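/- Let $\mathbf T^2$ be the torus of side length $2\pi$, $e_k(x)=\frac1{2\pi}e^{ik\cdot x}$ and $a_k=\mathrm{Re}\,e_k$, $b_k=\mathrm{Im}\,e_k$ for $k\in\mathbf Z^2$, and let $\mathbf Z^2_0=\mathbf Z^2\setminus\{0\}$. Let $\eta$ be mean-zero spatial white noise, i.e. a centred Gaussian process indexed by the mean-zero real functions in $L^2(\mathbf T^2)$ with $\mathbf E[\eta(\varphi)\eta(\psi)]=\langle\varphi,\psi\rangle$, and let $\eta_k=\eta(a_k)-i\,\eta(b_k)$ for $k\in\mathbf Z_0^2$, $\eta_0=0$, be its Fourier components. Let $N\in\mathbf N$ and $\nu_N,\lambda_N>0$. For $\ell,m\in\mathbf Z_0^2$ put $$\mathcal K^N_{\ell,m}=|\ell+m|\,\frac{\ell_2m_2-\ell_1m_1}{|\ell||m|}\,\mathbf 1_{|\ell|_\infty\le N,\ |m|_\infty\le N,\ |\ell+m|_\infty\le N},$$ and $\mathcal N^N_k[v]=\sum_{\ell+m=k}\mathcal K^N_{\ell,m}v_\ell v_m$ (sum over $\ell,m\in\mathbf Z^2_0$). Consider the system of SDEs $$du^N_k=\Big(-\tfrac{\nu_N}{2}|k|^2u^N_k+\lambda_N\mathcal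 N^N_k[u^N]\Big)dt+\nu_N^{1/2}|k|\,dB_k(t),\qquad k\in\mathbf Z_0^2,$$ for $u^N_{-k}=\overline{u^N_k}$ (and $u^N_0=0$), where the $B_k$ are jointly Gaussian complex Brownian motions with $B_{-k}=\overline{B_k}$ and $d\langle B_k,B_\ell\rangle_t=\mathbf 1_{k+\ell=0}\,dt$. Let $F$ be a real cylinder function, i.e. a smooth function of finitely many Fourier components all of whose derivatives grow at most polynomially, and let $D_kF=\langle DF,e_k\rangle$ with the Hermitian scalar product of $L^2(\mathbf T^2;\mathbf C)$, i.e. $D_kF=D_{a_k}F-i\,D_{b_k}F$, so that $D_{-k}$ is differentiation with respect to $v_k$. The generator of the system is $$\mathcal L^NF(v)=\sum_{k\in\mathbf Z_0^2}\Big(-\tfrac{\nu_N}{2}|k|^2v_k+\lambda_N\mathcal N^N_k[v]\Big)D_{-k}F(v)+\tfrac12\sum_{k,\ell\in\mathbf Z_0^2}\nu_N|k||\ell|\mathbf 1_{k+\ell=0}\,D_{-k}D_{-\ell}F(v).$$ Put $$\mathcal L_0^NF(v)=\frac{\nu_N}2\sum_{k\in\mathbf Z^2}|k|^2\big(-v_{-k}D_k+D_{-k}D_k\big)F(v),\qquad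 \mathcal A^NF(v)=\lambda_N\sum_{m,\ell\in\mathbf Z^2_0}\mathcal K^N_{m,\ell}\,v_mv_\ell\,D_{-m-\ell}F(v).$$ Then: 1. White noise is invariant for the system: on any filtered probability space carrying such $(B_k)$, every time-zero measurable initial condition with the law of $(\eta_k)_k$ is the starting point of a global continuous adapted solution, and every such solution $u^N$ whose initial law is that of $(\eta_k)_k$ has the law of $(\eta_k)_k$ at every time $t\ge0$. 2. On cylinder functions $\mathcal L^N=\mathcal L^N_0+\mathcal A^N$; cylinder functions $F$ are in $L^2(\eta)$, the operators $\mathcal L^N,\mathcal L^N_0,\mathcal A^N$ map them to real elements of $L^2(\eta)$, and $\mathcal L_0^N$ and $\mathcal A^N$ are the symmetric and antisymmetric parts of $\mathcal L^N$ in $L^2(\eta)$: for all cylinder functions $F,G$, $$\mathbf E[\mathcal L_0^NF(\eta)\,G(\eta)]=\tfrac12\big(\mathbf E[\mathcal L^NF(\eta)\,G(\eta)]+\mathbf E[F(\eta)\,\mathcal L^NG(\eta)]\big),$$ $$\mathbf E[\mathcal A^NF(\eta)\,G(\eta)]=\tfrac12\big(\mathbf E[\mathcal L^NF(\eta)\,G(\eta)]-\mathbf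 E[F(\eta)\,\mathcal L^NG(\eta)]\big).$$ 3. For every family of complex numbers $(v_k)_{k\in\mathbf Z^2}$, $$\sum_{m,\ell\in\mathbf Z_0^2}\mathcal K^N_{m,\ell}\,v_mv_\ell v_{-m-\ell}=0.$$ -/

import Mathlib

open MeasureTheory ProbabilityTheory
open scoped NNReal ComplexConjugate

universe u w

noncomputable section

namespace AKPZ

/-! ### The torus of side length `2π`, its Fourier basis, and spatial white noise -/

instance fact_two_pi_pos : Fact (0 < 2 * Real.pi) := ⟨Real.two_pi_pos⟩

/-- The two-dimensional torus of side length `2π`, with Lebesgue measure (total mass `(2π)²`). -/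
abbrev Torus : Type := AddCircle (2 * Real.pi) × AddCircle (2 * Real.pi)

/-- Fourier modes: the lattice `ℤ²`. -/
abbrev Mode : Type := ℤ × ℤ

/-- The Fourier basis function `e_k(x) = (2π)⁻¹ exp(i k · x)`. -/
def e (k : Mode) (x : Torus) : ℂ :=
  ((2 * Real.pi)⁻¹ : ℝ) * (fourier k.1 x.1 * fourier k.2 x.2)

theorem e_continuous (k : Mode) : Continuous (e k) := by
  unfold e; fun_prop

theorem integral_e (k : Mode) (hk : k ≠ 0) : ∫ x, e k x = 0 := by
  have key : ∀ n : ℤ, n ≠ 0 →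
      ∫ y : AddCircle (2 * Real.pi), (fourier n y : ℂ) = 0 := fun n hn =>
    integral_eq_zero_of_add_right_eq_neg
      (fourier_add_half_inv_index hn Real.two_pi_pos)
  unfold e
  rw [integral_const_mul, Measure.volume_eq_prod,
    integral_prod_mul (fun y : AddCircle (2 * Real.pi) => (fourier k.1 y : ℂ))
      (fun y : AddCircle (2 * Real.pi) => (fourier k.2 y : ℂ))]
  by_cases h1 : k.1 = 0
  · have h2 : k.2 ≠ 0 := fun h2 => hk (Prod.ext h1 h2)
    rw [key _ h2]; simp
  · rw [key _ h1]; simp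

/-- The real Hilbert space `L²₀(𝕋²)` of mean-zero square integrable functions. -/
def L20 : Submodule ℝ (Lp ℝ 2 (volume : Measure Torus)) where
  carrier := {f | ∫ x, f x = 0}
  zero_mem' := by
    show ∫ x, (0 : Lp ℝ 2 (volume : Measure Torus)) x = 0
    rw [integral_congr_ae (Lp.coeFn_zero ℝ 2 volume)]
    simp
  add_mem' := by
    intro f g hf hg
    show ∫ x, (f + g) x = 0
    rw [integral_congr_ae (Lp.coeFn_add f g)]
    have h1 : Integrable f := (Lp.memLp f).integrable one_le_two
    have h2 : Integrable g := (Lp.memLp g).integrable one_le_two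
    simp only [Pi.add_apply]
    rw [integral_add h1 h2, show ∫ x, f x = 0 from hf, show ∫ x, g x = 0 from hg, add_zero]
  smul_mem' := by
    intro c f hf
    show ∫ x, (c • f) x = 0
    rw [integral_congr_ae (Lp.coeFn_smul c f)]
    simp only [Pi.smul_apply]
    rw [integral_smul, show ∫ x, f x = 0 from hf, smul_zero]

theorem memLp_of_continuous (f : Torus → ℝ) (hf : Continuous f) : MemLp f 2 volume :=
  hf.memLp_of_hasCompactSupport (HasCompactSupport.of_compactSpace f)

/-- `a_k = Re e_k` as an element of `L²₀(𝕋²)`, for `k ≠ 0`. -/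
def aVec (k : Mode) (hk : k ≠ 0) : L20 :=
  ⟨(memLp_of_continuous (fun x => (e k x).re)
      (Complex.continuous_re.comp (e_continuous k))).toLp, by
    show ∫ x, _ = (0 : ℝ)
    rw [integral_congr_ae (MemLp.coeFn_toLp _)]
    have hi : Integrable (e k) :=
      (e_continuous k).integrable_of_hasCompactSupport (HasCompactSupport.of_compactSpace _)
    have := integral_re hi
    simp only [RCLike.re_eq_complex_re] at this
    rw [this, integral_e k hk, Complex.zero_re]⟩

/-- `b_k = Im e_k` as an element of `L²₀(𝕋²)`, for `k ≠ 0`. -/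
def bVec (k : Mode) (hk : k ≠ 0) : L20 :=
  ⟨(memLp_of_continuous (fun x => (e k x).im)
      (Complex.continuous_im.comp (e_continuous k))).toLp, by
    show ∫ x, _ = (0 : ℝ)
    rw [integral_congr_ae (MemLp.coeFn_toLp _)]
    have hi : Integrable (e k) :=
      (e_continuous k).integrable_of_hasCompactSupport (HasCompactSupport.of_compactSpace _)
    have := integral_im hi
    simp only [RCLike.im_eq_complex_im] at this
    rw [this, integral_e k hk, Complex.zero_im]⟩

/-- An isonormal Gaussian process on a real Hilbert space `H`: a centred Gaussian process
indexed by `H` with `E[η(h) η(g)] = ⟨h, g⟩`. -/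
structure IsIsonormal {H Ω : Type*} [NormedAddCommGroup H] [InnerProductSpace ℝ H]
    [MeasurableSpace Ω] (P : Measure Ω) (η : H → Ω → ℝ) : Prop where
  gaussian : IsGaussianProcess η P
  centred : ∀ h, ∫ ω, η h ω ∂P = 0
  covariance : ∀ h g, ∫ ω, η h ω * η g ω ∂P = inner ℝ h g

/-- Mean-zero spatial white noise on the torus: the isonormal Gaussian process on `L²₀(𝕋²)`. -/
abbrev IsWhiteNoise {Ω : Type*} [MeasurableSpace Ω] (P : Measure Ω) (η : L20 → Ω → ℝ) : Prop :=
  IsIsonormal P η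

/-- The family of Fourier components of white noise,
`η_k = η(a_k) - i η(b_k)` for `k ≠ 0`, and `η_0 = 0`. -/
def modes {Ω : Type*} (η : L20 → Ω → ℝ) (ω : Ω) : Mode → ℂ := fun k =>
  if hk : k = 0 then 0 else (η (aVec k hk) ω : ℂ) - Complex.I * (η (bVec k hk) ω : ℂ)

/-! ### The Fourier system of SDEs -/

/-- The Euclidean norm `|k|`. -/
def eucl (k : Mode) : ℝ := Real.sqrt ((k.1 : ℝ) ^ 2 + (k.2 : ℝ) ^ 2)

/-- `|k|_∞ ≤ N`. -/
def SupLe (N : ℕ) (k : Mode) : Prop := |k.1| ≤ (N : ℤ) ∧ |k.2| ≤ (N : ℤ)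

open Classical in
/-- The coefficient
`K^N_{ℓ,m} = |ℓ+m| (ℓ₂ m₂ - ℓ₁ m₁) / (|ℓ||m|) 1{|ℓ|_∞ ≤ N, |m|_∞ ≤ N, |ℓ+m|_∞ ≤ N}` for
`ℓ, m ∈ ℤ² \ {0}`. It is extended by `0` when `ℓ = 0` or `m = 0`, so that sums over `ℤ² \ {0}`
can be written as sums over `ℤ²`; all these sums have finite support. -/
def K (N : ℕ) (l m : Mode) : ℝ :=
  if l ≠ 0 ∧ m ≠ 0 ∧ SupLe N l ∧ SupLe N m ∧ SupLe N (l + m) then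
    eucl (l + m) * ((l.2 : ℝ) * m.2 - (l.1 : ℝ) * m.1) / (eucl l * eucl m)
  else 0

/-- The `k`-th Fourier component of the nonlinearity, `∑_{ℓ+m=k} K^N_{ℓ,m} v_ℓ v_m`. -/
def nonlin (N : ℕ) (v : Mode → ℂ) (k : Mode) : ℂ :=
  ∑' l : Mode, (K N l (k - l) : ℂ) * v l * v (k - l)

/-- The drift of the `k`-th equation. -/
def drift (N : ℕ) (ν lam : ℝ) (v : Mode → ℂ) (k : Mode) : ℂ :=
  -((ν / 2 * eucl k ^ 2 : ℝ) : ℂ) * v k + (lam : ℂ) * nonlin N v k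

/-- Complex Brownian motions `B_k(t) = ∫₀ᵗ ξ_k(s) ds`, `k ∈ ℤ²`, relative to a filtration `ℱ`,
with `ξ` a mean-zero space-time white noise: `B_{-k}` is the conjugate of `B_k`, and
`d⟨B_k, B_ℓ⟩_t = 1{k+ℓ=0} dt` for `k, ℓ ≠ 0` (while `B_0 = 0` almost surely). -/
structure IsNoise {Ω : Type*} [mΩ : MeasurableSpace Ω] (P : Measure Ω) (ℱ : Filtration ℝ≥0 mΩ)
    (B : ℝ≥0 → Ω → Mode → ℂ) : Prop where
  adapted : ∀ t, Measurable[ℱ t] (B t)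
  zero : ∀ ω, B 0 ω = 0
  continuous : ∀ ω k, Continuous fun t => B t ω k
  conj_symm : ∀ t ω k, B t ω (-k) = conj (B t ω k)
  gaussian : ∀ s t, s ≤ t → IsGaussianProcess (fun k ω => B t ω k - B s ω k) P
  centred : ∀ s t k, s ≤ t → ∫ ω, (B t ω k - B s ω k) ∂P = 0
  covariance : ∀ (s t : ℝ≥0) (k l : Mode), s ≤ t →
    ∫ ω, (B t ω k - B s ω k) * (B t ω l - B s ω l) ∂P =
      if k ≠ 0 ∧ k + l = 0 then ((t - s : ℝ) : ℂ) else 0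
  indep : ∀ s t, s ≤ t →
    Indep (MeasurableSpace.comap (fun ω k => B t ω k - B s ω k) inferInstance) (ℱ s) P

/-- `u` is a (global, continuous, adapted, real) solution of
`du_k = (-ν/2 |k|² u_k + λ N_k[u]) dt + ν^{1/2} |k| dB_k(t)`, `k ∈ ℤ² \ {0}`.
Here "real" means that `(u_k)_k` is the family of Fourier components of a real object; the
zeroth component vanishes. -/
structure IsSolution {Ω : Type*} [mΩ : MeasurableSpace Ω] (P : Measure Ω)
    (ℱ : Filtration ℝ≥0 mΩ) (B : ℝ≥0 → Ω → Mode → ℂ) (N : ℕ) (ν lam : ℝ)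
    (u : ℝ≥0 → Ω → Mode → ℂ) : Prop where
  adapted : ∀ t, Measurable[ℱ t] (u t)
  continuous : ∀ᵐ ω ∂P, ∀ k, Continuous fun t => u t ω k
  real : ∀ᵐ ω ∂P, ∀ t k, u t ω (-k) = conj (u t ω k)
  zero_mode : ∀ᵐ ω ∂P, ∀ t, u t ω 0 = 0
  equation : ∀ᵐ ω ∂P, ∀ k, k ≠ 0 → ∀ t : ℝ≥0,
    u t ω k = u 0 ω k + (∫ s in (0 : ℝ)..t, drift N ν lam (u s.toNNReal ω) k)
      + ((Real.sqrt ν * eucl k : ℝ) : ℂ) * B t ω k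

/-- The probability measure `μ` is invariant for the system of SDEs: on every filtered probability
space with driving noise, every initial condition with law `μ` is the starting point
of a global solution, and every solution with initial law `μ` has law `μ` at all times. -/
def IsInvariant (N : ℕ) (ν lam : ℝ) (μ : Measure (Mode → ℂ)) : Prop :=
  ∀ (Ω : Type w) [mΩ : MeasurableSpace Ω] (P : Measure Ω) [IsProbabilityMeasure P]
    (ℱ : Filtration ℝ≥0 mΩ) (B : ℝ≥0 → Ω → Mode → ℂ), IsNoise P ℱ B →
    (∀ u₀ : Ω → Mode → ℂ, Measurable[ℱ 0] u₀ → P.map u₀ = μ →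
      ∃ u, IsSolution P ℱ B N ν lam u ∧ ∀ᵐ ω ∂P, u 0 ω = u₀ ω) ∧
    (∀ u, IsSolution P ℱ B N ν lam u → P.map (u 0) = μ → ∀ t, P.map (u t) = μ)

/-! ### Cylinder functions and the generator -/

/-- Real cylinder functions depending on finitely many Fourier components: `F(v) = f((v_k)_{k ∈ S})`
with `S` finite and `f` smooth, all derivatives of `f` growing at most polynomially. -/
def IsCylinder (F : (Mode → ℂ) → ℝ) : Prop :=
  ∃ (S : Finset Mode) (f : (S → ℂ) → ℝ), f.HasTemperateGrowth ∧ ∀ v, F v = f (fun k => v k)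

/-- The Fourier components of `a_k = (e_k + e_{-k}) / 2`. -/
def aDir (k : Mode) : Mode → ℂ := fun j =>
  ((if j = k then 1 else 0) + (if j = -k then 1 else 0)) / 2

/-- The Fourier components of `b_k = (e_k - e_{-k}) / (2i)`. -/
def bDir (k : Mode) : Mode → ℂ := fun j =>
  ((if j = k then 1 else 0) - (if j = -k then 1 else 0)) / (2 * Complex.I)

/-- `D_k F = ⟨DF, e_k⟩ = D_{a_k} F - i D_{b_k} F`, the scalar product being antilinear
in the second argument; it is the Wirtinger-type derivative `∂F/∂v_{-k}`. -/
def D (k : Mode) (F : (Mode → ℂ) → ℂ) (v : Mode → ℂ) : ℂ :=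
  lineDeriv ℝ F v (aDir k) - Complex.I * lineDeriv ℝ F v (bDir k)

/-- The generator of the system of SDEs, on cylinder functions, read off from the coefficients:
drift times first derivatives plus one half of the covariation rates
`d⟨ν^{1/2}|k| B_k, ν^{1/2}|ℓ| B_ℓ⟩_t / dt` times second derivatives, where
`D_{-k}` is the derivative with respect to `v_k`. -/
def gen (N : ℕ) (ν lam : ℝ) (F : (Mode → ℂ) → ℝ) (v : Mode → ℂ) : ℂ :=
  (∑' k : Mode, if k = 0 then 0 else drift N ν lam v k * D (-k) (fun w => (F w : ℂ)) v) +
  1 / 2 * ∑' p : Mode × Mode,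
    (if p.1 ≠ 0 ∧ p.1 + p.2 = 0 then ((ν * eucl p.1 * eucl p.2 : ℝ) : ℂ) else 0) *
      D (-p.1) (D (-p.2) (fun w => (F w : ℂ))) v

/-- `L₀ F(v) = ν/2 ∑_k |k|² (-v_{-k} D_k + D_{-k} D_k) F(v)`. -/
def genS (ν : ℝ) (F : (Mode → ℂ) → ℝ) (v : Mode → ℂ) : ℂ :=
  ((ν / 2 : ℝ) : ℂ) * ∑' k : Mode, ((eucl k ^ 2 : ℝ) : ℂ) *
    (-v (-k) * D k (fun w => (F w : ℂ)) v + D (-k) (D k (fun w => (F w : ℂ))) v)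

/-- `A^N F(v) = λ ∑_{m,ℓ} K^N_{m,ℓ} v_m v_ℓ D_{-m-ℓ} F(v)`. -/
def genA (N : ℕ) (lam : ℝ) (F : (Mode → ℂ) → ℝ) (v : Mode → ℂ) : ℂ :=
  (lam : ℂ) * ∑' p : Mode × Mode,
    (K N p.1 p.2 : ℂ) * v p.1 * v p.2 * D (-p.1 - p.2) (fun w => (F w : ℂ)) v

/-- An operator `T` on real cylinder functions is well defined in `L²(μ)`: it maps cylinder functions
to square integrable, almost surely real random variables. -/
def MapsToL2 (μ : Measure (Mode → ℂ)) (T : ((Mode → ℂ) → ℝ) → (Mode → ℂ) → ℂ) : Prop :=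
  ∀ F, IsCylinder F → MemLp (T F) 2 μ ∧ ∀ᵐ v ∂μ, (T F v).im = 0

/-- `S` is the symmetric part of `T` in `L²(μ)` on cylinder functions: `S = (T + T*) / 2`, tested
against cylinder functions. -/
def IsSymmetricPart (μ : Measure (Mode → ℂ)) (T S : ((Mode → ℂ) → ℝ) → (Mode → ℂ) → ℂ) : Prop :=
  ∀ F G, IsCylinder F → IsCylinder G →
    ∫ v, S F v * (G v : ℂ) ∂μ =
      (∫ v, T F v * (G v : ℂ) ∂μ + ∫ v, (F v : ℂ) * T G v ∂μ) / 2

/-- `A` is the antisymmetric part of `T` in `L²(μ)` on cylinder functions: `A = (T - T*) / 2`, tested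
against cylinder functions. -/
def IsAntisymmetricPart (μ : Measure (Mode → ℂ))
    (T A : ((Mode → ℂ) → ℝ) → (Mode → ℂ) → ℂ) : Prop :=
  ∀ F G, IsCylinder F → IsCylinder G →
    ∫ v, A F v * (G v : ℂ) ∂μ =
      (∫ v, T F v * (G v : ℂ) ∂μ - ∫ v, (F v : ℂ) * T G v ∂μ) / 2

end AKPZ

end

/-! Two cancellations carry the theorem. On triads l + m + n = 0 the cyclic sum of the coefficients
vanishes, because multiplied by |l||m||n| it is a polynomial identity (`K_cyclic`). Cyclic
relabelling does not change v_l v_m v_n, so three times the triad sum is zero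
(`tsum_triad_eq_zero`); for real fields the nonlinearity is therefore orthogonal to v. It is
moreover divergence free (`divergence_field`). A vector field with both properties preserves
Lebesgue measure and the Gaussian weight.

Real fields are described by the Hartley coordinates g_k = Re v_k + Im v_k. They are unconstrained
real numbers, they turn the pairing of v_{-k} with w_k over a symmetric box into a Euclidean inner
product (`sum_ofHartley_pairing`), and they turn white noise into independent standard Gaussians
(`map_hart_eq_pi`). In every box of size M ≥ N the system is a closed finite-dimensional equation
with drift -D_i x_i / 2 + X_i(x) and additive noise of variance rate D_i.

Additive noise allows a pathwise treatment as an integral equation, without stochastic calculus.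
Consistent one-step schemes converge along each path (`tendsto_scheme`). The Euler scheme gives
uniqueness and adaptedness; existence comes from the ordinary differential equation for u - W and an
energy bound. Invariance follows from a splitting scheme: an Euler step along the truncated X
changes the Gaussian measure by o(h) in total variation (`integral_euler_sub_le`), and contracting
and adding the noise increment restores it exactly (`stdGauss_prod_map`). Over T/h steps the error
is o(1), so the limit is Gaussian (`map_eq_stdGauss`); finite-dimensional marginals determine the
full law.

For the generator, L_0 becomes an Ornstein-Uhlenbeck operator and A the derivative along X. Gaussian
integration by parts makes the first symmetric (`integral_ouGen_mul_comm`) and, by the same two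
cancellations, the second antisymmetric (`integral_transport_mul_comm`). -/

noncomputable section

namespace AKPZ

open Set Filter Topology

/-! ### Integral equations with additive forcing, and their one-step approximations -/

section Scheme

variable {E : Type*} [NormedAddCommGroup E]

/-- `b` is Lipschitz on bounded sets. -/
def LipschitzOnBalls (b : E → E) : Prop :=
  ∀ M : ℝ, ∃ K : ℝ≥0, LipschitzOnWith K b (Metric.closedBall 0 M)

theorem LipschitzOnBalls.continuous {b : E → E} (hb : LipschitzOnBalls b) : Continuous b := by
  rw [continuous_iff_continuousAt]
  intro x
  obtain ⟨K, hK⟩ := hb (‖x‖ + 1)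
  refine hK.continuousOn.continuousAt ?_
  refine Filter.mem_of_superset (Metric.closedBall_mem_nhds x one_pos) fun y hy => ?_
  rw [Metric.mem_closedBall, dist_eq_norm] at hy
  rw [mem_closedBall_zero_iff]
  linarith [norm_le_norm_add_norm_sub x y, norm_sub_rev x y]

variable [NormedSpace ℝ E]

/-- `u` is continuous on `[0, T]` and solves `u(t) = u(0) + ∫₀ᵗ b(u(s)) ds + W(t)` there. -/
def SolvesOn (b : E → E) (W u : ℝ → E) (T : ℝ) : Prop :=
  ContinuousOn u (Icc 0 T) ∧ ∀ t ∈ Icc 0 T, u t = u 0 + (∫ s in (0 : ℝ)..t, b (u s)) + W t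

/-- The iteration `y_{j+1} = Φ(y_j) + Δ_j`. -/
def scheme (Φ : E → E) (Δ : ℕ → E) (x : E) : ℕ → E
  | 0 => x
  | j + 1 => Φ (scheme Φ Δ x j) + Δ j

/-- The `j`-th increment of `W` on the grid of mesh `h`. -/
def gridIncrement (W : ℝ → E) (h : ℝ) (j : ℕ) : E := W ((j + 1 : ℕ) * h) - W (j * h)

theorem SolvesOn.mono {b : E → E} {W u : ℝ → E} {S T : ℝ} (h : SolvesOn b W u T) (hST : S ≤ T) :
    SolvesOn b W u S :=
  ⟨h.1.mono (Icc_subset_Icc_right hST), fun t ht => h.2 t ⟨ht.1, ht.2.trans hST⟩⟩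

theorem SolvesOn.intervalIntegrable {b : E → E} (hb : Continuous b) {W u : ℝ → E} {T : ℝ}
    (h : SolvesOn b W u T) {s t : ℝ} (hs : s ∈ Icc 0 T) (ht : t ∈ Icc 0 T) :
    IntervalIntegrable (fun r => b (u r)) volume s t := by
  apply ContinuousOn.intervalIntegrable
  exact hb.comp_continuousOn (h.1.mono (ordConnected_Icc.uIcc_subset hs ht))

theorem SolvesOn.sub_eq {b : E → E} (hb : Continuous b) {W u : ℝ → E} {T : ℝ}
    (h : SolvesOn b W u T) {s t : ℝ} (hs : s ∈ Icc 0 T) (ht : t ∈ Icc 0 T) :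
    u t = u s + (∫ r in s..t, b (u r)) + (W t - W s) := by
  have h0 : (0 : ℝ) ∈ Icc 0 T := ⟨le_rfl, hs.1.trans hs.2⟩
  rw [← intervalIntegral.integral_interval_sub_left (h.intervalIntegrable hb h0 ht)
    (h.intervalIntegrable hb h0 hs)]
  have e1 := h.2 t ht
  have e2 := h.2 s hs
  rw [e1, add_sub, eq_sub_of_add_eq (eq_sub_of_add_eq e2.symm)]
  abel

/-- A discrete Gronwall argument with a bootstrap: the Lipschitz constant is available only on the
ball of radius M + 1, and `hsmall` keeps the accumulated error below 1, so the scheme never leaves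
that ball. -/
theorem norm_scheme_sub_le [CompleteSpace E] {b : E → E} (hbc : Continuous b) {W u : ℝ → E} {T : ℝ}
    (hu : SolvesOn b W u T) {Φ : E → E} {n : ℕ} {h ε δ M : ℝ} {K : ℝ≥0} (hh : 0 ≤ h)
    (hnT : n * h = T) (hε : 0 ≤ ε) (hδ : 0 ≤ δ)
    (hM : ∀ s ∈ Icc 0 T, ‖u s‖ ≤ M)
    (hb : LipschitzOnWith K b (Metric.closedBall 0 (M + 1)))
    (hΦ : ∀ v ∈ Metric.closedBall (0 : E) (M + 1), ‖Φ v - v - h • b v‖ ≤ h * ε)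
    (hmod : ∀ s ∈ Icc 0 T, ∀ t ∈ Icc 0 T, |s - t| ≤ h → ‖u s - u t‖ ≤ δ)
    (hsmall : T * (ε + K * δ) * Real.exp (K * T) ≤ 1) :
    ∀ j ≤ n, ‖scheme Φ (gridIncrement W h) (u 0) j - u (j * h)‖ ≤
      (j * h) * (ε + K * δ) * Real.exp (K * (j * h)) := by
  intro j
  induction j with
  | zero => simp [scheme]
  | succ j ih =>
    intro hj
    have hjn : j ≤ n := by omega
    have ih := ih hjn
    set y := scheme Φ (gridIncrement W h) (u 0) j with hy
    have hjT : (j : ℝ) * h ∈ Icc 0 T :=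
      ⟨by positivity, hnT ▸ mul_le_mul_of_nonneg_right (by exact_mod_cast hjn) hh⟩
    have hj1T : ((j + 1 : ℕ) : ℝ) * h ∈ Icc 0 T :=
      ⟨by positivity, hnT ▸ mul_le_mul_of_nonneg_right (by exact_mod_cast hj) hh⟩
    have hle1 : ‖y - u (j * h)‖ ≤ 1 := by
      refine ih.trans (le_trans ?_ hsmall)
      have : 0 ≤ T := hjT.1.trans hjT.2
      gcongr
      · exact hjT.2
      · exact hjT.2
    have huM : ∀ s ∈ Icc 0 T, u s ∈ Metric.closedBall (0 : E) (M + 1) := fun s hs => by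
      rw [mem_closedBall_zero_iff]; linarith [hM s hs]
    have hyM : y ∈ Metric.closedBall (0 : E) (M + 1) := by
      rw [mem_closedBall_zero_iff]
      have := norm_le_norm_add_norm_sub (u (j * h)) y
      linarith [hM _ hjT, norm_sub_rev (u (j * h)) y]
    -- The noise increments cancel exactly. What remains is the old error, its propagation by the
    -- drift, the consistency error of the step, and the error of freezing the drift at the left
    -- endpoint.
    have e1 : scheme Φ (gridIncrement W h) (u 0) (j + 1) - u ((j + 1 : ℕ) * h) =
        (y - u (j * h)) + h • (b y - b (u (j * h))) + (Φ y - y - h • b y)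
          - ∫ r in (j * h)..((j + 1 : ℕ) * h), (b (u r) - b (u (j * h))) := by
      have e2 : ∫ r in (j * h)..((j + 1 : ℕ) * h), (b (u r) - b (u (j * h))) =
          (∫ r in (j * h)..((j + 1 : ℕ) * h), b (u r)) - h • b (u (j * h)) := by
        rw [intervalIntegral.integral_sub (hu.intervalIntegrable hbc hjT hj1T) (by simp),
          intervalIntegral.integral_const]
        congr 2
        push_cast; ring
      rw [e2, hu.sub_eq hbc hjT hj1T]
      simp only [scheme, gridIncrement, ← hy, smul_sub]
      abel
    have e3 : ‖∫ r in (j * h)..((j + 1 : ℕ) * h), (b (u r) - b (u (j * h)))‖ ≤ K * δ * h := by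
      have hle : (j : ℝ) * h ≤ (j + 1 : ℕ) * h := by push_cast; nlinarith
      have := intervalIntegral.norm_integral_le_of_norm_le_const (a := (j : ℝ) * h)
        (b := (j + 1 : ℕ) * h) (C := K * δ) (f := fun r => b (u r) - b (u (j * h))) (fun r hr => by
          rw [uIoc_of_le hle] at hr
          have hrT : r ∈ Icc 0 T := ⟨hjT.1.trans hr.1.le, hr.2.trans hj1T.2⟩
          refine (hb.norm_sub_le (huM _ hrT) (huM _ hjT)).trans ?_
          gcongr
          refine hmod _ hrT _ hjT ?_
          rw [abs_of_nonneg (by linarith [hr.1])]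
          have := hr.2
          push_cast at this
          linarith)
      refine this.trans (le_of_eq ?_)
      rw [abs_of_nonneg (by linarith)]
      push_cast; ring
    have e4 : ‖h • (b y - b (u (j * h)))‖ ≤ h * (K * ‖y - u (j * h)‖) := by
      rw [norm_smul, Real.norm_of_nonneg hh]
      gcongr
      exact hb.norm_sub_le hyM (huM _ hjT)
    have e5 : ‖scheme Φ (gridIncrement W h) (u 0) (j + 1) - u ((j + 1 : ℕ) * h)‖ ≤
        (1 + K * h) * ‖y - u (j * h)‖ + h * (ε + K * δ) := by
      rw [e1]
      refine (norm_sub_le _ _).trans ?_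
      refine (add_le_add (norm_add₃_le) e3).trans ?_
      linarith [hΦ y hyM, e4]
    have e6 : 1 + K * h ≤ Real.exp (K * h) := by linarith [Real.add_one_le_exp (K * h)]
    have e7 : Real.exp (K * ((j + 1 : ℕ) * h)) = Real.exp (K * h) * Real.exp (K * (j * h)) := by
      rw [← Real.exp_add]; congr 1; push_cast; ring
    have e8 : 1 ≤ Real.exp (K * ((j + 1 : ℕ) * h)) := Real.one_le_exp (by positivity)
    calc _ ≤ (1 + K * h) * ‖y - u (j * h)‖ + h * (ε + K * δ) := e5
      _ ≤ Real.exp (K * h) * ((j * h) * (ε + K * δ) * Real.exp (K * (j * h)))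
          + h * (ε + K * δ) * Real.exp (K * ((j + 1 : ℕ) * h)) := by
        refine add_le_add ?_ (le_mul_of_one_le_right (by positivity) e8)
        exact mul_le_mul e6 ih (norm_nonneg _) (Real.exp_pos _).le
      _ = _ := by rw [e7]; push_cast; ring

/-- Consistent one-step schemes converge to the solution of the integral equation. -/
theorem tendsto_scheme [CompleteSpace E] {b : E → E} (hb : LipschitzOnBalls b) {W u : ℝ → E} {T : ℝ}
    (hT : 0 < T) (hu : SolvesOn b W u T) {M : ℝ} (hM : ∀ s ∈ Icc 0 T, ‖u s‖ ≤ M) {Φ : ℕ → E → E}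
    (hΦ : ∀ ε > 0, ∀ᶠ n : ℕ in atTop, ∀ v ∈ Metric.closedBall (0 : E) (M + 1),
      ‖Φ n v - v - (T / n) • b v‖ ≤ T / n * ε) :
    Tendsto (fun n : ℕ => scheme (Φ n) (gridIncrement W (T / n)) (u 0) n) atTop
      (𝓝 (u T)) := by
  obtain ⟨K, hK⟩ := hb (M + 1)
  rw [Metric.tendsto_nhds]
  intro η hη
  set A : ℝ := T * Real.exp (K * T) with hA
  have hApos : 0 < A := by positivity
  -- The same ε serves as consistency error and as modulus of continuity of u over one step; the
  -- bound by 1 feeds the bootstrap, the bound by η is the goal.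
  obtain ⟨ε, hε, hεs⟩ : ∃ ε > 0, A * (ε + K * ε) < min η 1 := by
    refine ⟨min η 1 / (2 * A * (1 + K)), by positivity, ?_⟩
    have : A * (min η 1 / (2 * A * (1 + K)) + K * (min η 1 / (2 * A * (1 + K)))) = min η 1 / 2 := by
      field_simp
    rw [this]
    exact half_lt_self (by positivity)
  have huc : UniformContinuousOn u (Icc 0 T) := isCompact_Icc.uniformContinuousOn_of_continuous hu.1
  rw [Metric.uniformContinuousOn_iff] at huc
  obtain ⟨d, hd, hdu⟩ := huc ε hε
  have hlim : Tendsto (fun n : ℕ => T / (n : ℝ)) atTop (𝓝[>] 0) := by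
    refine tendsto_nhdsWithin_iff.2 ⟨tendsto_const_div_atTop_nhds_zero_nat T, ?_⟩
    filter_upwards [eventually_gt_atTop 0] with n hn
    exact div_pos hT (by exact_mod_cast hn)
  filter_upwards [hΦ ε hε, hlim.eventually (Ioo_mem_nhdsGT hd),
    eventually_gt_atTop 0] with n hn1 hn2 hn3
  have hn0 : (n : ℝ) ≠ 0 := by positivity
  have hnT : (n : ℝ) * (T / n) = T := by field_simp
  have hs : T * (ε + K * ε) * Real.exp (K * T) < min η 1 := by
    calc _ = A * (ε + K * ε) := by rw [hA]; ring
      _ < _ := hεs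
  have key := norm_scheme_sub_le hb.continuous hu (Φ := Φ n) (n := n) (h := T / n)
    (δ := ε) hn2.1.le hnT hε.le hε.le hM hK hn1 (fun s hs t ht hst => by
      rw [← dist_eq_norm]
      exact (hdu s hs t ht (by rw [Real.dist_eq]; exact hst.trans_lt hn2.2)).le)
    (hs.le.trans (min_le_right _ _)) n le_rfl
  rw [hnT] at key
  rw [dist_eq_norm]
  exact key.trans_lt (hs.trans_le (min_le_left _ _))

end Scheme

/-! ### Radial cutoffs and local Lipschitz bounds -/

section Cutoff

variable {ι : Type*} [Fintype ι]

/-- The squared Euclidean norm on `ι → ℝ`. -/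
def energy (x : ι → ℝ) : ℝ := ∑ i, x i ^ 2

theorem energy_nonneg (x : ι → ℝ) : 0 ≤ energy x := Finset.sum_nonneg fun _ _ => sq_nonneg _

theorem contDiff_energy {n : WithTop ℕ∞} : ContDiff ℝ n (energy : (ι → ℝ) → ℝ) := by
  unfold energy; fun_prop

theorem sq_norm_le_energy (x : ι → ℝ) : ‖x‖ ^ 2 ≤ energy x := by
  have : ‖x‖ ≤ Real.sqrt (energy x) := by
    refine (pi_norm_le_iff_of_nonneg (Real.sqrt_nonneg _)).2 fun i => Real.le_sqrt_of_sq_le ?_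
    rw [Real.norm_eq_abs, sq_abs]
    exact Finset.single_le_sum (f := fun i => x i ^ 2) (fun _ _ => sq_nonneg _) (Finset.mem_univ i)
  calc ‖x‖ ^ 2 ≤ Real.sqrt (energy x) ^ 2 := by gcongr
    _ = energy x := Real.sq_sqrt (energy_nonneg x)

theorem energy_le (x : ι → ℝ) : energy x ≤ Fintype.card ι * ‖x‖ ^ 2 := by
  calc energy x ≤ ∑ _i : ι, ‖x‖ ^ 2 := by
        refine Finset.sum_le_sum fun i _ => ?_
        rw [← sq_abs, ← Real.norm_eq_abs]
        exact pow_le_pow_left₀ (norm_nonneg _) (norm_le_pi_norm x i) 2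
    _ = _ := by simp

theorem energy_add_le (x y : ι → ℝ) : energy (x + y) ≤ 2 * energy x + 2 * energy y := by
  simp only [energy, Finset.mul_sum, ← Finset.sum_add_distrib, Pi.add_apply]
  exact Finset.sum_le_sum fun i _ => by nlinarith [sq_nonneg (x i - y i)]

/-- A smooth radial cutoff: `1` where the energy is at most `r`, `0` where it is at least `2r`. -/
def cutoff (r : ℝ) (x : ι → ℝ) : ℝ := Real.smoothTransition (2 - energy x / r)

theorem contDiff_cutoff (r : ℝ) {n : ℕ∞} : ContDiff ℝ n (cutoff r : (ι → ℝ) → ℝ) := by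
  unfold cutoff
  exact Real.smoothTransition.contDiff.comp
    (contDiff_const.sub (contDiff_energy.div_const r))

theorem cutoff_nonneg (r : ℝ) (x : ι → ℝ) : 0 ≤ cutoff r x := Real.smoothTransition.nonneg _

theorem cutoff_le_one (r : ℝ) (x : ι → ℝ) : cutoff r x ≤ 1 := Real.smoothTransition.le_one _

theorem cutoff_eq_one {r : ℝ} (hr : 0 < r) {x : ι → ℝ} (hx : energy x ≤ r) : cutoff r x = 1 := by
  apply Real.smoothTransition.one_of_one_le
  have : energy x / r ≤ 1 := (div_le_one hr).2 hx
  linarith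

theorem hasCompactSupport_cutoff {r : ℝ} (hr : 0 < r) :
    HasCompactSupport (cutoff r : (ι → ℝ) → ℝ) := by
  refine HasCompactSupport.of_support_subset_isCompact
    (isCompact_closedBall (0 : ι → ℝ) (Real.sqrt (2 * r))) fun x hx => ?_
  rw [mem_closedBall_zero_iff]
  refine Real.le_sqrt_of_sq_le ((sq_norm_le_energy x).trans ?_)
  by_contra! h
  refine hx (Real.smoothTransition.zero_of_nonpos ?_)
  have : 2 ≤ energy x / r := (le_div_iff₀ hr).2 h.le
  linarith

/-- A compactly supported C¹ map is globally Lipschitz, so it suffices to multiply by a cutoff equal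
to 1 on the ball. The norm is the sup norm, hence the factor `Fintype.card ι` in the energy radius;
the added 1 keeps that radius positive. -/
theorem lipschitzOnBalls_of_contDiff {b : (ι → ℝ) → ι → ℝ} (hb : ContDiff ℝ 1 b) :
    LipschitzOnBalls b := by
  intro M
  have hL : ContDiff ℝ 1 fun x => cutoff (Fintype.card ι * M ^ 2 + 1) x • b x :=
    (contDiff_cutoff _ (n := 1)).smul hb
  have hpos : 0 < (Fintype.card ι : ℝ) * M ^ 2 + 1 := by positivity
  obtain ⟨K, hK⟩ := hL.lipschitzWith_of_hasCompactSupport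
    ((hasCompactSupport_cutoff hpos).smul_right) one_ne_zero
  have h1 : ∀ x ∈ Metric.closedBall (0 : ι → ℝ) M,
      cutoff (Fintype.card ι * M ^ 2 + 1) x • b x = b x := by
    intro x hx
    rw [mem_closedBall_zero_iff] at hx
    have h2 : ‖x‖ ^ 2 ≤ M ^ 2 := by gcongr
    have h3 : energy x ≤ Fintype.card ι * M ^ 2 + 1 := by
      refine (energy_le x).trans ?_
      nlinarith [(Nat.cast_nonneg (Fintype.card ι) : (0 : ℝ) ≤ _)]
    rw [cutoff_eq_one hpos h3, one_smul]
  refine ⟨K, fun x hx y hy => ?_⟩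
  have := hK x y
  simpa only [h1 x hx, h1 y hy] using this

end Cutoff

/-! ### Pathwise existence, uniqueness and adaptedness with additive noise -/

section ODE

variable {ι : Type*} [Fintype ι]

/-- One-sided growth condition that prevents explosion of `z' = b(z + w)` for bounded `w`. -/
def Coercive (b : (ι → ℝ) → ι → ℝ) : Prop :=
  ∀ M : ℝ, ∃ C : ℝ, ∀ z w : ι → ℝ, ‖w‖ ≤ M → ∑ i, z i * b (z + w) i ≤ C * (1 + energy z)

/-- Gronwall in the form that (1 + energy) exp(-2Ct) has nonpositive derivative. -/
theorem energy_le_of_hasDerivAt {z z' : ℝ → ι → ℝ} {T C : ℝ}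
    (hc : ContinuousOn z (Icc 0 T)) (hz : ∀ t ∈ Ioo 0 T, HasDerivAt z (z' t) t)
    (hC : ∀ t ∈ Ioo 0 T, ∑ i, z t i * z' t i ≤ C * (1 + energy (z t))) {t : ℝ}
    (ht : t ∈ Icc 0 T) : 1 + energy (z t) ≤ (1 + energy (z 0)) * Real.exp (2 * C * t) := by
  have hd : ∀ t ∈ Ioo 0 T, HasDerivAt (fun t => (1 + energy (z t)) * Real.exp (-(2 * C * t)))
      ((2 * ∑ i, z t i * z' t i) * Real.exp (-(2 * C * t)) +
        (1 + energy (z t)) * (Real.exp (-(2 * C * t)) * (-(2 * C * 1)))) t := by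
    intro t ht
    have h1 : HasDerivAt (fun t => 1 + energy (z t)) (2 * ∑ i, z t i * z' t i) t := by
      unfold energy
      have := HasDerivAt.fun_sum (u := Finset.univ) (A := fun i t => z t i ^ 2)
        (A' := fun i => 2 * (z t i * z' t i)) (x := t) fun i _ => by
          have := (hasDerivAt_pi.1 (hz t ht) i).pow 2
          exact this.congr_deriv (by push_cast; ring)
      rw [← Finset.mul_sum] at this
      exact this.const_add 1
    exact h1.mul (((hasDerivAt_id t).const_mul (2 * C)).neg.exp)
  have hanti : AntitoneOn (fun t => (1 + energy (z t)) * Real.exp (-(2 * C * t))) (Icc 0 T) := by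
    refine antitoneOn_of_deriv_nonpos (convex_Icc 0 T) ?_ ?_ ?_
    · refine ContinuousOn.mul ?_ (by fun_prop)
      exact continuousOn_const.add
        ((contDiff_energy (n := 0)).continuous.comp_continuousOn hc)
    · rw [interior_Icc]
      exact fun t ht => (hd t ht).differentiableAt.differentiableWithinAt
    · rw [interior_Icc]
      intro t ht
      rw [(hd t ht).deriv]
      have := mul_le_mul_of_nonneg_right (hC t ht) (Real.exp_pos (-(2 * C * t))).le
      nlinarith
  have := hanti ⟨le_rfl, ht.1.trans ht.2⟩ ht ht.1
  simp only [mul_zero, neg_zero, Real.exp_zero, mul_one] at this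
  calc 1 + energy (z t) = (1 + energy (z t)) * Real.exp (-(2 * C * t)) * Real.exp (2 * C * t) := by
        rw [mul_assoc, ← Real.exp_add]; simp
    _ ≤ _ := by gcongr

/-- The difference z = u - W solves z' = b(z + W), an ordinary equation even though W is only
continuous. The truncated equation has a solution on all of [0, T], and coercivity bounds its energy
so that the cutoff is never active. -/
theorem exists_solvesOn {b : (ι → ℝ) → ι → ℝ} (hb : ContDiff ℝ 1 b) (hco : Coercive b)
    {W : ℝ → ι → ℝ} (hW : Continuous W) (hW0 : W 0 = 0) (x : ι → ℝ) {T : ℝ} (hT : 0 ≤ T) :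
    ∃ u, u 0 = x ∧ SolvesOn b W u T := by
  obtain ⟨M, hM⟩ := isCompact_Icc.exists_bound_of_continuousOn (s := Icc 0 T) hW.continuousOn
  obtain ⟨C₀, hC₀⟩ := hco M
  -- Nonnegativity is needed because the truncation multiplies the coercivity estimate by a factor
  -- between 0 and 1.
  set C := max C₀ 0
  have hC : ∀ z w : ι → ℝ, ‖w‖ ≤ M → ∑ i, z i * b (z + w) i ≤ C * (1 + energy z) :=
    fun z w hw => (hC₀ z w hw).trans (mul_le_mul_of_nonneg_right (le_max_left _ _)
      (by linarith [energy_nonneg z]))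
  have hC0 : 0 ≤ C := le_max_right _ _
  -- This dominates 2 energy(z) + 2 energy(W), by the Gronwall bound for z and the bound M for W on
  -- [0, T].
  set r : ℝ := 2 * ((1 + energy x) * Real.exp (2 * C * T)) + 2 * (Fintype.card ι * M ^ 2) with hr
  have hrpos : 0 < r := by
    have := energy_nonneg x
    positivity
  set g : (ι → ℝ) → ι → ℝ := fun v => cutoff r v • b v with hg
  have hgC : ContDiff ℝ 1 g := (contDiff_cutoff _ (n := 1)).smul hb
  have hgs : HasCompactSupport g := (hasCompactSupport_cutoff hrpos).smul_right
  obtain ⟨K, hK⟩ := hgC.lipschitzWith_of_hasCompactSupport hgs one_ne_zero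
  obtain ⟨L₀, hL₀⟩ := hgs.exists_bound_of_continuous hgC.continuous
  have hL₀' : 0 ≤ L₀ := (norm_nonneg _).trans (hL₀ 0)
  set L : ℝ≥0 := ⟨L₀, hL₀'⟩
  -- The truncated field is bounded by L, so the ball of radius L T allows the time interval [0, T]
  -- without iteration.
  have hPL : IsPicardLindelof (fun t z => g (z + W t)) (tmin := 0) (tmax := T)
      ⟨0, le_rfl, hT⟩ x (L * ⟨T, hT⟩) 0 L K :=
    { lipschitzOnWith := fun t _ => by
        have : LipschitzWith K fun z => g (z + W t) := by
          have h := hK.comp (LipschitzWith.of_dist_le_mul (K := 1) (f := fun z => z + W t)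
            fun z z' => by simp)
          rwa [mul_one] at h
        exact this.lipschitzOnWith
      continuousOn := fun z _ => (hgC.continuous.comp (continuous_const.add hW)).continuousOn
      norm_le := fun t _ z _ => hL₀ _
      mul_max_le := by
        simp only [sub_zero, sub_self, NNReal.coe_zero]
        rw [max_eq_left hT]
        exact le_of_eq rfl }
  obtain ⟨z, hz0, hz⟩ := hPL.exists_eq_forall_mem_Icc_hasDerivWithinAt₀
  have hz0 : z 0 = x := hz0
  have hzc : ContinuousOn z (Icc 0 T) := fun t ht => (hz t ht).continuousWithinAt
  have hzd : ∀ t ∈ Ioo 0 T, HasDerivAt z (g (z t + W t)) t := fun t ht =>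
    (hz t (Ioo_subset_Icc_self ht)).hasDerivAt (Icc_mem_nhds ht.1 ht.2)
  have hbound : ∀ t ∈ Icc 0 T, energy (z t + W t) ≤ r := by
    intro t ht
    have h1 := energy_le_of_hasDerivAt hzc hzd (C := C) (fun t ht => by
      have h := hC (z t) (W t) (hM t (Ioo_subset_Icc_self ht))
      have h2 : ∑ i, z t i * g (z t + W t) i =
          cutoff r (z t + W t) * ∑ i, z t i * b (z t + W t) i := by
        simp only [hg, Pi.smul_apply, smul_eq_mul, Finset.mul_sum]
        exact Finset.sum_congr rfl fun i _ => by ring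
      rw [h2]
      have h3 := energy_nonneg (z t)
      calc _ ≤ cutoff r (z t + W t) * (C * (1 + energy (z t))) :=
            mul_le_mul_of_nonneg_left h (cutoff_nonneg _ _)
        _ ≤ _ := mul_le_of_le_one_left (by positivity) (cutoff_le_one _ _)) ht
    rw [hz0] at h1
    have h2 : Real.exp (2 * C * t) ≤ Real.exp (2 * C * T) := by
      gcongr; exact ht.2
    have h3 := (energy_add_le (z t) (W t)).trans
      (add_le_add_right (mul_le_mul_of_nonneg_left (energy_le (W t)) zero_le_two) _)
    have h4 : ‖W t‖ ^ 2 ≤ M ^ 2 := by gcongr; exact hM t ht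
    have h5 : (1 + energy x) * Real.exp (2 * C * t) ≤ (1 + energy x) * Real.exp (2 * C * T) :=
      mul_le_mul_of_nonneg_left h2 (by linarith [energy_nonneg x])
    have h6 : (Fintype.card ι : ℝ) * ‖W t‖ ^ 2 ≤ Fintype.card ι * M ^ 2 := by gcongr
    linarith
  have hgb : ∀ t ∈ Icc 0 T, g (z t + W t) = b (z t + W t) := fun t ht => by
    simp [hg, cutoff_eq_one hrpos (hbound t ht)]
  refine ⟨fun t => z t + W t, by simp [hz0, hW0], hzc.add hW.continuousOn, fun t ht => ?_⟩
  have hsub : Icc 0 t ⊆ Icc 0 T := Icc_subset_Icc_right ht.2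
  have hFTC := intervalIntegral.integral_eq_sub_of_hasDerivAt_of_le ht.1 (hzc.mono hsub)
    (f' := fun s => b (z s + W s)) (fun s hs => by
      rw [← hgb s (hsub (Ioo_subset_Icc_self hs))]
      exact hzd s ⟨hs.1, hs.2.trans_le ht.2⟩) (by
      apply ContinuousOn.intervalIntegrable
      rw [uIcc_of_le ht.1]
      exact hb.continuous.comp_continuousOn ((hzc.mono hsub).add hW.continuousOn))
  simp only [hFTC, hW0]
  abel

theorem tendsto_euler {b : (ι → ℝ) → ι → ℝ} (hb : ContDiff ℝ 1 b) {W u : ℝ → ι → ℝ} {T : ℝ}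
    (hT : 0 < T) (hu : SolvesOn b W u T) :
    Tendsto (fun n : ℕ => scheme (fun v => v + (T / n) • b v) (gridIncrement W (T / n)) (u 0) n)
      atTop (𝓝 (u T)) := by
  obtain ⟨M, hM⟩ := isCompact_Icc.exists_bound_of_continuousOn hu.1
  refine tendsto_scheme (lipschitzOnBalls_of_contDiff hb) hT hu hM
    (Φ := fun n v => v + (T / n) • b v) fun ε hε => Eventually.of_forall fun n v _ => ?_
  simp only [add_sub_cancel_left, sub_self, norm_zero]
  positivity

/-- Both solutions are the limit of one and the same Euler scheme, which depends only on the initial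
value and on W. -/
theorem SolvesOn.eqOn {b : (ι → ℝ) → ι → ℝ} (hb : ContDiff ℝ 1 b) {W u v : ℝ → ι → ℝ} {T : ℝ}
    (hu : SolvesOn b W u T) (hv : SolvesOn b W v T) (h0 : u 0 = v 0) : EqOn u v (Icc 0 T) := by
  intro t ht
  rcases ht.1.eq_or_lt with rfl | hpos
  · exact h0
  have h1 := tendsto_euler hb hpos (hu.mono ht.2)
  have h2 := tendsto_euler hb hpos (hv.mono ht.2)
  rw [h0] at h1
  exact tendsto_nhds_unique h1 h2

/-- Global existence of continuous adapted solutions of equations with additive noise. -/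
theorem exists_adapted_solution {b : (ι → ℝ) → ι → ℝ} (hb : ContDiff ℝ 1 b) (hco : Coercive b)
    {Ω : Type*} [mΩ : MeasurableSpace Ω] (ℱ : Filtration ℝ≥0 mΩ) {x : Ω → ι → ℝ}
    (hx : Measurable[ℱ 0] x) {W : ℝ≥0 → Ω → ι → ℝ} (hW : ∀ t, Measurable[ℱ t] (W t))
    (hW0 : ∀ ω, W 0 ω = 0) (hWc : ∀ ω, Continuous fun t => W t ω) :
    ∃ u : ℝ≥0 → Ω → ι → ℝ, (∀ t, Measurable[ℱ t] (u t)) ∧ (∀ ω, Continuous fun t => u t ω) ∧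
      u 0 = x ∧ ∀ ω (t : ℝ≥0),
        u t ω = x ω + (∫ s in (0 : ℝ)..t, b (u s.toNNReal ω)) + W t ω := by
  have hWc' : ∀ ω, Continuous fun t : ℝ => W t.toNNReal ω := fun ω =>
    (hWc ω).comp continuous_real_toNNReal
  have hex : ∀ ω (T : ℝ≥0), ∃ v, v 0 = x ω ∧ SolvesOn b (fun t => W t.toNNReal ω) v T :=
    fun ω T => exists_solvesOn hb hco (hWc' ω) (by simp [hW0]) (x ω) T.2
  choose v hv0 hv using hex
  -- By uniqueness the solutions on different horizons agree, so the diagonal choice of the horizon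
  -- t at time t defines one global path.
  have heq : ∀ ω (s T : ℝ≥0), s ≤ T → v ω s s = v ω T s := fun ω s T hsT =>
    (hv ω s).eqOn hb ((hv ω T).mono (by exact_mod_cast hsT)) (by rw [hv0, hv0]) ⟨s.2, le_rfl⟩
  refine ⟨fun t ω => v ω t t, fun t => ?_, fun ω => ?_, ?_, fun ω t => ?_⟩
  · rcases eq_or_ne t 0 with rfl | ht
    · simpa only [NNReal.coe_zero, hv0] using hx
    have htpos : (0 : ℝ) < t := by exact_mod_cast pos_iff_ne_zero.2 ht
    -- Solutions were chosen separately for each ω, so measurability needs an argument: u(t) is a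
    -- limit of Euler values, which are explicit functions of x and of W at grid times up to t.
    have hlim : ∀ ω, Tendsto (fun n : ℕ => scheme (fun v => v + ((t : ℝ) / n) • b v)
        (gridIncrement (fun s : ℝ => W s.toNNReal ω) (t / n)) (x ω) n) atTop (𝓝 (v ω t t)) :=
      fun ω => by
        have := tendsto_euler hb htpos (hv ω t)
        rwa [hv0] at this
    refine @measurable_of_tendsto_metrizable _ _ (ℱ t) _ _ _ _ _ _ (fun n => ?_)
      (tendsto_pi_nhds.2 hlim)
    have hgrid : ∀ j ≤ n, ((j : ℝ) * ((t : ℝ) / n)).toNNReal ≤ t := by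
      intro j hj
      rw [Real.toNNReal_le_iff_le_coe]
      rcases Nat.eq_zero_or_pos n with rfl | hn
      · simp
      rw [mul_div_assoc', div_le_iff₀ (by exact_mod_cast hn), mul_comm]
      exact mul_le_mul_of_nonneg_left (by exact_mod_cast hj) t.2
    have hj : ∀ j ≤ n, Measurable[ℱ t] fun ω => scheme (fun v => v + ((t : ℝ) / n) • b v)
        (gridIncrement (fun s : ℝ => W s.toNNReal ω) (t / n)) (x ω) j := by
      intro j
      induction j with
      | zero => exact fun _ => hx.mono (ℱ.mono (zero_le (a := t))) le_rfl
      | succ j ih =>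
        intro hj
        have ih := ih (by omega)
        have hbm : Measurable fun v => v + ((t : ℝ) / n) • b v :=
          measurable_id.add (hb.continuous.const_smul ((t : ℝ) / n)).measurable
        refine (hbm.comp ih).add (Measurable.sub ?_ ?_)
        · exact (hW _).mono (ℱ.mono (hgrid (j + 1) hj)) le_rfl
        · exact (hW _).mono (ℱ.mono (hgrid j (by omega))) le_rfl
    exact hj n le_rfl
  · rw [continuous_iff_continuousAt]
    intro t
    -- The horizon t + 1 puts t in the interior of the interval where one fixed solution is
    -- continuous.
    have h1 : ContinuousOn (fun s : ℝ≥0 => v ω (t + 1) s) (Iic (t + 1)) :=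
      (hv ω (t + 1)).1.comp continuous_subtype_val.continuousOn
        fun s hs => ⟨s.2, by exact_mod_cast hs⟩
    have h2 : Iic (t + 1) ∈ 𝓝 t := Iic_mem_nhds (by simp)
    refine (h1.continuousAt h2).congr ?_
    filter_upwards [h2] with s hs
    exact (heq ω s (t + 1) hs).symm
  · ext1 ω
    simp [hv0]
  · have := (hv ω t).2 t ⟨t.2, le_rfl⟩
    simp only [hv0, Real.toNNReal_coe] at this
    simp only [this]
    congr 2
    refine intervalIntegral.integral_congr fun s hs => ?_
    rw [uIcc_of_le t.coe_nonneg] at hs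
    have := heq ω s.toNNReal t (Real.toNNReal_le_iff_le_coe.2 hs.2)
    rw [Real.coe_toNNReal s hs.1] at this
    simp only [Real.coe_toNNReal s hs.1, this]

end ODE

/-! ### The standard Gaussian measure: density, moments, integration by parts -/

section StandardGaussian

variable (ι : Type*) [Fintype ι]

/-- The standard Gaussian measure on `ι → ℝ`. -/
abbrev stdGauss : Measure (ι → ℝ) := Measure.pi fun _ => gaussianReal 0 1

variable {ι}

/-- The density of the standard Gaussian measure on `ι → ℝ`. -/
def gaussDensity (x : ι → ℝ) : ℝ := ∏ i, gaussianPDFReal 0 1 (x i)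

theorem gaussDensity_eq (x : ι → ℝ) :
    gaussDensity x = (Real.sqrt (2 * Real.pi))⁻¹ ^ Fintype.card ι * Real.exp (-(energy x / 2)) := by
  simp only [gaussDensity, gaussianPDFReal, Finset.prod_mul_distrib, ← Real.exp_sum]
  simp [energy, Finset.sum_div, neg_div]

theorem gaussDensity_pos (x : ι → ℝ) : 0 < gaussDensity x :=
  Finset.prod_pos fun i _ => gaussianPDFReal_pos 0 1 (x i) one_ne_zero

theorem contDiff_gaussDensity {n : WithTop ℕ∞} : ContDiff ℝ n (gaussDensity : (ι → ℝ) → ℝ) := by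
  have : (gaussDensity : (ι → ℝ) → ℝ) = fun x =>
      (Real.sqrt (2 * Real.pi))⁻¹ ^ Fintype.card ι * Real.exp (-(energy x / 2)) :=
    funext gaussDensity_eq
  rw [this]
  exact contDiff_const.mul (contDiff_energy.div_const 2).neg.exp

theorem integrable_gaussDensity : Integrable (gaussDensity : (ι → ℝ) → ℝ) := by
  unfold gaussDensity
  exact Integrable.fintype_prod (f := fun _ => gaussianPDFReal 0 1)
    fun i => integrable_gaussianPDFReal 0 1

theorem stdGauss_eq_withDensity :
    stdGauss ι = (volume : Measure (ι → ℝ)).withDensity fun x => ENNReal.ofReal (gaussDensity x) := by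
  symm
  refine (Measure.pi_eq fun s hs => ?_).symm
  rw [withDensity_apply _ (MeasurableSet.univ_pi hs), ← ofReal_integral_eq_lintegral_ofReal
    integrable_gaussDensity.integrableOn (ae_of_all _ fun x => (gaussDensity_pos x).le)]
  have : ∫ x in univ.pi s, gaussDensity x = ∏ i, ∫ y in s i, gaussianPDFReal 0 1 y := by
    rw [volume_pi, Measure.restrict_pi_pi]
    exact integral_fintype_prod_eq_prod (fun _ => gaussianPDFReal 0 1)
  rw [this, ENNReal.ofReal_prod_of_nonneg fun i _ =>
    integral_nonneg fun y => gaussianPDFReal_nonneg 0 1 y]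
  exact Finset.prod_congr rfl fun i _ => (gaussianReal_apply_eq_integral 0 one_ne_zero _).symm

theorem integral_stdGauss (f : (ι → ℝ) → ℝ) :
    ∫ x, f x ∂(stdGauss ι) = ∫ x, gaussDensity x * f x := by
  rw [stdGauss_eq_withDensity, integral_withDensity_eq_integral_toReal_smul
    (contDiff_gaussDensity (n := 0)).continuous.measurable.ennreal_ofReal (by simp)]
  simp [ENNReal.toReal_ofReal (gaussDensity_pos _).le]

theorem integrable_stdGauss_iff (f : (ι → ℝ) → ℝ) :
    Integrable f (stdGauss ι) ↔ Integrable fun x => gaussDensity x * f x := by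
  rw [stdGauss_eq_withDensity, integrable_withDensity_iff_integrable_smul'
    (contDiff_gaussDensity (n := 0)).continuous.measurable.ennreal_ofReal (by simp)]
  simp [ENNReal.toReal_ofReal (gaussDensity_pos _).le]

/-- Gaussianity supplies finite moments of every order of the norm, which make functions of
polynomial growth integrable. -/
theorem isGaussian_stdGauss : IsGaussian (stdGauss ι) := by
  have h : iIndepFun (fun (i : ι) (x : ι → ℝ) => x i) (stdGauss ι) :=
    iIndepFun_pi (X := fun _ => id) fun _ => aemeasurable_id
  have h2 : HasGaussianLaw (fun (x : ι → ℝ) i => x i) (stdGauss ι) := h.hasGaussianLaw fun i =>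
    ⟨by
      have := (measurePreserving_eval (fun _ : ι => gaussianReal 0 1) i).map_eq
      unfold Function.eval at this
      rw [this]
      infer_instance⟩
  simpa [Measure.map_id'] using h2.isGaussian_map

theorem integrable_stdGauss_of_bound {F : Type*} [NormedAddCommGroup F] {f : (ι → ℝ) → F}
    (hf : AEStronglyMeasurable f (stdGauss ι)) {C : ℝ} {k : ℕ}
    (h : ∀ x, ‖f x‖ ≤ C * (1 + ‖x‖) ^ k) : Integrable f (stdGauss ι) := by
  have := isGaussian_stdGauss (ι := ι)
  have h1 : Integrable (fun x : ι → ℝ => ‖x‖ ^ k) (stdGauss ι) :=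
    (IsGaussian.memLp_id (stdGauss ι) k (by simp)).integrable_norm_pow'
  have h2 : Integrable (fun x : ι → ℝ => |C| * (2 ^ (k - 1) * (1 ^ k + ‖x‖ ^ k))) (stdGauss ι) :=
    (((integrable_const (1 ^ k : ℝ)).add h1).const_mul _).const_mul _
  refine h2.mono' hf (ae_of_all _ fun x => (h x).trans ?_)
  calc C * (1 + ‖x‖) ^ k ≤ |C| * (1 + ‖x‖) ^ k := by gcongr; exact le_abs_self C
    _ ≤ _ := by gcongr; exact add_pow_le zero_le_one (norm_nonneg x) k

theorem memLp_two_stdGauss_of_bound {F : Type*} [NormedAddCommGroup F] {f : (ι → ℝ) → F}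
    (hf : AEStronglyMeasurable f (stdGauss ι)) {C : ℝ} {k : ℕ}
    (h : ∀ x, ‖f x‖ ≤ C * (1 + ‖x‖) ^ k) : MemLp f 2 (stdGauss ι) := by
  rw [memLp_two_iff_integrable_sq_norm hf]
  refine integrable_stdGauss_of_bound (hf.norm.pow 2) (C := C ^ 2) (k := k * 2) fun x => ?_
  rw [norm_pow, norm_norm, pow_mul, ← mul_pow]
  exact pow_le_pow_left₀ (norm_nonneg _) (h x) 2

theorem hasTemperateGrowth_bound {E F : Type*} [NormedAddCommGroup E] [NormedSpace ℝ E]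
    [NormedAddCommGroup F] [NormedSpace ℝ F] {f : E → F} (hf : f.HasTemperateGrowth) :
    ∃ (k : ℕ) (C : ℝ), ∀ x, ‖f x‖ ≤ C * (1 + ‖x‖) ^ k := by
  obtain ⟨k, C, h⟩ := hf.2 0
  exact ⟨k, C, fun x => by simpa using h x⟩

theorem integrable_stdGauss_of_temperate {F : Type*} [NormedAddCommGroup F] [NormedSpace ℝ F]
    {f : (ι → ℝ) → F} (hf : f.HasTemperateGrowth) : Integrable f (stdGauss ι) := by
  obtain ⟨k, C, h⟩ := hasTemperateGrowth_bound hf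
  exact integrable_stdGauss_of_bound hf.1.continuous.aestronglyMeasurable h

theorem memLp_two_stdGauss_of_temperate {F : Type*} [NormedAddCommGroup F] [NormedSpace ℝ F]
    {f : (ι → ℝ) → F} (hf : f.HasTemperateGrowth) : MemLp f 2 (stdGauss ι) := by
  obtain ⟨k, C, h⟩ := hasTemperateGrowth_bound hf
  exact memLp_two_stdGauss_of_bound hf.1.continuous.aestronglyMeasurable h

theorem hasTemperateGrowth_fderiv_apply {E F : Type*} [NormedAddCommGroup E] [NormedSpace ℝ E]
    [NormedAddCommGroup F] [NormedSpace ℝ F] {f : E → F} (hf : f.HasTemperateGrowth) (v : E) :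
    (fun x => fderiv ℝ f x v).HasTemperateGrowth := by
  have h1 : (fderiv ℝ f).HasTemperateGrowth := by
    refine ⟨hf.1.fderiv_right (by simp), fun n => ?_⟩
    obtain ⟨k, C, h⟩ := hf.2 (n + 1)
    exact ⟨k, C, fun x => by rw [norm_iteratedFDeriv_fderiv]; exact h x⟩
  exact (ContinuousLinearMap.hasTemperateGrowth (ContinuousLinearMap.apply ℝ F v)).comp h1

theorem temperate_coord (i : ι) : (fun x : ι → ℝ => x i).HasTemperateGrowth :=
  ContinuousLinearMap.hasTemperateGrowth (ContinuousLinearMap.proj (R := ℝ) (φ := fun _ => ℝ) i)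

variable [DecidableEq ι]

/-- The partial derivative in the `i`-th coordinate. -/
def pderiv (i : ι) (f : (ι → ℝ) → ℝ) (x : ι → ℝ) : ℝ := fderiv ℝ f x (Pi.single i 1)

theorem temperate_pderiv {f : (ι → ℝ) → ℝ} (hf : f.HasTemperateGrowth) (i : ι) :
    (pderiv i f).HasTemperateGrowth := hasTemperateGrowth_fderiv_apply hf _

theorem pderiv_mul {f g : (ι → ℝ) → ℝ} (hf : f.HasTemperateGrowth) (hg : g.HasTemperateGrowth)
    (i : ι) (x : ι → ℝ) :
    pderiv i (fun y => f y * g y) x = f x * pderiv i g x + pderiv i f x * g x := by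
  have h1 := (hf.1.differentiable (by simp)) x
  have h2 := (hg.1.differentiable (by simp)) x
  simp only [pderiv]
  rw [fderiv_fun_mul h1 h2]
  simp [mul_comm]

theorem pderiv_gaussDensity (i : ι) (x : ι → ℝ) :
    pderiv i gaussDensity x = -(x i) * gaussDensity x := by
  have h1 : HasFDerivAt (energy : (ι → ℝ) → ℝ)
      (∑ j, (2 * x j) • ContinuousLinearMap.proj (R := ℝ) (φ := fun _ : ι => ℝ) j) x := by
    unfold energy
    refine HasFDerivAt.fun_sum fun j _ => ?_
    have := (hasFDerivAt_apply (𝕜 := ℝ) (F' := fun _ : ι => ℝ) j x).pow 2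
    simpa using this
  have h2 := ((h1.mul_const (2⁻¹ : ℝ)).neg.exp).const_mul
    ((Real.sqrt (2 * Real.pi))⁻¹ ^ Fintype.card ι)
  have h3 : (gaussDensity : (ι → ℝ) → ℝ) = fun x =>
      (Real.sqrt (2 * Real.pi))⁻¹ ^ Fintype.card ι * Real.exp (-(energy x * 2⁻¹)) := by
    funext y; rw [gaussDensity_eq, div_eq_mul_inv]
  rw [pderiv, HasFDerivAt.fderiv (f := gaussDensity) (x := x) (by rw [h3]; exact h2), h3]
  simp [Pi.single_apply]
  ring

/-- Gaussian integration by parts. -/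
theorem integral_pderiv {f : (ι → ℝ) → ℝ} (hf : f.HasTemperateGrowth) (i : ι) :
    ∫ x, pderiv i f x ∂(stdGauss ι) = ∫ x, x i * f x ∂(stdGauss ι) := by
  have hxf : (fun x : ι → ℝ => x i * f x).HasTemperateGrowth := (temperate_coord i).mul hf
  have h1 := (integrable_stdGauss_iff _).1 (integrable_stdGauss_of_temperate hf)
  have h2 := (integrable_stdGauss_iff _).1 (integrable_stdGauss_of_temperate (temperate_pderiv hf i))
  have h3 := (integrable_stdGauss_iff _).1 (integrable_stdGauss_of_temperate hxf)
  have e : ∀ x, fderiv ℝ gaussDensity x (Pi.single i 1) * f x = -(gaussDensity x * (x i * f x)) :=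
    fun x => by
      have := pderiv_gaussDensity i x
      rw [pderiv] at this
      rw [this]; ring
  -- Integration by parts for Lebesgue measure against the density; integrability of the three
  -- products replaces any condition at infinity, and the derivative of the density produces the
  -- factor -x_i.
  have := integral_mul_fderiv_eq_neg_fderiv_mul_of_integrable (μ := volume)
    (f := (gaussDensity : (ι → ℝ) → ℝ)) (g := f) (v := Pi.single i 1)
    (by simp only [e]; exact h3.neg) h2 h1
    (fun x _ => (contDiff_gaussDensity (n := 1)).differentiable one_ne_zero x)
    (fun x _ => hf.1.differentiable (by simp) x)
  rw [integral_stdGauss, integral_stdGauss]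
  simp only [e, integral_neg, neg_neg] at this
  exact this

end StandardGaussian

/-! ### Euler steps almost preserve the Gaussian measure -/

section Jacobian

variable {ι : Type*} [Fintype ι]

theorem fderiv_coord {X : (ι → ℝ) → ι → ℝ} {x : ι → ℝ} (hX : DifferentiableAt ℝ X x) (i : ι)
    (v : ι → ℝ) : fderiv ℝ (fun y => X y i) x v = fderiv ℝ X x v i := by
  have := (hasFDerivAt_pi'.1 hX.hasFDerivAt i).fderiv
  rw [this]; rfl

variable [DecidableEq ι]

/-- The derivative of the determinant at the identity is the trace. Fréchet differentiability,
rather than differentiability along lines, makes the remainder uniform over bounded trace-free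
matrices. -/
theorem det_one_add_isLittleO {κ : ℝ} (hκ : 0 ≤ κ) {ε : ℝ} (hε : 0 < ε) :
    ∀ᶠ h in 𝓝[>] (0 : ℝ), ∀ A : ι → ι → ℝ, ‖A‖ ≤ κ → (Matrix.of A).trace = 0 →
      |(1 + h • Matrix.of A).det - 1| ≤ h * ε := by
  set f : (ι → ι → ℝ) → ℝ := fun A => (1 + Matrix.of A).det with hf
  have hfd : DifferentiableAt ℝ f 0 := by
    have : ContDiff ℝ 1 f := by
      simp only [hf, Matrix.det_apply, Matrix.add_apply, Matrix.of_apply]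
      fun_prop
    exact this.differentiable one_ne_zero 0
  have hf' : ∀ A, fderiv ℝ f 0 A = (Matrix.of A).trace := by
    intro A
    have h1 : HasDerivAt (fun t : ℝ => f (t • A)) (fderiv ℝ f 0 A) 0 := by
      have h2 : HasDerivAt (fun t : ℝ => t • A) A 0 := by
        simpa using (hasDerivAt_id (0 : ℝ)).smul_const A
      have h3 : HasFDerivAt f (fderiv ℝ f 0) ((0 : ℝ) • A) := by
        rw [zero_smul]; exact hfd.hasFDerivAt
      exact h3.comp_hasDerivAt 0 h2
    -- The part of det(1 + tA) of order at least two, divided by t²; it does not affect the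
    -- derivative at t = 0.
    set p : Polynomial ℝ :=
      (1 + (Polynomial.X : Polynomial ℝ) • (Matrix.of A).map Polynomial.C).det.divX.divX
    have h4 : (fun t : ℝ => f (t • A)) = fun t =>
        1 + (Matrix.of A).trace * t + p.eval t * t ^ 2 := by
      funext t
      exact Matrix.det_one_add_smul t (Matrix.of A)
    rw [h4] at h1
    have h5 : HasDerivAt (fun t : ℝ => 1 + (Matrix.of A).trace * t + p.eval t * t ^ 2)
        ((Matrix.of A).trace) 0 := by
      have h6 := (((hasDerivAt_id (0 : ℝ)).const_mul (Matrix.of A).trace).const_add 1).add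
        ((p.hasDerivAt 0).mul ((hasDerivAt_id (0 : ℝ)).pow 2))
      refine h6.congr_deriv ?_
      simp
    exact h1.unique h5
  have hlo := hfd.hasFDerivAt.isLittleO
  -- The constant is chosen because ‖hA‖ ≤ hκ; the added 1 covers κ = 0.
  have h7 := hlo.def (c := ε / (κ + 1)) (by positivity)
  simp only [sub_zero] at h7
  rw [Metric.eventually_nhds_iff_ball] at h7
  obtain ⟨d, hd, h7⟩ := h7
  filter_upwards [Ioo_mem_nhdsGT (show (0 : ℝ) < d / (κ + 1) by positivity)] with h hh A hA htr
  have hn : ‖h • A‖ ≤ h * κ := by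
    rw [norm_smul, Real.norm_of_nonneg hh.1.le]
    exact mul_le_mul_of_nonneg_left hA hh.1.le
  have h8 := h7 (h • A) (by
    rw [mem_ball_zero_iff]
    refine hn.trans_lt ?_
    have := (lt_div_iff₀ (by positivity)).1 hh.2
    nlinarith [hh.1])
  rw [hf', show (Matrix.of (h • A)).trace = h * (Matrix.of A).trace from by
    rw [← smul_eq_mul, ← Matrix.trace_smul]; rfl, htr, mul_zero, sub_zero] at h8
  have h9 : f 0 = 1 := by
    simp only [hf]
    rw [show (Matrix.of (0 : ι → ι → ℝ)) = 0 from rfl, add_zero, Matrix.det_one]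
  rw [h9] at h8
  refine (h8.trans (mul_le_mul_of_nonneg_left hn (by positivity))).trans ?_
  have : ε / (κ + 1) * (h * κ) = h * ε * (κ / (κ + 1)) := by ring
  rw [this]
  refine mul_le_of_le_one_right (by have := hh.1; positivity) ?_
  rw [div_le_one (by positivity)]
  linarith

/-- The divergence of a vector field. -/
def divergence (X : (ι → ℝ) → ι → ℝ) (x : ι → ℝ) : ℝ := ∑ i, pderiv i (fun y => X y i) x

/-- The explicit Euler step of an energy preserving, divergence free, compactly supported vector
field preserves the standard Gaussian measure up to an error `o(h)` in total variation. -/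
theorem integral_euler_sub_le {X : (ι → ℝ) → ι → ℝ} (hX : ContDiff ℝ 1 X)
    (hs : HasCompactSupport X) (hdiv : ∀ x, divergence X x = 0) (hen : ∀ x, ∑ i, x i * X x i = 0)
    {ε : ℝ} (hε : 0 < ε) :
    ∀ᶠ h in 𝓝[>] (0 : ℝ), ∀ G : (ι → ℝ) → ℝ, Measurable G → (∀ x, |G x| ≤ 1) →
      |∫ x, G (x + h • X x) ∂(stdGauss ι) - ∫ x, G x ∂(stdGauss ι)| ≤ h * ε := by
  obtain ⟨K, hK⟩ := hX.lipschitzWith_of_hasCompactSupport hs one_ne_zero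
  obtain ⟨Q₀, hQ₀⟩ := (hs.comp_left (g := energy) (by simp [energy])).exists_bound_of_continuous
    ((contDiff_energy (n := 0)).continuous.comp hX.continuous)
  have hQ : ∀ x, energy (X x) ≤ Q₀ := fun x => (le_abs_self _).trans (hQ₀ x)
  have hQ0 : 0 ≤ Q₀ := (energy_nonneg _).trans (hQ 0)
  -- Below (K + 1)⁻¹ the step is a perturbation of the identity with Lipschitz constant less than 1,
  -- hence a bijection; below the last bound the quadratic change of the density is at most a
  -- fraction of h ε.
  have hsm : ∀ᶠ h in 𝓝[>] (0 : ℝ), h < min 1 (min ((K + 1 : ℝ)⁻¹) (ε / (2 * (Q₀ + 1)))) := by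
    have : (0 : ℝ) < min 1 (min ((K + 1 : ℝ)⁻¹) (ε / (2 * (Q₀ + 1)))) := by positivity
    filter_upwards [Ioo_mem_nhdsGT this] with h hh using hh.2
  -- The determinant estimate is used twice: with ε / 2 for accuracy, and with 1, together with h <
  -- 1, to make the Jacobian positive and less than 2.
  filter_upwards [hsm, det_one_add_isLittleO (ι := ι) K.2 (show 0 < ε / 2 by positivity),
    det_one_add_isLittleO (ι := ι) K.2 one_pos, self_mem_nhdsWithin]
    with h hh hdet hdet1 hpos G hG hG1
  have hpos : 0 < h := hpos
  obtain ⟨hh1, hh2, hh3⟩ : h < 1 ∧ h < (K + 1 : ℝ)⁻¹ ∧ h < ε / (2 * (Q₀ + 1)) := by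
    simpa only [lt_min_iff] using hh
  set ψ : (ι → ℝ) → ι → ℝ := fun x => x + h • X x with hψ
  set ψ' : (ι → ℝ) → (ι → ℝ) →L[ℝ] (ι → ℝ) := fun x => .id ℝ _ + h • fderiv ℝ X x with hψ'
  have hXd : ∀ x, DifferentiableAt ℝ X x := hX.differentiable one_ne_zero
  have hψd : ∀ x, HasFDerivAt ψ (ψ' x) x := fun x =>
    (hasFDerivAt_id x).add ((hXd x).hasFDerivAt.const_smul h)
  have hKh : K * h < 1 := by
    have : h * (K + 1) < 1 := by
      rwa [← one_div, lt_div_iff₀ (by positivity)] at hh2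
    nlinarith
  have happ : ApproximatesLinearOn ψ (ContinuousLinearEquiv.refl ℝ (ι → ℝ) : (ι → ℝ) →L[ℝ] ι → ℝ)
      univ (K * ⟨h, hpos.le⟩) := by
    intro x _ y _
    have h1 : ψ x - ψ y - (ContinuousLinearEquiv.refl ℝ (ι → ℝ) : (ι → ℝ) →L[ℝ] ι → ℝ) (x - y)
        = h • (X x - X y) := by
      simp only [hψ, ContinuousLinearEquiv.coe_refl, ContinuousLinearMap.id_apply, smul_sub]
      abel
    rw [h1, norm_smul, Real.norm_of_nonneg hpos.le]
    calc h * ‖X x - X y‖ ≤ h * (K * ‖x - y‖) := by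
          gcongr; exact hK.norm_sub_le x y
      _ = K * h * ‖x - y‖ := by ring
  have hcN : Subsingleton (ι → ℝ) ∨ K * ⟨h, hpos.le⟩ <
      ‖((ContinuousLinearEquiv.refl ℝ (ι → ℝ)).symm : (ι → ℝ) →L[ℝ] ι → ℝ)‖₊⁻¹ := by
    rcases subsingleton_or_nontrivial (ι → ℝ) with hsub | hnt
    · exact Or.inl hsub
    · right
      have : ‖((ContinuousLinearEquiv.refl ℝ (ι → ℝ)).symm : (ι → ℝ) →L[ℝ] ι → ℝ)‖₊ = 1 := by
        simp only [ContinuousLinearEquiv.refl_symm, ContinuousLinearEquiv.coe_refl]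
        exact NNReal.eq (ContinuousLinearMap.norm_id)
      rw [this, inv_one]
      exact hKh
  have hinj : InjOn ψ univ := happ.injOn hcN
  have hsurj : ψ '' univ = univ := image_univ_of_surjective (happ.surjective hcN)
  have hcv := integral_image_eq_integral_abs_det_fderiv_smul (volume : Measure (ι → ℝ))
    MeasurableSet.univ (fun x _ => (hψd x).hasFDerivWithinAt) hinj
    (fun x => gaussDensity x * G x)
  have hGi : Integrable (fun x => gaussDensity x * G x) := by
    rw [← integrable_stdGauss_iff]
    exact Integrable.of_bound hG.aestronglyMeasurable 1 (ae_of_all _ hG1)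
  have hcvi := integrableOn_image_iff_integrableOn_abs_det_fderiv_smul (volume : Measure (ι → ℝ))
    MeasurableSet.univ (fun x _ => (hψd x).hasFDerivWithinAt) hinj
    (fun x => gaussDensity x * G x)
  rw [hsurj] at hcv hcvi
  simp only [integrableOn_univ, setIntegral_univ, smul_eq_mul] at hcv hcvi
  have hi1 := hcvi.1 hGi
  have hψm : Measurable ψ := (continuous_id.add (hX.continuous.const_smul h)).measurable
  have hi2 : Integrable (fun x => gaussDensity x * G (ψ x)) := by
    rw [← integrable_stdGauss_iff]
    exact Integrable.of_bound (hG.comp hψm).aestronglyMeasurable 1 (ae_of_all _ fun x => hG1 _)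
  -- Since X(x) is orthogonal to x, the energy of x + h X(x) has no term of first order in h.
  have hρ : ∀ x, gaussDensity (ψ x) =
      gaussDensity x * Real.exp (-(h ^ 2 * energy (X x) / 2)) := by
    intro x
    have : energy (ψ x) = energy x + h ^ 2 * energy (X x) := by
      have e1 : energy (ψ x) = energy x + 2 * h * ∑ i, x i * X x i + h ^ 2 * energy (X x) := by
        simp only [energy, hψ, Finset.mul_sum, ← Finset.sum_add_distrib, Pi.add_apply,
          Pi.smul_apply, smul_eq_mul]
        exact Finset.sum_congr rfl fun i _ => by ring
      rw [e1, hen, mul_zero, add_zero]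
    rw [gaussDensity_eq, gaussDensity_eq, this, mul_assoc, ← Real.exp_add]
    congr 2
    ring
  have hdetx : ∀ x, |(ψ' x).det - 1| ≤ h * (ε / 2) ∧ |(ψ' x).det - 1| ≤ h * 1 := by
    intro x
    set A : ι → ι → ℝ := fun i j => fderiv ℝ X x (Pi.single j 1) i with hA
    have hAK : ‖A‖ ≤ K := by
      refine (pi_norm_le_iff_of_nonneg K.2).2 fun i => (pi_norm_le_iff_of_nonneg K.2).2 fun j => ?_
      refine (norm_le_pi_norm (fderiv ℝ X x (Pi.single j 1)) i).trans ?_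
      refine ((fderiv ℝ X x).le_opNorm _).trans ?_
      rw [Pi.norm_single, norm_one, mul_one]
      exact norm_fderiv_le_of_lipschitz ℝ hK
    have hAt : (Matrix.of A).trace = 0 := by
      rw [← hdiv x]
      simp only [Matrix.trace, Matrix.diag, Matrix.of_apply, hA, divergence, pderiv]
      exact Finset.sum_congr rfl fun i _ => (fderiv_coord (hXd x) i _).symm
    have hAd : (ψ' x).det = (1 + h • Matrix.of A).det := by
      rw [ContinuousLinearMap.det, ← LinearMap.det_toMatrix']
      congr 1
      ext i j
      simp [LinearMap.toMatrix'_apply, hψ', hA, Matrix.one_apply, Pi.single_apply]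
    rw [hAd]
    exact ⟨hdet A hAK hAt, hdet1 A hAK hAt⟩
  -- This is the pointwise relative error after the change of variables: at most h ε / 2 from the
  -- Jacobian, and at most 2q ≤ h ε / 2 from the exponential, the Jacobian being less than 2.
  have hkey : ∀ x, |1 - |(ψ' x).det| * Real.exp (-(h ^ 2 * energy (X x) / 2))| ≤ h * ε := by
    intro x
    obtain ⟨h1, h2⟩ := hdetx x
    set D := (ψ' x).det
    set q := h ^ 2 * energy (X x) / 2 with hq
    have hDpos : 0 < D := by have := abs_le.1 h2; linarith [this.1]
    have hq0 : 0 ≤ q := by have := energy_nonneg (X x); positivity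
    have he1 : 1 - q ≤ Real.exp (-q) := Real.one_sub_le_exp_neg q
    have he2 : Real.exp (-q) ≤ 1 := Real.exp_le_one_iff.2 (by linarith)
    have hqe : 2 * q ≤ h * (ε / 2) := by
      have h3 : h * (2 * (Q₀ + 1)) < ε := (lt_div_iff₀ (by positivity)).1 hh3
      have h4 : h ^ 2 * energy (X x) ≤ h ^ 2 * Q₀ := by gcongr; exact hQ x
      have h5 : h * (h * (2 * (Q₀ + 1))) ≤ h * ε := by gcongr
      rw [hq]
      nlinarith [sq_nonneg h]
    rw [abs_of_pos hDpos]
    rw [abs_le] at h1 h2 ⊢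
    constructor <;> nlinarith [mul_nonneg hDpos.le (sub_nonneg.2 he2)]
  rw [integral_stdGauss, integral_stdGauss, hcv, ← integral_sub hi2 hi1]
  have hle : ∀ x, ‖gaussDensity x * G (ψ x) - |(ψ' x).det| * (gaussDensity (ψ x) * G (ψ x))‖ ≤
      h * ε * gaussDensity x := by
    intro x
    rw [hρ]
    have : gaussDensity x * G (ψ x) - |(ψ' x).det| * (gaussDensity x *
        Real.exp (-(h ^ 2 * energy (X x) / 2)) * G (ψ x)) =
        (1 - |(ψ' x).det| * Real.exp (-(h ^ 2 * energy (X x) / 2))) * G (ψ x) *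
          gaussDensity x := by ring
    rw [this, norm_mul, norm_mul, Real.norm_eq_abs, Real.norm_eq_abs,
      Real.norm_of_nonneg (gaussDensity_pos x).le]
    refine mul_le_mul_of_nonneg_right ?_ (gaussDensity_pos x).le
    calc _ ≤ h * ε * 1 := mul_le_mul (hkey x) (hG1 _) (abs_nonneg _) (by positivity)
      _ = _ := mul_one _
  rw [← Real.norm_eq_abs]
  refine (norm_integral_le_of_norm_le (integrable_gaussDensity.const_mul (h * ε))
    (ae_of_all _ hle)).trans (le_of_eq ?_)
  rw [integral_const_mul]
  have := integral_stdGauss (ι := ι) fun _ => 1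
  simp only [integral_const, probReal_univ, smul_eq_mul, mul_one] at this
  rw [← this, mul_one]

end Jacobian

/-! ### The exact Gaussian autoregressive step -/

section LinearStep

variable {ι : Type*} [Fintype ι]

theorem gaussianReal_prod_map_add (a b : ℝ≥0) (c : ℝ) (hc : c ^ 2 * a + b = 1) :
    ((gaussianReal 0 a).prod (gaussianReal 0 b)).map (fun p => c * p.1 + p.2) =
      gaussianReal 0 1 := by
  have h1 : (fun p : ℝ × ℝ => c * p.1 + p.2) = (fun p => p.1 + p.2) ∘ Prod.map (c * ·) id := rfl
  rw [h1, ← Measure.map_map (by fun_prop) (by fun_prop),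
    ← Measure.map_prod_map _ _ (by fun_prop) measurable_id, Measure.map_id,
    gaussianReal_map_const_mul]
  refine (gaussianReal_conv_gaussianReal (m₁ := c * 0) (m₂ := 0) (v₁ := _ * a) (v₂ := b)).trans ?_
  congr 1
  · simp
  · exact NNReal.eq (by simpa using hc)

/-- The stationary autoregressive step preserves the standard Gaussian measure. -/
theorem stdGauss_prod_map (v : ι → ℝ≥0) (c : ι → ℝ) (hc : ∀ i, c i ^ 2 + v i = 1) :
    ((stdGauss ι).prod (Measure.pi fun i => gaussianReal 0 (v i))).map
      (fun p i => c i * p.1 i + p.2 i) = stdGauss ι := by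
  rw [← (measurePreserving_arrowProdEquivProdArrow ℝ ℝ ι (fun _ => gaussianReal 0 1)
    (fun i => gaussianReal 0 (v i))).map_eq, Measure.map_map (by fun_prop)
    (MeasurableEquiv.measurable _)]
  have h1 : ∀ i, ((gaussianReal 0 1).prod (gaussianReal 0 (v i))).map
      (fun p => c i * p.1 + p.2) = gaussianReal 0 1 := fun i =>
    gaussianReal_prod_map_add 1 (v i) (c i) (by simpa using hc i)
  have := Measure.pi_map_pi (μ := fun i => (gaussianReal 0 1).prod (gaussianReal 0 (v i)))
    (f := fun i p => c i * p.1 + p.2) (hμ := fun i => by rw [h1]; infer_instance)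
    (fun i => by fun_prop)
  simp only [h1] at this
  exact this

end LinearStep

/-! ### Truncation preserves the two structural properties of the field -/

section Cutoff

variable {ι : Type*} [Fintype ι]

/-- The gradient of a radial cutoff is parallel to x, and X is orthogonal to x, so the product rule
adds nothing to the divergence. -/
theorem divergence_cutoff_smul [DecidableEq ι] {X : (ι → ℝ) → ι → ℝ} (hX : ContDiff ℝ 1 X)
    (hdiv : ∀ x, divergence X x = 0) (hen : ∀ x, ∑ i, x i * X x i = 0) (r : ℝ) (x : ι → ℝ) :
    divergence (fun y => cutoff r y • X y) x = 0 := by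
  have hXd : DifferentiableAt ℝ X x := hX.differentiable one_ne_zero x
  have hS : DifferentiableAt ℝ Real.smoothTransition (2 - energy x / r) :=
    (Real.smoothTransition.contDiff (n := 1)).differentiable one_ne_zero _
  have h1 : HasFDerivAt (energy : (ι → ℝ) → ℝ)
      (∑ j, (2 * x j) • ContinuousLinearMap.proj (R := ℝ) (φ := fun _ : ι => ℝ) j) x := by
    unfold energy
    refine HasFDerivAt.fun_sum fun j _ => ?_
    have := (hasFDerivAt_apply (𝕜 := ℝ) (F' := fun _ : ι => ℝ) j x).pow 2
    simpa using this
  have h2 := hS.hasDerivAt.comp_hasFDerivAt x ((h1.mul_const r⁻¹).const_sub 2)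
  have h2' : HasFDerivAt (cutoff r : (ι → ℝ) → ℝ) _ x := h2
  have h3 : ∀ i, pderiv i (fun y => (cutoff r y • X y) i) x =
      cutoff r x * pderiv i (fun y => X y i) x -
        2 * deriv Real.smoothTransition (2 - energy x / r) * r⁻¹ * (x i * X x i) := by
    intro i
    have hXi : HasFDerivAt (fun y => X y i) (fderiv ℝ (fun y => X y i) x) x :=
      (differentiableAt_pi.1 hXd i).hasFDerivAt
    have h4 := h2'.mul hXi
    have h5 : (fun y => (cutoff r y • X y) i) = fun y => cutoff r y * X y i := rfl
    rw [h5, pderiv, HasFDerivAt.fderiv (f := fun y => cutoff r y * X y i) h4]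
    simp [Pi.single_apply, pderiv]
    ring
  simp only [divergence, h3]
  rw [Finset.sum_sub_distrib, ← Finset.mul_sum, ← Finset.mul_sum, hen,
    show ∑ i, pderiv i (fun y => X y i) x = 0 from hdiv x]
  simp

theorem sum_mul_cutoff_smul {X : (ι → ℝ) → ι → ℝ} (hen : ∀ x, ∑ i, x i * X x i = 0) (r : ℝ)
    (x : ι → ℝ) : ∑ i, x i * (cutoff r x • X x) i = 0 := by
  have : ∑ i, x i * (cutoff r x • X x) i = cutoff r x * ∑ i, x i * X x i := by
    rw [Finset.mul_sum]
    exact Finset.sum_congr rfl fun i _ => by simp; ring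
  rw [this, hen, mul_zero]

end Cutoff

/-! ### Invariance of the Gaussian measure in finite dimensions -/

section Stationary

variable {ι : Type*} [Fintype ι]

/-- One step of the splitting scheme: an Euler step for the truncated vector field, followed by
the contraction that compensates Gaussian noise of variance `h D_i`. -/
def splitStep (D : ι → ℝ≥0) (X : (ι → ℝ) → ι → ℝ) (r h : ℝ) (x : ι → ℝ) : ι → ℝ := fun i =>
  Real.sqrt (1 - D i * h) * (x + h • (cutoff r x • X x)) i

/-- The drift `-D_i x_i / 2 + X_i(x)`. -/
def splitDrift (D : ι → ℝ≥0) (X : (ι → ℝ) → ι → ℝ) (x : ι → ℝ) : ι → ℝ := fun i =>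
  -(D i / 2 : ℝ) * x i + X x i

theorem contDiff_splitDrift (D : ι → ℝ≥0) {X : (ι → ℝ) → ι → ℝ} (hX : ContDiff ℝ 1 X) :
    ContDiff ℝ 1 (splitDrift D X) := by
  refine contDiff_pi.2 fun i => ?_
  have := contDiff_pi.1 hX i
  unfold splitDrift
  fun_prop

theorem continuous_splitStep (D : ι → ℝ≥0) {X : (ι → ℝ) → ι → ℝ} (hX : ContDiff ℝ 1 X) (r h : ℝ) :
    Continuous (splitStep D X r h) := by
  refine continuous_pi fun i => continuous_const.mul ?_
  have h1 := hX.continuous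
  have h2 : Continuous (cutoff r : (ι → ℝ) → ℝ) := (contDiff_cutoff r (n := 0)).continuous
  exact (continuous_apply i).comp (continuous_id.add ((h2.smul h1).const_smul h))

/-- Substituting x = 1 - s² with s = √(1 - x) turns both bounds into polynomial inequalities for s
in [0, 1]. -/
theorem abs_sqrt_one_sub_sub_le {x : ℝ} (h0 : 0 ≤ x) (h1 : x ≤ 1) :
    |Real.sqrt (1 - x) - 1 + x / 2| ≤ x ^ 2 ∧ |Real.sqrt (1 - x) - 1| ≤ x := by
  set s := Real.sqrt (1 - x)
  have hs : s ^ 2 = 1 - x := Real.sq_sqrt (by linarith)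
  have hs0 : 0 ≤ s := Real.sqrt_nonneg _
  have hs1 : s ≤ 1 := Real.sqrt_le_one.2 (by linarith)
  have hx : x = 1 - s ^ 2 := by linarith
  rw [hx]
  constructor <;> rw [abs_le] <;> constructor <;>
    nlinarith [mul_nonneg hs0 (sub_nonneg.2 hs1), sq_nonneg (1 - s), mul_nonneg hs0 hs0,
      mul_nonneg (sq_nonneg (1 - s)) hs0, mul_nonneg (sq_nonneg (1 - s)) (sq_nonneg s)]

/-- Where the cutoff equals 1, the splitting step agrees with the Euler step of the full drift up to
h². This is the consistency needed for pathwise convergence. -/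
theorem norm_splitStep_sub_le (D : ι → ℝ≥0) (X : (ι → ℝ) → ι → ℝ) {S M Q r h : ℝ} {x : ι → ℝ}
    (hS : ∀ i, (D i : ℝ) ≤ S) (hM : ‖x‖ ≤ M) (hQ : ‖X x‖ ≤ Q) (hr : 0 < r) (hxr : energy x ≤ r)
    (hh : 0 ≤ h) (hSh : S * h ≤ 1) (hS0 : 0 ≤ S) :
    ‖splitStep D X r h x - x - h • splitDrift D X x‖ ≤ h * (h * (S ^ 2 * M + S * Q)) := by
  have hM0 : 0 ≤ M := (norm_nonneg _).trans hM
  have hQ0 : 0 ≤ Q := (norm_nonneg _).trans hQ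
  refine (pi_norm_le_iff_of_nonneg (by positivity)).2 fun i => ?_
  have hx0 : 0 ≤ D i * h := mul_nonneg (D i).2 hh
  have hxS : D i * h ≤ S * h := mul_le_mul_of_nonneg_right (hS i) hh
  obtain ⟨h1, h2⟩ := abs_sqrt_one_sub_sub_le hx0 (hxS.trans hSh)
  have e : (splitStep D X r h x - x - h • splitDrift D X x) i =
      (Real.sqrt (1 - D i * h) - 1 + D i * h / 2) * x i +
        (Real.sqrt (1 - D i * h) - 1) * (h * X x i) := by
    simp only [splitStep, splitDrift, cutoff_eq_one hr hxr, Pi.sub_apply, Pi.add_apply,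
      Pi.smul_apply, smul_eq_mul, one_mul]
    ring
  rw [e]
  refine (norm_add_le _ _).trans ?_
  rw [norm_mul, norm_mul, norm_mul, Real.norm_eq_abs, Real.norm_eq_abs (Real.sqrt _ - 1),
    Real.norm_of_nonneg hh]
  have hxi : ‖x i‖ ≤ M := (norm_le_pi_norm x i).trans hM
  have hXi : ‖X x i‖ ≤ Q := (norm_le_pi_norm (X x) i).trans hQ
  calc _ ≤ (S * h) ^ 2 * M + (S * h) * (h * Q) := by
        gcongr
        · exact h1.trans (pow_le_pow_left₀ hx0 hxS 2)
        · exact h2.trans hxS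
    _ = _ := by ring

variable {Ω : Type*} [mΩ : MeasurableSpace Ω] {P : Measure Ω} [IsProbabilityMeasure P]
  {ℱ : Filtration ℝ≥0 mΩ}

/-- `W` is a process adapted to `ℱ`, starting at `0`, with independent Brownian coordinates of
variances `D_i`, and increments independent of the past. -/
structure IsBrownian (P : Measure Ω) (ℱ : Filtration ℝ≥0 mΩ) (D : ι → ℝ≥0)
    (W : ℝ≥0 → Ω → ι → ℝ) : Prop where
  adapted : ∀ t, Measurable[ℱ t] (W t)
  law : ∀ s t, s ≤ t → P.map (fun ω => W t ω - W s ω) =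
    Measure.pi fun i => gaussianReal 0 (D i * (t - s))
  indep : ∀ s t, s ≤ t → Indep (MeasurableSpace.comap (fun ω => W t ω - W s ω) inferInstance)
    (ℱ s) P

/-- The Markov property of one step: the increment is independent of the past, so the joint law is a
product and Fubini applies. -/
theorem integral_step_eq {D : ι → ℝ≥0} {W : ℝ≥0 → Ω → ι → ℝ} (hW : IsBrownian P ℱ D W)
    {s t : ℝ≥0} (hst : s ≤ t) {y : Ω → ι → ℝ} (hy : Measurable[ℱ s] y) {G : (ι → ℝ) → ℝ}
    (hG : Measurable G) (hG1 : ∀ x, |G x| ≤ 1) {Φ : (ι → ℝ) → ι → ℝ} (hΦ : Measurable Φ) :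
    ∫ ω, G (Φ (y ω) + (W t ω - W s ω)) ∂P =
      ∫ x, ∫ w, G (Φ x + w) ∂(Measure.pi fun i => gaussianReal 0 (D i * (t - s))) ∂(P.map y) := by
  have hym : Measurable y := hy.mono (ℱ.le s) le_rfl
  have hΔm : Measurable fun ω => W t ω - W s ω :=
    ((hW.adapted t).mono (ℱ.le t) le_rfl).sub ((hW.adapted s).mono (ℱ.le s) le_rfl)
  have hind : IndepFun y (fun ω => W t ω - W s ω) P :=
    (indep_of_indep_of_le_right (hW.indep s t hst) hy.comap_le).symm
  have h1 := (indepFun_iff_map_prod_eq_prod_map_map hym.aemeasurable hΔm.aemeasurable).1 hind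
  have hGm : Measurable fun p : (ι → ℝ) × (ι → ℝ) => G (Φ p.1 + p.2) :=
    hG.comp ((hΦ.comp measurable_fst).add measurable_snd)
  have := Measure.isProbabilityMeasure_map (μ := P) hym.aemeasurable
  calc _ = ∫ p, G (Φ p.1 + p.2) ∂(P.map fun ω => (y ω, W t ω - W s ω)) :=
        (integral_map (hym.prodMk hΔm).aemeasurable hGm.aestronglyMeasurable).symm
    _ = _ := by
        rw [h1, hW.law s t hst, integral_prod]
        exact Integrable.of_bound hGm.aestronglyMeasurable 1 (ae_of_all _ fun p => hG1 _)

/-- Along the splitting scheme, the law stays close to the standard Gaussian measure. -/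
theorem integral_scheme_sub_le {D : ι → ℝ≥0} {W : ℝ≥0 → Ω → ι → ℝ} (hW : IsBrownian P ℱ D W)
    {x₀ : Ω → ι → ℝ} (hx₀ : Measurable[ℱ 0] x₀) (hlaw : P.map x₀ = stdGauss ι)
    {X : (ι → ℝ) → ι → ℝ} (hX : ContDiff ℝ 1 X) {r ε : ℝ} {h : ℝ≥0} (hD : ∀ i, D i * h ≤ 1)
    (hE : ∀ G : (ι → ℝ) → ℝ, Measurable G → (∀ x, |G x| ≤ 1) →
      |∫ x, G (x + (h : ℝ) • (cutoff r x • X x)) ∂(stdGauss ι) - ∫ x, G x ∂(stdGauss ι)| ≤ h * ε)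
    (j : ℕ) :
    (Measurable[ℱ (j * h)] fun ω => scheme (splitStep D X r h)
      (gridIncrement (fun s : ℝ => W s.toNNReal ω) h) (x₀ ω) j) ∧
    ∀ G : (ι → ℝ) → ℝ, Measurable G → (∀ x, |G x| ≤ 1) →
      |∫ ω, G (scheme (splitStep D X r h)
        (gridIncrement (fun s : ℝ => W s.toNNReal ω) h) (x₀ ω) j) ∂P -
        ∫ x, G x ∂(stdGauss ι)| ≤ j * (h * ε) := by
  induction j with
  | zero =>
    refine ⟨by
      have h0 : ((0 : ℕ) : ℝ≥0) * h = 0 := by simp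
      rw [h0]
      exact hx₀, fun G hG _ => ?_⟩
    have hm : Measurable x₀ := hx₀.mono (ℱ.le 0) le_rfl
    rw [← hlaw, integral_map hm.aemeasurable hG.aestronglyMeasurable]
    simp [scheme]
  | succ j ih =>
    obtain ⟨ihm, ih⟩ := ih
    set y : Ω → ι → ℝ := fun ω => scheme (splitStep D X r h)
      (gridIncrement (fun s : ℝ => W s.toNNReal ω) h) (x₀ ω) j with hy
    have hle : (j : ℝ≥0) * h ≤ (j + 1 : ℕ) * h := by gcongr; simp
    have hcast : ∀ i : ℕ, ((i : ℝ) * (h : ℝ)).toNNReal = i * h := fun i => by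
      rw [← NNReal.coe_natCast, ← NNReal.coe_mul, Real.toNNReal_coe]
    have hsucc : ∀ ω, scheme (splitStep D X r h)
        (gridIncrement (fun s : ℝ => W s.toNNReal ω) h) (x₀ ω) (j + 1) =
        splitStep D X r h (y ω) + (W ((j + 1 : ℕ) * h) ω - W (j * h) ω) := by
      intro ω
      simp only [scheme, gridIncrement, hcast, hy]
    simp only [hsucc]
    have hΦm : Measurable (splitStep D X r (h : ℝ)) := (continuous_splitStep D hX r h).measurable
    refine ⟨(hΦm.comp (ihm.mono (ℱ.mono hle) le_rfl)).add
      ((hW.adapted _).sub ((hW.adapted _).mono (ℱ.mono hle) le_rfl)), fun G hG hG1 => ?_⟩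
    rw [integral_step_eq hW hle ihm hG hG1 hΦm]
    have hsub : ((j + 1 : ℕ) : ℝ≥0) * h - j * h = h := by
      push_cast
      rw [add_mul, one_mul, add_tsub_cancel_left]
    rw [hsub]
    set β := Measure.pi fun i => gaussianReal 0 (D i * h) with hβ
    -- The contraction and the noise are averaged into the test function, leaving only the Euler
    -- step to be compared with the identity.
    set G' : (ι → ℝ) → ℝ := fun z => ∫ w, G ((fun i => Real.sqrt (1 - D i * h) * z i) + w) ∂β
      with hG'
    have hGm : Measurable fun p : (ι → ℝ) × (ι → ℝ) =>
        G ((fun i => Real.sqrt (1 - D i * h) * p.1 i) + p.2) := by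
      refine hG.comp (Measurable.add ?_ measurable_snd)
      fun_prop
    have hG'm : Measurable G' := (hGm.stronglyMeasurable.integral_prod_right).measurable
    have hG'1 : ∀ x, |G' x| ≤ 1 := fun x => by
      have := norm_integral_le_of_norm_le_const (μ := β) (C := 1)
        (f := fun w => G ((fun i => Real.sqrt (1 - D i * h) * x i) + w))
        (ae_of_all _ fun w => hG1 _)
      simpa [hβ] using this
    have hym : Measurable y := ihm.mono (ℱ.le _) le_rfl
    have e1 : ∫ x, ∫ w, G (splitStep D X r h x + w) ∂β ∂(P.map y) =
        ∫ ω, G' (y ω + (h : ℝ) • (cutoff r (y ω) • X (y ω))) ∂P := by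
      rw [← integral_map (f := fun z => G' (z + (h : ℝ) • (cutoff r z • X z))) hym.aemeasurable]
      · rfl
      · refine (hG'm.comp ?_).aestronglyMeasurable
        have h2 : Continuous (cutoff r : (ι → ℝ) → ℝ) := (contDiff_cutoff r (n := 0)).continuous
        exact (continuous_id.add ((h2.smul hX.continuous).const_smul (h : ℝ))).measurable
    have hψm : Measurable fun z : ι → ℝ => z + (h : ℝ) • (cutoff r z • X z) := by
      have h2 : Continuous (cutoff r : (ι → ℝ) → ℝ) := (contDiff_cutoff r (n := 0)).continuous
      exact (continuous_id.add ((h2.smul hX.continuous).const_smul (h : ℝ))).measurable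
    -- The contraction leaves variance 1 - D_i h and the noise adds D_i h. Thus this half of the
    -- step is exact, and each step adds only the Euler error h ε.
    have e2 : ∫ x, G' x ∂(stdGauss ι) = ∫ x, G x ∂(stdGauss ι) := by
      have hinv := stdGauss_prod_map (fun i => D i * h) (fun i => Real.sqrt (1 - D i * h))
        (fun i => by
          have : (D i : ℝ) * h ≤ 1 := by exact_mod_cast hD i
          rw [Real.sq_sqrt (by linarith)]
          push_cast; ring)
      calc _ = ∫ p, G ((fun i => Real.sqrt (1 - D i * h) * p.1 i) + p.2)
            ∂((stdGauss ι).prod β) := by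
            rw [integral_prod]
            exact Integrable.of_bound hGm.aestronglyMeasurable 1 (ae_of_all _ fun p => hG1 _)
        _ = _ := by
            conv_rhs => rw [← hinv]
            rw [integral_map (by fun_prop) hG.aestronglyMeasurable]
            rfl
    have t1 := ih (fun z => G' (z + (h : ℝ) • (cutoff r z • X z))) (hG'm.comp hψm)
      fun x => hG'1 _
    have t2 := hE G' hG'm hG'1
    rw [e2] at t2
    rw [e1]
    have := abs_sub_le (∫ ω, G' (y ω + (h : ℝ) • (cutoff r (y ω) • X (y ω))) ∂P)
      (∫ x, G' (x + (h : ℝ) • (cutoff r x • X x)) ∂(stdGauss ι)) (∫ x, G x ∂(stdGauss ι))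
    push_cast
    linarith

/-- A diagonal choice. It lets the cutoff radius tend to infinity with the number of steps, slowly
enough that the estimate for that radius is already in force. -/
theorem exists_tendsto_of_forall_eventually {p : ℕ → ℕ → Prop}
    (hp : ∀ r, ∀ᶠ n in atTop, p r n) :
    ∃ r : ℕ → ℕ, Tendsto r atTop atTop ∧ ∀ᶠ n in atTop, p (r n) n := by
  simp only [eventually_atTop] at hp
  choose N hN using hp
  classical
  refine ⟨fun n => Nat.findGreatest (fun r => N r ≤ n) n, ?_, ?_⟩
  · refine tendsto_atTop.2 fun R => ?_
    filter_upwards [eventually_ge_atTop R, eventually_ge_atTop (N R)] with n h1 h2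
    exact Nat.le_findGreatest h1 h2
  · filter_upwards [eventually_ge_atTop (N 0)] with n hn
    exact hN _ n (Nat.findGreatest_spec (P := fun r => N r ≤ n) (Nat.zero_le n) hn)

/-- The standard Gaussian measure is invariant under
`du_i = (-D_i u_i / 2 + X_i(u)) dt + D_i^{1/2} dW_i` if `X` is divergence free and preserves
the energy. -/
theorem map_eq_stdGauss [DecidableEq ι] {D : ι → ℝ≥0} {W : ℝ≥0 → Ω → ι → ℝ} (hW : IsBrownian P ℱ D W)
    {X : (ι → ℝ) → ι → ℝ} (hX : ContDiff ℝ 1 X)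
    (hdiv : ∀ x, divergence X x = 0) (hen : ∀ x, ∑ i, x i * X x i = 0)
    {u : ℝ≥0 → Ω → ι → ℝ} (hu : ∀ t, Measurable[ℱ t] (u t)) (hlaw : P.map (u 0) = stdGauss ι)
    {T : ℝ≥0} (hT : 0 < T)
    (hsol : ∀ᵐ ω ∂P, SolvesOn (splitDrift D X) (fun s => W s.toNNReal ω)
      (fun s => u s.toNNReal ω) T) :
    P.map (u T) = stdGauss ι := by
  have hum : ∀ t, Measurable (u t) := fun t => (hu t).mono (ℱ.le t) le_rfl
  have hTr : (0 : ℝ) < T := hT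
  have hlim : Tendsto (fun n : ℕ => (T : ℝ) / (n : ℝ)) atTop (𝓝[>] 0) := by
    refine tendsto_nhdsWithin_iff.2 ⟨tendsto_const_div_atTop_nhds_zero_nat _, ?_⟩
    filter_upwards [eventually_gt_atTop 0] with n hn
    exact div_pos hTr (by exact_mod_cast hn)
  set S : ℝ := ∑ i, (D i : ℝ)
  have hS0 : 0 ≤ S := Finset.sum_nonneg fun i _ => (D i).2
  have hS : ∀ i, (D i : ℝ) ≤ S := fun i =>
    Finset.single_le_sum (f := fun i => (D i : ℝ)) (fun i _ => (D i).2) (Finset.mem_univ i)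
  have hSh : ∀ᶠ n : ℕ in atTop, S * ((T : ℝ) / n) ≤ 1 := by
    have h1 : ∀ᶠ h in 𝓝[>] (0 : ℝ), S * h ≤ 1 := by
      filter_upwards [Ioo_mem_nhdsGT (show (0 : ℝ) < 1 / (S + 1) by positivity)] with h hh
      have := (lt_div_iff₀ (by positivity)).1 hh.2
      nlinarith [hh.1]
    exact hlim.eventually h1
  -- The Euler error constant 1 / (r + 1) tends to zero together with the removal of the cutoff.
  obtain ⟨r, hr, hgood⟩ := exists_tendsto_of_forall_eventually
    (p := fun r n => ∀ G : (ι → ℝ) → ℝ, Measurable G → (∀ x, |G x| ≤ 1) →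
      |∫ x, G (x + ((T : ℝ) / n) • (cutoff (r + 1 : ℝ) x • X x)) ∂(stdGauss ι) -
        ∫ x, G x ∂(stdGauss ι)| ≤ (T : ℝ) / n * (1 / (r + 1)))
    (fun r => by
      have hXr : ContDiff ℝ 1 fun x => cutoff (r + 1 : ℝ) x • X x :=
        (contDiff_cutoff _ (n := 1)).smul hX
      exact hlim.eventually (integral_euler_sub_le hXr
        (hasCompactSupport_cutoff (by positivity)).smul_right
        (divergence_cutoff_smul hX hdiv hen _) (sum_mul_cutoff_smul hen _)
        (show (0 : ℝ) < 1 / (r + 1) by positivity)))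
  set y : ℕ → Ω → ι → ℝ := fun n ω => scheme (splitStep D X (r n + 1) (T / n))
      (gridIncrement (fun s : ℝ => W s.toNNReal ω) (T / n)) (u 0 ω) n with hy
  have hpath : ∀ᵐ ω ∂P, Tendsto (fun n => y n ω) atTop (𝓝 (u T ω)) := by
    filter_upwards [hsol] with ω hω
    obtain ⟨M, hM⟩ := isCompact_Icc.exists_bound_of_continuousOn hω.1
    obtain ⟨Q, hQ⟩ := (isCompact_closedBall (0 : ι → ℝ) (M + 1)).exists_bound_of_continuousOn
      hX.continuous.continuousOn
    have := tendsto_scheme (lipschitzOnBalls_of_contDiff (contDiff_splitDrift D hX)) hTr hω hM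
      (Φ := fun n => splitStep D X (r n + 1) (T / n)) (fun ε hε => by
        have hM1 : 0 ≤ M + 1 := by
          have := (norm_nonneg _).trans (hM 0 ⟨le_rfl, hTr.le⟩)
          linarith
        have hQ0 : 0 ≤ Q := (norm_nonneg _).trans (hQ 0 (Metric.mem_closedBall_self hM1))
        have hsmall : ∀ᶠ n : ℕ in atTop, (T : ℝ) / n * (S ^ 2 * (M + 1) + S * Q) ≤ ε := by
          have h1 := (tendsto_const_div_atTop_nhds_zero_nat (T : ℝ)).mul_const
            (S ^ 2 * (M + 1) + S * Q)
          rw [zero_mul] at h1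
          filter_upwards [h1.eventually (Iio_mem_nhds hε)] with n hn using le_of_lt hn
        -- A fixed path stays in a bounded set, so the growing cutoff is eventually equal to 1 on a
        -- neighbourhood of it.
        have hbig : ∀ᶠ n : ℕ in atTop,
            (Fintype.card ι : ℝ) * (M + 1) ^ 2 ≤ (r n : ℝ) :=
          (tendsto_natCast_atTop_atTop.comp hr).eventually_ge_atTop _
        filter_upwards [hSh, hsmall, hbig] with n h1 h2 h3 v hv
        rw [mem_closedBall_zero_iff] at hv
        have h4 : energy v ≤ (r n + 1 : ℝ) := by
          refine (energy_le v).trans ?_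
          have : ‖v‖ ^ 2 ≤ (M + 1) ^ 2 := by gcongr
          nlinarith [(Nat.cast_nonneg (Fintype.card ι) : (0 : ℝ) ≤ _)]
        refine (norm_splitStep_sub_le D X hS hv (hQ v (by rwa [mem_closedBall_zero_iff]))
          (by positivity) h4 (by positivity) h1 hS0).trans ?_
        gcongr)
    simpa only [Real.toNNReal_zero, Real.toNNReal_coe] using this
  have hcoe : ∀ n : ℕ, ((T / n : ℝ≥0) : ℝ) = (T : ℝ) / n := fun n => by push_cast; rfl
  -- The n steps, each costing (T / n) / (r_n + 1), add up to T / (r_n + 1).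
  have hscheme : ∀ᶠ n : ℕ in atTop, Measurable (y n) ∧ ∀ G : (ι → ℝ) → ℝ, Measurable G →
      (∀ x, |G x| ≤ 1) → |∫ ω, G (y n ω) ∂P - ∫ x, G x ∂(stdGauss ι)| ≤ T * (1 / (r n + 1)) := by
    filter_upwards [hgood, hSh, eventually_gt_atTop 0] with n h1 h2 h3
    have h4 := integral_scheme_sub_le hW (hu 0) hlaw hX (r := r n + 1) (ε := 1 / (r n + 1))
      (h := T / n) (fun i => by
        have : (D i : ℝ) * (T / n) ≤ 1 :=
          (mul_le_mul_of_nonneg_right (hS i) (by positivity)).trans h2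
        exact_mod_cast this) (by rw [hcoe]; exact h1) n
    simp only [hcoe] at h4
    refine ⟨h4.1.mono (ℱ.le _) le_rfl, fun G hG hG1 => (h4.2 G hG hG1).trans (le_of_eq ?_)⟩
    have : (n : ℝ) ≠ 0 := by positivity
    field_simp
  have hlim2 : Tendsto (fun n => (T : ℝ) * (1 / (r n + 1 : ℝ))) atTop (𝓝 0) := by
    have := (tendsto_one_div_add_atTop_nhds_zero_nat (𝕜 := ℝ)).comp hr
    simpa using this.const_mul (T : ℝ)
  have := Measure.isProbabilityMeasure_map (μ := P) (hum T).aemeasurable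
  refine ext_of_forall_integral_eq_of_IsFiniteMeasure fun f => ?_
  -- Normalises the test function to absolute value at most 1; the added 1 avoids division by zero.
  set c := ‖f‖ + 1 with hc
  have hcpos : 0 < c := by positivity
  set G : (ι → ℝ) → ℝ := fun x => f x / c with hG
  have hGc : Continuous G := f.continuous.div_const c
  have hG1 : ∀ x, |G x| ≤ 1 := fun x => by
    rw [hG, abs_div, abs_of_pos hcpos, div_le_one hcpos]
    have := f.norm_coe_le_norm x
    rw [Real.norm_eq_abs] at this
    linarith
  have hA : Tendsto (fun n => ∫ ω, G (y n ω) ∂P) atTop (𝓝 (∫ x, G x ∂(stdGauss ι))) := by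
    rw [tendsto_iff_dist_tendsto_zero]
    refine squeeze_zero' (Eventually.of_forall fun _ => dist_nonneg) ?_ hlim2
    filter_upwards [hscheme] with n hn
    exact hn.2 G hGc.measurable hG1
  have hB : Tendsto (fun n => ∫ ω, G (y n ω) ∂P) atTop (𝓝 (∫ ω, G (u T ω) ∂P)) := by
    refine tendsto_integral_filter_of_dominated_convergence (fun _ => 1) ?_
      (Eventually.of_forall fun n => ae_of_all _ fun ω => hG1 _) (integrable_const _) ?_
    · filter_upwards [hscheme] with n hn
      exact (hGc.measurable.comp hn.1).aestronglyMeasurable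
    · filter_upwards [hpath] with ω hω
      exact (hGc.tendsto _).comp hω
  have hAB := tendsto_nhds_unique hB hA
  rw [integral_map (hum T).aemeasurable f.continuous.aestronglyMeasurable]
  simp only [hG, integral_div] at hAB
  exact (div_left_inj' hcpos.ne').1 hAB

end Stationary

/-! ### The coefficients and their cyclic cancellation -/

section Coefficients

theorem eucl_neg (k : Mode) : eucl (-k) = eucl k := by simp [eucl]

theorem eucl_zero : eucl 0 = 0 := by simp [eucl]

theorem eucl_sq (k : Mode) : eucl k ^ 2 = (k.1 : ℝ) ^ 2 + (k.2 : ℝ) ^ 2 :=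
  Real.sq_sqrt (by positivity)

theorem eucl_pos {k : Mode} (hk : k ≠ 0) : 0 < eucl k := by
  refine Real.sqrt_pos.2 ?_
  by_contra! h
  refine hk (Prod.ext ?_ ?_)
  · have : (k.1 : ℝ) ^ 2 = 0 := by nlinarith [sq_nonneg (k.1 : ℝ), sq_nonneg (k.2 : ℝ)]
    simpa using this
  · have : (k.2 : ℝ) ^ 2 = 0 := by nlinarith [sq_nonneg (k.1 : ℝ), sq_nonneg (k.2 : ℝ)]
    simpa using this

theorem supLe_neg {N : ℕ} {k : Mode} : SupLe N (-k) ↔ SupLe N k := by simp [SupLe]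

/-- The nonzero modes `k` with `|k|_∞ ≤ M`. -/
def boxModes (M : ℕ) : Finset Mode :=
  (Finset.Icc (-(M : ℤ)) M ×ˢ Finset.Icc (-(M : ℤ)) M).erase 0

theorem mem_boxModes {M : ℕ} {k : Mode} : k ∈ boxModes M ↔ k ≠ 0 ∧ SupLe M k := by
  simp [boxModes, SupLe, abs_le]

theorem neg_mem_boxModes {M : ℕ} {k : Mode} : -k ∈ boxModes M ↔ k ∈ boxModes M := by
  rw [mem_boxModes, mem_boxModes, supLe_neg, neg_ne_zero]

theorem boxModes_mono {M M' : ℕ} (h : M ≤ M') : boxModes M ⊆ boxModes M' := by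
  intro k hk
  rw [mem_boxModes] at hk ⊢
  have : (M : ℤ) ≤ M' := by exact_mod_cast h
  exact ⟨hk.1, hk.2.1.trans this, hk.2.2.trans this⟩

theorem exists_boxModes (S : Finset Mode) : ∃ M, ∀ k ∈ S, k ≠ 0 → k ∈ boxModes M := by
  refine ⟨S.sup fun k => max k.1.natAbs k.2.natAbs, fun k hk h0 => ?_⟩
  have h := Finset.le_sup (f := fun k : Mode => max k.1.natAbs k.2.natAbs) hk
  rw [mem_boxModes, SupLe, Int.abs_eq_natAbs, Int.abs_eq_natAbs]
  exact ⟨h0, by exact_mod_cast (le_max_left _ _).trans h,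
    by exact_mod_cast (le_max_right _ _).trans h⟩

theorem K_comm (N : ℕ) (l m : Mode) : K N l m = K N m l := by
  unfold K
  rw [add_comm l m]
  by_cases h : l ≠ 0 ∧ m ≠ 0 ∧ SupLe N l ∧ SupLe N m ∧ SupLe N (m + l)
  · rw [if_pos h, if_pos (by tauto)]
    ring
  · rw [if_neg h, if_neg (by tauto)]

theorem K_neg (N : ℕ) (l m : Mode) : K N (-l) (-m) = K N l m := by
  unfold K
  rw [← neg_add, supLe_neg, supLe_neg, supLe_neg, eucl_neg, eucl_neg, eucl_neg]
  have h1 : -l ≠ 0 ↔ l ≠ 0 := neg_ne_zero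
  have h2 : -m ≠ 0 ↔ m ≠ 0 := neg_ne_zero
  by_cases h : l ≠ 0 ∧ m ≠ 0 ∧ SupLe N l ∧ SupLe N m ∧ SupLe N (l + m)
  · rw [if_pos h, if_pos (by rwa [h1, h2])]
    simp
  · rw [if_neg h, if_neg (by rwa [h1, h2])]

theorem K_zero_right (N : ℕ) (l : Mode) : K N l 0 = 0 := by simp [K]

theorem K_zero_left (N : ℕ) (l : Mode) : K N 0 l = 0 := by simp [K]

theorem K_self_neg (N : ℕ) (l : Mode) : K N l (-l) = 0 := by
  unfold K
  simp [eucl_zero]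

theorem mem_of_K_ne_zero {N : ℕ} {l m : Mode} (h : K N l m ≠ 0) :
    l ∈ boxModes N ∧ m ∈ boxModes N ∧ l + m ∈ boxModes N := by
  unfold K at h
  have hc : l ≠ 0 ∧ m ≠ 0 ∧ SupLe N l ∧ SupLe N m ∧ SupLe N (l + m) := by
    by_contra hc
    exact h (if_neg hc)
  rw [if_pos hc] at h
  obtain ⟨h1, h2, h3, h4, h5⟩ := hc
  simp only [mem_boxModes]
  refine ⟨⟨h1, h3⟩, ⟨h2, h4⟩, fun h0 => h ?_, h5⟩
  rw [h0, eucl_zero]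
  simp

/-- The cyclic cancellation of the coefficients on triads `l + m + n = 0`. -/
theorem K_cyclic (N : ℕ) {l m n : Mode} (h : l + m + n = 0) :
    K N l m + K N m n + K N n l = 0 := by
  by_cases hl : l = 0
  · subst hl
    have : n = -m := by rw [zero_add] at h; exact (neg_eq_of_add_eq_zero_right h).symm
    subst this
    rw [K_zero_left, K_self_neg, K_zero_right]; simp
  by_cases hm : m = 0
  · subst hm
    have : n = -l := by rw [add_zero] at h; exact (neg_eq_of_add_eq_zero_right h).symm
    subst this
    rw [K_zero_left, K_comm N (-l), K_self_neg, K_zero_right]; simp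
  by_cases hn : n = 0
  · subst hn
    have : m = -l := by rw [add_zero] at h; exact (neg_eq_of_add_eq_zero_right h).symm
    subst this
    rw [K_zero_left, K_self_neg, K_zero_right]; simp
  have e1 : l + m = -n := eq_neg_of_add_eq_zero_left h
  have e2 : m + n = -l := eq_neg_of_add_eq_zero_left (by rw [← h]; abel)
  have e3 : n + l = -m := eq_neg_of_add_eq_zero_left (by rw [← h]; abel)
  unfold K
  rw [e1, e2, e3, supLe_neg, supLe_neg, supLe_neg, eucl_neg, eucl_neg, eucl_neg]
  by_cases hS : SupLe N l ∧ SupLe N m ∧ SupLe N n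
  · rw [if_pos ⟨hl, hm, hS.1, hS.2.1, hS.2.2⟩, if_pos ⟨hm, hn, hS.2.1, hS.2.2, hS.1⟩,
      if_pos ⟨hn, hl, hS.2.2, hS.1, hS.2.1⟩]
    have pl := eucl_pos hl
    have pm := eucl_pos hm
    have pn := eucl_pos hn
    have hl2 := eucl_sq l
    have hm2 := eucl_sq m
    have hn2 := eucl_sq n
    have f1 : (n.1 : ℝ) = -(l.1 + m.1) := by
      have := congrArg Prod.fst h
      simp only [Prod.fst_add, Prod.fst_zero] at this
      have h' : ((l.1 + m.1 + n.1 : ℤ) : ℝ) = 0 := by exact_mod_cast this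
      push_cast at h'
      linarith
    have f2 : (n.2 : ℝ) = -(l.2 + m.2) := by
      have := congrArg Prod.snd h
      simp only [Prod.snd_add, Prod.snd_zero] at this
      have h' : ((l.2 + m.2 + n.2 : ℤ) : ℝ) = 0 := by exact_mod_cast this
      push_cast at h'
      linarith
    -- Multiplying the three coefficients by |l||m||n| squares the one norm in each numerator, so no
    -- square roots remain; substituting n = -(l + m) gives a polynomial identity.
    have key : eucl n ^ 2 * ((l.2 : ℝ) * m.2 - l.1 * m.1) +
        eucl l ^ 2 * ((m.2 : ℝ) * n.2 - m.1 * n.1) +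
        eucl m ^ 2 * ((n.2 : ℝ) * l.2 - n.1 * l.1) = 0 := by
      rw [hl2, hm2, hn2, f1, f2]; ring
    field_simp
    linear_combination key
  · rw [if_neg (by tauto), if_neg (by tauto), if_neg (by tauto)]
    simp

end Coefficients

/-! ### The nonlinearity: finite sums, reality, conservation of energy -/

section Nonlinearity

variable (N : ℕ)

theorem hasFiniteSupport_triad (f : Mode × Mode → ℂ) :
    (Function.support fun p : Mode × Mode => (K N p.1 p.2 : ℂ) * f p).Finite := by
  refine (Finset.finite_toSet (boxModes N ×ˢ boxModes N)).subset fun p hp => ?_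
  have : K N p.1 p.2 ≠ 0 := fun h => hp (by simp [h])
  have := mem_of_K_ne_zero this
  simp [this.1, this.2.1]

theorem summable_triad (f : Mode × Mode → ℂ) :
    Summable fun p : Mode × Mode => (K N p.1 p.2 : ℂ) * f p :=
  summable_of_hasFiniteSupport (hasFiniteSupport_triad N f)

theorem nonlin_eq_sum (v : Mode → ℂ) (k : Mode) :
    nonlin N v k = ∑ l ∈ boxModes N, (K N l (k - l) : ℂ) * v l * v (k - l) := by
  refine tsum_eq_sum fun l hl => ?_
  have : K N l (k - l) = 0 := by
    by_contra h
    exact hl (mem_of_K_ne_zero h).1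
  simp [this]

theorem nonlin_eq_zero (v : Mode → ℂ) {k : Mode} (hk : k ∉ boxModes N) : nonlin N v k = 0 := by
  rw [nonlin_eq_sum]
  refine Finset.sum_eq_zero fun l _ => ?_
  have : K N l (k - l) = 0 := by
    by_contra h
    exact hk (by simpa using (mem_of_K_ne_zero h).2.2)
  simp [this]

theorem nonlin_congr {v w : Mode → ℂ} (h : ∀ k ∈ boxModes N, v k = w k) (k : Mode) :
    nonlin N v k = nonlin N w k := by
  rw [nonlin_eq_sum, nonlin_eq_sum]
  refine Finset.sum_congr rfl fun l hl => ?_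
  by_cases hK : K N l (k - l) = 0
  · simp [hK]
  · rw [h l hl, h _ (mem_of_K_ne_zero hK).2.1]

theorem nonlin_neg {v : Mode → ℂ} (hv : ∀ k, v (-k) = conj (v k)) (k : Mode) :
    nonlin N v (-k) = conj (nonlin N v k) := by
  rw [nonlin_eq_sum, nonlin_eq_sum, map_sum]
  refine Finset.sum_nbij' (fun l => -l) (fun l => -l) (fun l hl => neg_mem_boxModes.2 hl)
    (fun l hl => neg_mem_boxModes.2 hl) (fun l _ => neg_neg l) (fun l _ => neg_neg l)
    fun l _ => ?_
  rw [map_mul, map_mul, Complex.conj_ofReal, ← hv, ← hv, neg_neg,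
    show -(k - -l) = -k - l by abel, ← K_neg, show -(-k - l) = k - -l by abel]

/-- Summation over pairs with prescribed sum. -/
theorem tsum_nonlin_mul (v a : Mode → ℂ) :
    ∑' k, nonlin N v k * a k =
      ∑' p : Mode × Mode, (K N p.1 p.2 : ℂ) * v p.1 * v p.2 * a (p.1 + p.2) := by
  let e : Mode × Mode ≃ Mode × Mode :=
    { toFun := fun p => (p.2, p.1 - p.2)
      invFun := fun p => (p.1 + p.2, p.1)
      left_inv := fun p => by simp
      right_inv := fun p => by simp }
  have hs : Summable fun p : Mode × Mode =>
      (K N p.1 p.2 : ℂ) * v p.1 * v p.2 * a (p.1 + p.2) := by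
    simpa only [mul_assoc] using summable_triad N fun p => v p.1 * (v p.2 * a (p.1 + p.2))
  have hs' := (e.summable_iff).2 hs
  rw [← e.tsum_eq]
  refine Eq.trans ?_ (Summable.tsum_prod hs').symm
  refine tsum_congr fun k => ?_
  rw [nonlin, ← tsum_mul_right]
  refine tsum_congr fun l => ?_
  simp [e]

/-- The rotation of triads (l, m, n) to (m, n, l) permutes the index set and fixes the product of
the three components. The sum of the summand over its three rotations contains the cyclic sum of
coefficients, so three times the series vanishes. -/
theorem tsum_triad_eq_zero (v : Mode → ℂ) :
    ∑' p : Mode × Mode, (K N p.1 p.2 : ℂ) * v p.1 * v p.2 * v (-p.1 - p.2) = 0 := by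
  let e : Mode × Mode ≃ Mode × Mode :=
    { toFun := fun p => (p.2, -p.1 - p.2)
      invFun := fun p => (-p.1 - p.2, p.1)
      left_inv := fun p => Prod.ext (show -p.2 - (-p.1 - p.2) = p.1 by abel) rfl
      right_inv := fun p => Prod.ext rfl (show -(-p.1 - p.2) - p.1 = p.2 by abel) }
  set f : Mode × Mode → ℂ := fun p => (K N p.1 p.2 : ℂ) * v p.1 * v p.2 * v (-p.1 - p.2) with hf
  have hs : Summable f := by
    simpa only [hf, mul_assoc] using summable_triad N fun p => v p.1 * (v p.2 * v (-p.1 - p.2))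
  have hs1 : Summable (f ∘ e) := e.summable_iff.2 hs
  have hs2 : Summable ((f ∘ e) ∘ e) := e.summable_iff.2 hs1
  have h1 : ∑' p, (f ∘ e) p = ∑' p, f p := e.tsum_eq f
  have h2 : ∑' p, ((f ∘ e) ∘ e) p = ∑' p, f p := (e.tsum_eq (f ∘ e)).trans h1
  have h3 : ∑' p, (f p + (f ∘ e) p + ((f ∘ e) ∘ e) p) = 0 := by
    refine (tsum_congr fun p => ?_).trans tsum_zero
    have hcyc := K_cyclic N (l := p.1) (m := p.2) (n := -p.1 - p.2) (by abel)
    have hcyc' : (K N p.1 p.2 : ℂ) + K N p.2 (-p.1 - p.2) + K N (-p.1 - p.2) p.1 = 0 := by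
      exact_mod_cast hcyc
    simp only [hf, e, Function.comp_apply, Equiv.coe_fn_mk]
    rw [show -p.2 - (-p.1 - p.2) = p.1 by abel, show -(-p.1 - p.2) - p.1 = p.2 by abel]
    linear_combination (v p.1 * v p.2 * v (-p.1 - p.2)) * hcyc'
  rw [(hs.add hs1).tsum_add hs2, hs.tsum_add hs1, h1, h2] at h3
  have : (3 : ℂ) * ∑' p, f p = 0 := by linear_combination h3
  simpa using this

/-- Grouping the triad sum by its third mode; components of the nonlinearity outside the box N
vanish, so any larger box gives the same sum. -/
theorem sum_nonlin_mul_neg {M : ℕ} (hNM : N ≤ M) (v : Mode → ℂ) :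
    ∑ k ∈ boxModes M, v (-k) * nonlin N v k = 0 := by
  have h1 := tsum_nonlin_mul N v fun k => v (-k)
  simp only [neg_add'] at h1
  rw [tsum_triad_eq_zero, tsum_eq_sum (s := boxModes M)] at h1
  · simpa only [mul_comm] using h1
  · intro k hk
    rw [nonlin_eq_zero N v fun h => hk (boxModes_mono hNM h), zero_mul]

end Nonlinearity

/-! ### Hartley coordinates of real fields -/

section Hartley

/-- The Hartley coordinate `Re z + Im z`. -/
def hart : ℂ →L[ℝ] ℝ := Complex.reCLM + Complex.imCLM

theorem hart_apply (z : ℂ) : hart z = z.re + z.im := rfl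

/-- The family of Fourier components with given Hartley coordinates. -/
def ofHartley (g : Mode → ℝ) (k : Mode) : ℂ :=
  ((1 + Complex.I) * g k + (1 - Complex.I) * g (-k)) / 2

theorem ofHartley_re (g : Mode → ℝ) (k : Mode) : (ofHartley g k).re = (g k + g (-k)) / 2 := by
  rw [ofHartley, show (2 : ℂ) = ((2 : ℝ) : ℂ) by simp, Complex.div_ofReal_re]
  simp

theorem ofHartley_im (g : Mode → ℝ) (k : Mode) : (ofHartley g k).im = (g k - g (-k)) / 2 := by
  rw [ofHartley, show (2 : ℂ) = ((2 : ℝ) : ℂ) by simp, Complex.div_ofReal_im]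
  simp [sub_eq_add_neg]

theorem ofHartley_neg (g : Mode → ℝ) (k : Mode) : ofHartley g (-k) = conj (ofHartley g k) := by
  apply Complex.ext <;> simp only [Complex.conj_re, Complex.conj_im, ofHartley_re, ofHartley_im,
    neg_neg] <;> ring

theorem hart_ofHartley (g : Mode → ℝ) (k : Mode) : hart (ofHartley g k) = g k := by
  rw [hart_apply, ofHartley_re, ofHartley_im]; ring

theorem ofHartley_hart {v : Mode → ℂ} (hv : ∀ k, v (-k) = conj (v k)) :
    ofHartley (fun k => hart (v k)) = v := by
  funext k
  apply Complex.ext <;> simp only [ofHartley_re, ofHartley_im, hart_apply, hv, Complex.conj_re,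
    Complex.conj_im] <;> ring

/-- A single product is complex, but its imaginary part is odd in k and disappears on adding the
term for -k. -/
theorem ofHartley_pairing (g h : Mode → ℝ) (k : Mode) :
    ofHartley g (-k) * ofHartley h k + ofHartley g k * ofHartley h (-k) =
      ((g k * h k + g (-k) * h (-k) : ℝ) : ℂ) := by
  apply Complex.ext <;> simp only [Complex.add_re, Complex.add_im, Complex.mul_re, Complex.mul_im,
    ofHartley_re, ofHartley_im, neg_neg, Complex.ofReal_re, Complex.ofReal_im] <;> ring

/-- Reflection k → -k symmetrises the sum, after which the pairing identity applies to each pair of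
opposite modes. Energy conservation and both parts of the generator pass to real coordinates through
this identity. -/
theorem sum_ofHartley_pairing {S : Finset Mode} (hS : ∀ k, -k ∈ S ↔ k ∈ S) {wt : Mode → ℝ}
    (hwt : ∀ k, wt (-k) = wt k) (g h : Mode → ℝ) :
    ∑ k ∈ S, (wt k : ℂ) * (ofHartley g (-k) * ofHartley h k) =
      ((∑ k ∈ S, wt k * (g k * h k) : ℝ) : ℂ) := by
  have hr : ∀ a : Mode → ℂ, ∑ k ∈ S, a (-k) = ∑ k ∈ S, a k := fun a =>
    Finset.sum_nbij' (fun k => -k) (fun k => -k) (fun k hk => (hS k).2 hk)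
      (fun k hk => (hS k).2 hk) (fun k _ => neg_neg k) (fun k _ => neg_neg k) fun k _ => rfl
  have h1 := hr fun k => (wt k : ℂ) * (ofHartley g (-k) * ofHartley h k)
  have h2 := hr fun k => (wt k : ℂ) * ((g k * h k : ℝ) : ℂ)
  simp only [hwt, neg_neg] at h1 h2
  have h3 : ∑ k ∈ S, (wt k : ℂ) * (ofHartley g (-k) * ofHartley h k +
      ofHartley g k * ofHartley h (-k)) =
      ∑ k ∈ S, (wt k : ℂ) * ((g k * h k + g (-k) * h (-k) : ℝ) : ℂ) :=
    Finset.sum_congr rfl fun k _ => by rw [ofHartley_pairing]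
  simp only [mul_add, Finset.sum_add_distrib, Complex.ofReal_add, h1, h2] at h3
  push_cast
  push_cast at h3
  linear_combination h3 / 2

end Hartley

/-! ### Passing between fields and coordinates in a finite box -/

section Extension

variable {M : ℕ}

/-- Extension by zero of coordinates indexed by the modes of a box. -/
def extend (g : boxModes M → ℝ) (k : Mode) : ℝ :=
  if h : k ∈ boxModes M then g ⟨k, h⟩ else 0

theorem extend_coe (g : boxModes M → ℝ) (k : boxModes M) : extend g k = g k := by
  simp [extend]

theorem extend_of_mem (g : boxModes M → ℝ) {k : Mode} (h : k ∈ boxModes M) :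
    extend g k = g ⟨k, h⟩ := dif_pos h

theorem extend_of_notMem (g : boxModes M → ℝ) {k : Mode} (h : k ∉ boxModes M) :
    extend g k = 0 := dif_neg h

/-- The Fourier components with Hartley coordinates `g` in the box and `0` outside of it. -/
def fromBox (g : boxModes M → ℝ) : Mode → ℂ := ofHartley (extend g)

/-- The Hartley coordinates in a box. -/
def toBox (M : ℕ) (v : Mode → ℂ) : boxModes M → ℝ := fun k => hart (v k)

theorem fromBox_of_notMem (g : boxModes M → ℝ) {k : Mode} (h : k ∉ boxModes M) :
    fromBox g k = 0 := by
  simp [fromBox, ofHartley, extend_of_notMem g h,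
    extend_of_notMem g (fun h' => h (neg_mem_boxModes.1 h'))]

theorem fromBox_neg (g : boxModes M → ℝ) (k : Mode) : fromBox g (-k) = conj (fromBox g k) :=
  ofHartley_neg _ _

theorem fromBox_zero (g : boxModes M → ℝ) : fromBox g 0 = 0 :=
  fromBox_of_notMem g fun h => (mem_boxModes.1 h).1 rfl

theorem fromBox_toBox {v : Mode → ℂ} (hv : ∀ k, v (-k) = conj (v k)) {k : Mode}
    (hk : k ∈ boxModes M) : fromBox (toBox M v) k = v k := by
  have := congrFun (ofHartley_hart hv) k
  rw [← this, fromBox, ofHartley, ofHartley, extend_of_mem _ hk,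
    extend_of_mem _ (neg_mem_boxModes.2 hk)]
  rfl

variable (M) in
/-- `fromBox` in a fixed component, as a continuous linear map. -/
def fromBoxL (k : Mode) : (boxModes M → ℝ) →L[ℝ] ℂ :=
  LinearMap.toContinuousLinearMap
    { toFun := fun g => fromBox g k
      map_add' := fun g h => by
        have : ∀ k, extend (g + h) k = extend g k + extend h k := fun k => by
          unfold extend; split_ifs <;> simp
        simp only [fromBox, ofHartley, this]
        push_cast; ring
      map_smul' := fun c g => by
        have : ∀ k, extend (c • g) k = c * extend g k := fun k => by
          unfold extend; split_ifs <;> simp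
        simp only [fromBox, ofHartley, this, RingHom.id_apply, Complex.real_smul]
        push_cast; ring }

theorem fromBoxL_apply (k : Mode) (g : boxModes M → ℝ) : fromBoxL M k g = fromBox g k := rfl

theorem fromBox_add (g h : boxModes M → ℝ) : fromBox (g + h) = fromBox g + fromBox h := by
  funext k
  simp only [← fromBoxL_apply, map_add, Pi.add_apply]

theorem fromBox_smul (c : ℝ) (g : boxModes M → ℝ) : fromBox (c • g) = c • fromBox g := by
  funext k
  simp only [← fromBoxL_apply, map_smul, Pi.smul_apply]

theorem sum_boxModes_extend (f : Mode → ℝ → ℝ → ℝ) (g h : boxModes M → ℝ) :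
    ∑ k ∈ boxModes M, f k (extend g k) (extend h k) = ∑ k : boxModes M, f k (g k) (h k) := by
  rw [← Finset.sum_coe_sort]
  simp only [extend_coe]

end Extension

/-! ### The nonlinearity as a vector field on a box -/

section Field

variable (N M : ℕ) (lam : ℝ)

/-- The nonlinearity in Hartley coordinates. -/
def field (g : boxModes M → ℝ) : boxModes M → ℝ := fun k =>
  lam * hart (nonlin N (fromBox g) k)

variable {N M}

/-- The nonlinearity of a real field is again a real field and is supported in the box, so no
information is lost in its Hartley coordinates. -/
theorem fromBox_field (hNM : N ≤ M) (g : boxModes M → ℝ) (k : Mode) :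
    fromBox (field N M lam g) k = lam * nonlin N (fromBox g) k := by
  by_cases hk : k ∈ boxModes M
  · have hv : ∀ k, (lam : ℂ) * nonlin N (fromBox g) (-k) =
        conj ((lam : ℂ) * nonlin N (fromBox g) k) := fun k => by
      rw [nonlin_neg N (fromBox_neg g), map_mul, Complex.conj_ofReal]
    rw [← fromBox_toBox (v := fun k => (lam : ℂ) * nonlin N (fromBox g) k) hv hk]
    congr 1
    funext k
    simp [field, toBox, hart_apply, mul_add]
  · rw [fromBox_of_notMem _ hk, nonlin_eq_zero N _ fun h => hk (boxModes_mono hNM h), mul_zero]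

theorem sum_mul_field (hNM : N ≤ M) (g : boxModes M → ℝ) : ∑ k, g k * field N M lam g k = 0 := by
  have h1 := sum_ofHartley_pairing (S := boxModes M) (fun k => neg_mem_boxModes) (wt := fun _ => 1)
    (fun _ => rfl) (extend g) (extend (field N M lam g))
  have h2 : ∀ k, ofHartley (extend (field N M lam g)) k = lam * nonlin N (fromBox g) k :=
    fromBox_field lam hNM g
  simp only [h2, Complex.ofReal_one, one_mul] at h1
  rw [sum_boxModes_extend fun _ x y => x * y] at h1
  have h3 : ∑ k ∈ boxModes M, ofHartley (extend g) (-k) * (lam * nonlin N (fromBox g) k) = 0 := by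
    have := sum_nonlin_mul_neg N hNM (fromBox g)
    rw [← mul_zero (lam : ℂ), ← this, Finset.mul_sum]
    exact Finset.sum_congr rfl fun k _ => by rw [fromBox]; ring
  rw [h3] at h1
  exact_mod_cast h1.symm

theorem field_eq (g : boxModes M → ℝ) (k : boxModes M) : field N M lam g k =
    lam * hart (∑ l ∈ boxModes N,
      (K N l (k - l) : ℂ) * fromBoxL M l g * fromBoxL M (k - l) g) := by
  rw [field, nonlin_eq_sum]; rfl

theorem temperate_field (k : boxModes M) :
    (fun g => field N M lam g k).HasTemperateGrowth := by
  simp only [field_eq]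
  refine (Function.HasTemperateGrowth.const lam).mul ?_
  refine (ContinuousLinearMap.hasTemperateGrowth hart).comp ?_
  refine Function.HasTemperateGrowth.sum fun l _ => ?_
  exact ((Function.HasTemperateGrowth.const _).mul
    (ContinuousLinearMap.hasTemperateGrowth (fromBoxL M l))).mul
    (ContinuousLinearMap.hasTemperateGrowth (fromBoxL M (k - l)))

theorem contDiff_field : ContDiff ℝ 1 (field N M lam) :=
  contDiff_pi.2 fun k => (temperate_field lam k).1.of_le (by simp)

/-- Moving one Hartley coordinate moves both opposite Fourier components; this is why the diagonal
derivatives below do not vanish individually. -/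
theorem fromBox_single (k : boxModes M) (l : Mode) : fromBox (Pi.single k 1) l =
    if l = k then (1 + Complex.I) / 2 else if l = -k then (1 - Complex.I) / 2 else 0 := by
  have hk0 : (k : Mode) ≠ 0 := (mem_boxModes.1 k.2).1
  have hkn : (k : Mode) ≠ -k := fun h => hk0 (by
    ext
    · have := congrArg Prod.fst h
      simp only [Prod.fst_neg] at this
      simp only [Prod.fst_zero]; omega
    · have := congrArg Prod.snd h
      simp only [Prod.snd_neg] at this
      simp only [Prod.snd_zero]; omega)
  have hext : ∀ j : Mode, extend (Pi.single k (1 : ℝ)) j = if j = k then 1 else 0 := by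
    intro j
    unfold extend
    split_ifs with h1 h2 h2
    · subst h2; simp
    · rw [Pi.single_apply, if_neg fun h => h2 (by rw [← h])]
    · exact absurd (h2 ▸ k.2) h1
    · rfl
  rw [fromBox, ofHartley, hext, hext]
  by_cases h1 : l = k
  · have h2 : ¬ (-l = k) := fun h => hkn (by rw [← h1] at h ⊢; exact h.symm)
    rw [if_pos h1, if_pos h1, if_neg h2]
    simp
  · by_cases h2 : l = -k
    · rw [if_neg h1, if_neg h1, if_pos h2, if_pos (by rw [h2, neg_neg])]
      simp
    · rw [if_neg h1, if_neg h1, if_neg h2, if_neg fun h => h2 (by rw [← h, neg_neg])]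
      simp

/-- Varying the coordinate k changes v_k and v_{-k} only. In the k-th component v_k is multiplied by
v_0 with coefficient zero, while v_{-k} is multiplied by v_{2k}; this product occurs twice, for l =
-k and for l = 2k. -/
theorem pderiv_field (k : boxModes M) (g : boxModes M → ℝ) :
    pderiv k (fun g => field N M lam g k) g =
      lam * (4 * K N (-k) (k + k) * (fromBox g (k + k)).im / 2) := by
  have hd : ∀ l : Mode, HasFDerivAt (fun g => fromBoxL M l g) (fromBoxL M l) g :=
    fun l => (fromBoxL M l).hasFDerivAt
  have h1 : HasFDerivAt (fun g => lam * hart (∑ l ∈ boxModes N,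
      (K N l (k - l) : ℂ) * (fromBoxL M l g * fromBoxL M (k - l) g)))
      (lam • hart.comp (∑ l ∈ boxModes N, (K N l (k - l) : ℂ) •
        (fromBoxL M l g • fromBoxL M (k - l) + fromBoxL M (k - l) g • fromBoxL M l))) g := by
    refine HasFDerivAt.const_mul ?_ lam
    refine hart.hasFDerivAt.comp g ?_
    exact HasFDerivAt.fun_sum fun l _ => ((hd l).mul (hd (k - l))).const_mul _
  have h2 : (fun g => field N M lam g k) = fun g => lam * hart (∑ l ∈ boxModes N,
      (K N l (k - l) : ℂ) * (fromBoxL M l g * fromBoxL M (k - l) g)) := by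
    funext g
    rw [field_eq]
    simp only [mul_assoc]
  have hk0 : (k : Mode) ≠ 0 := (mem_boxModes.1 k.2).1
  have h3 : ∑ l ∈ boxModes N, (K N l (k - l) : ℂ) * (fromBox g l * fromBox (Pi.single k 1) (k - l) +
      fromBox g (k - l) * fromBox (Pi.single k 1) l) =
      (1 - Complex.I) * (K N (-k) (k + k) * fromBox g (k + k)) := by
    have hA : ∑ l ∈ boxModes N, (K N l (k - l) : ℂ) * (fromBox g (k - l) *
        fromBox (Pi.single k 1) l) =
        (1 - Complex.I) / 2 * (K N (-k) (k + k) * fromBox g (k + k)) := by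
      have hterm : ∀ l : Mode, l ≠ -k → (K N l (k - l) : ℂ) * (fromBox g (k - l) *
          fromBox (Pi.single k 1) l) = 0 := fun l hl => by
        rw [fromBox_single]
        by_cases h : l = k
        · rw [h, sub_self, K_zero_right]; simp
        · rw [if_neg h, if_neg hl]; simp
      rw [Finset.sum_eq_single (-(k : Mode)) (fun l _ hl => hterm l hl)]
      · rw [fromBox_single, if_neg, if_pos rfl, sub_neg_eq_add]
        · ring
        · intro h
          have h1 := congrArg Prod.fst h
          have h2 := congrArg Prod.snd h
          simp only [Prod.fst_neg, Prod.snd_neg] at h1 h2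
          exact hk0 (Prod.ext (by simp only [Prod.fst_zero]; omega)
            (by simp only [Prod.snd_zero]; omega))
      · intro h
        have : K N (-(k : Mode)) (k - -k) = 0 := by
          by_contra hK
          exact h (mem_of_K_ne_zero hK).1
        rw [this]; simp
    have hB : ∑ l ∈ boxModes N, (K N l (k - l) : ℂ) * (fromBox g l *
        fromBox (Pi.single k 1) (k - l)) =
        (1 - Complex.I) / 2 * (K N (-k) (k + k) * fromBox g (k + k)) := by
      have hterm : ∀ l : Mode, l ≠ k + k → (K N l (k - l) : ℂ) * (fromBox g l *
          fromBox (Pi.single k 1) (k - l)) = 0 := fun l hl => by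
        rw [fromBox_single]
        by_cases h : k - l = k
        · have : l = 0 := by rwa [sub_eq_self] at h
          rw [this, K_zero_left]; simp
        · rw [if_neg h, if_neg]
          · simp
          · intro h'
            exact hl (by rw [sub_eq_iff_eq_add] at h'; rw [h']; nth_rewrite 1 [h']; abel)
      rw [Finset.sum_eq_single ((k : Mode) + k) (fun l _ hl => hterm l hl)]
      · rw [fromBox_single, show (k : Mode) - (k + k) = -k by abel, if_neg, if_pos rfl, K_comm]
        · ring
        · intro h
          have h1 := congrArg Prod.fst h
          have h2 := congrArg Prod.snd h
          simp only [Prod.fst_neg, Prod.snd_neg] at h1 h2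
          exact hk0 (Prod.ext (by simp only [Prod.fst_zero]; omega)
            (by simp only [Prod.snd_zero]; omega))
      · intro h
        have : K N ((k : Mode) + k) (k - (k + k)) = 0 := by
          by_contra hK
          exact h (mem_of_K_ne_zero hK).1
        rw [this]; simp
    simp only [mul_add, Finset.sum_add_distrib]
    rw [hA, hB]
    ring
  rw [pderiv, h2, h1.fderiv]
  simp only [smul_apply, ContinuousLinearMap.comp_apply,
    sum_apply, add_apply, fromBoxL_apply, smul_eq_mul]
  rw [h3, hart_apply]
  simp only [Complex.mul_re, Complex.mul_im, Complex.sub_re, Complex.sub_im, Complex.one_re,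
    Complex.one_im, Complex.I_re, Complex.I_im, Complex.ofReal_re, Complex.ofReal_im]
  ring

/-- The diagonal derivatives are odd in k: the coefficient is even and Im v_{2k} changes sign. The
sum over a symmetric box therefore vanishes. -/
theorem divergence_field (g : boxModes M → ℝ) :
    divergence (field N M lam) g = 0 := by
  have h1 : divergence (field N M lam) g =
      ∑ k ∈ boxModes M, lam * (4 * K N (-k) (k + k) * (fromBox g (k + k)).im / 2) := by
    rw [← Finset.sum_coe_sort, divergence]
    exact Finset.sum_congr rfl fun k _ => pderiv_field lam k g
  have h2 : ∑ k ∈ boxModes M, lam * (4 * K N (-k) (k + k) * (fromBox g (k + k)).im / 2) =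
      ∑ k ∈ boxModes M, -(lam * (4 * K N (-k) (k + k) * (fromBox g (k + k)).im / 2)) := by
    refine Finset.sum_nbij' (fun k => -k) (fun k => -k) (fun k hk => neg_mem_boxModes.2 hk)
      (fun k hk => neg_mem_boxModes.2 hk) (fun k _ => neg_neg k) (fun k _ => neg_neg k)
      fun k _ => ?_
    rw [← neg_add, fromBox_neg, K_neg, Complex.conj_im]
    ring
  rw [Finset.sum_neg_distrib] at h2
  rw [h1]
  linarith

theorem norm_field_le : ∃ C : ℝ, ∀ g : boxModes M → ℝ, ‖field N M lam g‖ ≤ C * ‖g‖ ^ 2 := by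
  have hk : ∀ k : boxModes M, ∃ C : ℝ, 0 ≤ C ∧ ∀ g : boxModes M → ℝ,
      ‖field N M lam g k‖ ≤ C * ‖g‖ ^ 2 := fun k => by
    refine ⟨|lam| * (‖hart‖ * ∑ l ∈ boxModes N,
      |K N l (k - l)| * ‖fromBoxL M l‖ * ‖fromBoxL M (k - l)‖), by positivity, fun g => ?_⟩
    rw [field_eq, norm_mul, Real.norm_eq_abs, mul_assoc, mul_assoc, Finset.sum_mul]
    gcongr
    refine (hart.le_opNorm _).trans ?_
    gcongr
    refine (norm_sum_le _ _).trans (Finset.sum_le_sum fun l _ => ?_)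
    rw [norm_mul, norm_mul, Complex.norm_real, Real.norm_eq_abs]
    calc _ ≤ |K N l (k - l)| * (‖fromBoxL M l‖ * ‖g‖) * (‖fromBoxL M (k - l)‖ * ‖g‖) := by
          gcongr <;> exact ContinuousLinearMap.le_opNorm _ _
      _ = _ := by ring
  choose C hC0 hC using hk
  refine ⟨∑ k, C k, fun g => ?_⟩
  have hsum : 0 ≤ ∑ k, C k := Finset.sum_nonneg fun k _ => hC0 k
  refine (pi_norm_le_iff_of_nonneg (by positivity)).2 fun k => (hC k g).trans ?_
  gcongr
  exact Finset.single_le_sum (f := C) (fun k _ => hC0 k) (Finset.mem_univ k)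

/-- Orthogonality at z + w replaces z · X(z + w) by -w · X(z + w). With w bounded and X of quadratic
growth, this is of quadratic rather than cubic size in z. -/
theorem coercive_splitDrift {ι : Type*} [Fintype ι] (D : ι → ℝ≥0) {X : (ι → ℝ) → ι → ℝ}
    (hen : ∀ x, ∑ i, x i * X x i = 0) (hX : ∃ C : ℝ, ∀ x, ‖X x‖ ≤ C * ‖x‖ ^ 2) :
    Coercive (splitDrift D X) := by
  obtain ⟨C, hC⟩ := hX
  intro M
  refine ⟨(∑ i, (D i : ℝ) * M ^ 2) + Fintype.card ι * (M * (|C| * (2 + 2 * M ^ 2))),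
    fun z w hw => ?_⟩
  have hM : 0 ≤ M := (norm_nonneg _).trans hw
  have hE := energy_nonneg z
  have e1 : ∑ i, z i * splitDrift D X (z + w) i =
      ∑ i, (-(D i / 2 : ℝ) * (z i * (z i + w i))) - ∑ i, w i * X (z + w) i := by
    have := hen (z + w)
    simp only [Pi.add_apply, add_mul, Finset.sum_add_distrib] at this
    have h1 : ∑ i, z i * splitDrift D X (z + w) i =
        ∑ i, (-(D i / 2 : ℝ) * (z i * (z i + w i))) + ∑ i, z i * X (z + w) i := by
      rw [← Finset.sum_add_distrib]
      refine Finset.sum_congr rfl fun i _ => ?_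
      simp only [splitDrift, Pi.add_apply]; ring
    linarith
  have e2 : ∑ i, (-(D i / 2 : ℝ) * (z i * (z i + w i))) ≤ ∑ i, (D i : ℝ) * M ^ 2 := by
    refine Finset.sum_le_sum fun i _ => ?_
    have h1 : w i ^ 2 ≤ M ^ 2 := by
      rw [← sq_abs]
      exact pow_le_pow_left₀ (abs_nonneg _) ((norm_le_pi_norm w i).trans hw) 2
    have h2 : 0 ≤ (D i : ℝ) := (D i).2
    -- Completing the square bounds the left side by w_i² / 4; the constant 2 is generous and
    -- cancels the 1 / 2 in the drift.
    have h3 : -(z i * (z i + w i)) ≤ 2 * M ^ 2 := by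
      nlinarith [sq_nonneg (z i + w i / 2)]
    nlinarith [mul_le_mul_of_nonneg_left h3 h2]
  have e3 : -∑ i, w i * X (z + w) i ≤
      Fintype.card ι * (M * (|C| * (2 + 2 * M ^ 2))) * (1 + energy z) := by
    have h1 : ‖z + w‖ ^ 2 ≤ (2 + 2 * M ^ 2) * (1 + energy z) := by
      have h2 : ‖z + w‖ ≤ ‖z‖ + M := (norm_add_le _ _).trans (by gcongr)
      have h3 : ‖z + w‖ ^ 2 ≤ (‖z‖ + M) ^ 2 := by gcongr
      nlinarith [sq_norm_le_energy z, sq_nonneg (‖z‖ - M), mul_nonneg (sq_nonneg M) hE]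
    rw [← Finset.sum_neg_distrib]
    calc ∑ i, -(w i * X (z + w) i) ≤ ∑ _i : ι, M * (|C| * ((2 + 2 * M ^ 2) * (1 + energy z))) := by
          refine Finset.sum_le_sum fun i _ => ?_
          refine (neg_le_abs _).trans ?_
          rw [abs_mul]
          have h4 : |w i| ≤ M := (norm_le_pi_norm w i).trans hw
          have h5 : |X (z + w) i| ≤ |C| * ((2 + 2 * M ^ 2) * (1 + energy z)) := by
            refine ((norm_le_pi_norm (X (z + w)) i).trans (hC _)).trans ?_
            calc C * ‖z + w‖ ^ 2 ≤ |C| * ‖z + w‖ ^ 2 := by gcongr; exact le_abs_self C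
              _ ≤ _ := by gcongr
          exact mul_le_mul h4 h5 (abs_nonneg _) hM
      _ = _ := by simp; ring
  have e4 : (0 : ℝ) ≤ ∑ i, (D i : ℝ) * M ^ 2 :=
    Finset.sum_nonneg fun i _ => mul_nonneg (D i).2 (sq_nonneg M)
  rw [e1]
  nlinarith [mul_nonneg e4 hE]

end Field

/-! ### Gaussian laws in Hartley coordinates -/

section HartleyLaw

variable {Ω : Type*} [mΩ : MeasurableSpace Ω] {P : Measure Ω}

/-- Uncorrelated jointly Gaussian variables are independent, and a centred Gaussian is determined by
its variance. -/
theorem map_eq_pi_gaussianReal {ι : Type*} [Fintype ι] {Y : ι → Ω → ℝ}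
    (hY : HasGaussianLaw (fun ω i => Y i ω) P) (hc : ∀ i, ∫ ω, Y i ω ∂P = 0) (v : ι → ℝ≥0)
    (hcov : ∀ i j, i ≠ j → ∫ ω, Y i ω * Y j ω ∂P = 0) (hvar : ∀ i, ∫ ω, Y i ω * Y i ω ∂P = v i) :
    P.map (fun ω i => Y i ω) = Measure.pi fun i => gaussianReal 0 (v i) := by
  have := hY.isProbabilityMeasure
  have hcov' : ∀ i j, cov[Y i, Y j; P] = ∫ ω, Y i ω * Y j ω ∂P := fun i j => by
    rw [covariance_eq_sub (hY.eval i).memLp_two (hY.eval j).memLp_two, hc i, zero_mul, sub_zero]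
    rfl
  have hind : iIndepFun Y P := hY.iIndepFun_of_covariance_eq_zero fun i j hij => by
    rw [hcov', hcov i j hij]
  rw [(iIndepFun_iff_map_fun_eq_pi_map fun i => (hY.eval i).aemeasurable).1 hind]
  congr 1
  funext i
  rw [(hY.eval i).map_eq_gaussianReal, hc i, ← covariance_self (hY.eval i).aemeasurable, hcov',
    hvar, Real.toNNReal_coe]

theorem integrable_mul_of_gaussian {X Y : Ω → ℂ} (hX : HasGaussianLaw X P)
    (hY : HasGaussianLaw Y P) : Integrable (fun ω => X ω * Y ω) P :=
  hX.memLp_two.integrable_mul hY.memLp_two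

/-- The first term sees the Hermitian covariance, the second the imaginary part of the covariance
without conjugation. For the noises considered the latter covariance is real, so only the first term
survives. -/
theorem hart_mul_hart (z w : ℂ) : hart z * hart w = (z * conj w).re + (z * w).im := by
  simp only [hart_apply, Complex.mul_re, Complex.mul_im, Complex.conj_re, Complex.conj_im]
  ring

/-- The Hartley coordinates of a complex white noise are independent Gaussians. -/
theorem map_hart_eq_pi {Z : Mode → Ω → ℂ} (hZ : IsGaussianProcess Z P)
    (hc : ∀ k, ∫ ω, Z k ω ∂P = 0) (hconj : ∀ k, ∀ᵐ ω ∂P, Z (-k) ω = conj (Z k ω)) (c : ℝ≥0)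
    (hcov : ∀ k l, ∫ ω, Z k ω * Z l ω ∂P = if k ≠ 0 ∧ k + l = 0 then (c : ℂ) else 0)
    (σ : Mode → ℝ≥0) (M : ℕ) :
    P.map (fun ω (k : boxModes M) => (σ k : ℝ) * hart (Z k ω)) =
      Measure.pi fun k : boxModes M => gaussianReal 0 (σ k ^ 2 * c) := by
  have hprod : ∀ k l : Mode, k ≠ 0 →
      ∫ ω, hart (Z k ω) * hart (Z l ω) ∂P = if k = l then (c : ℝ) else 0 := by
    intro k l hk
    have h1 : ∫ ω, hart (Z k ω) * hart (Z l ω) ∂P =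
        ∫ ω, ((Z k ω * Z (-l) ω).re + (Z k ω * Z l ω).im) ∂P := by
      refine integral_congr_ae ?_
      filter_upwards [hconj l] with ω hω
      rw [hart_mul_hart, hω]
    have i1 : Integrable (fun ω => Z k ω * Z (-l) ω) P :=
      integrable_mul_of_gaussian (hZ.hasGaussianLaw_eval k) (hZ.hasGaussianLaw_eval (-l))
    have i2 : Integrable (fun ω => Z k ω * Z l ω) P :=
      integrable_mul_of_gaussian (hZ.hasGaussianLaw_eval k) (hZ.hasGaussianLaw_eval l)
    have h2 : ∫ ω, (Z k ω * Z (-l) ω).re ∂P = (∫ ω, Z k ω * Z (-l) ω ∂P).re := integral_re i1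
    have h3 : ∫ ω, (Z k ω * Z l ω).im ∂P = (∫ ω, Z k ω * Z l ω ∂P).im := integral_im i2
    have j1 : Integrable (fun ω => (Z k ω * Z (-l) ω).re) P := i1.re
    have j2 : Integrable (fun ω => (Z k ω * Z l ω).im) P := i2.im
    rw [h1, integral_add j1 j2, h2, h3, hcov, hcov]
    have h4 : k + -l = 0 ↔ k = l := by rw [← sub_eq_add_neg, sub_eq_zero]
    have h5 : ((if k ≠ 0 ∧ k + l = 0 then (c : ℂ) else 0)).im = 0 := by split_ifs <;> simp
    rw [h5, add_zero]
    simp only [h4, hk, ne_eq, not_false_eq_true, true_and]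
    split_ifs <;> simp
  have hmem : ∀ k : boxModes M, (k : Mode) ≠ 0 := fun k => (mem_boxModes.1 k.2).1
  refine map_eq_pi_gaussianReal (Y := fun (k : boxModes M) ω => (σ k : ℝ) * hart (Z k ω)) ?_ ?_ _ ?_ ?_
  · exact (hZ.comp_left fun k => (σ k : ℝ) • hart).hasGaussianLaw (boxModes M)
  · intro k
    have h1 : ∫ ω, hart (Z k ω) ∂P = hart (∫ ω, Z k ω ∂P) :=
      hart.integral_comp_comm (hZ.hasGaussianLaw_eval (k : Mode)).integrable
    rw [integral_const_mul, h1, hc, map_zero, mul_zero]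
  · intro k l hkl
    have : ∀ ω, (σ k : ℝ) * hart (Z k ω) * (σ l * hart (Z l ω)) =
        (σ k * σ l : ℝ) * (hart (Z k ω) * hart (Z l ω)) := fun ω => by ring
    simp only [this]
    rw [integral_const_mul, hprod k l (hmem k), if_neg fun h => hkl (Subtype.ext h), mul_zero]
  · intro k
    have : ∀ ω, (σ k : ℝ) * hart (Z k ω) * (σ k * hart (Z k ω)) =
        (σ k * σ k : ℝ) * (hart (Z k ω) * hart (Z k ω)) := fun ω => by ring
    simp only [this]
    rw [integral_const_mul, hprod k k (hmem k), if_pos rfl]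
    push_cast; ring

end HartleyLaw

/-! ### Orthogonality of the Fourier basis -/

section FourierBasis

theorem e_neg (k : Mode) (x : Torus) : e (-k) x = conj (e k x) := by
  simp only [e, Prod.fst_neg, Prod.snd_neg, fourier_neg, map_mul, Complex.conj_ofReal]

theorem e_mul_e (k l : Mode) (x : Torus) : e k x * e l x = ((2 * Real.pi)⁻¹ : ℝ) * e (k + l) x := by
  simp only [e, Prod.fst_add, Prod.snd_add, fourier_add]
  ring

theorem integral_e_mul_e (k l : Mode) :
    ∫ x, e k x * e l x = if k + l = 0 then 1 else 0 := by
  simp only [e_mul_e]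
  rw [integral_const_mul]
  split_ifs with h
  · rw [h]
    have h0 : ∀ x : Torus, e 0 x = ((2 * Real.pi)⁻¹ : ℝ) := fun x => by simp [e]
    simp only [h0, integral_const]
    have hvol : (volume : Measure Torus).real univ = (2 * Real.pi) * (2 * Real.pi) := by
      rw [Measure.volume_eq_prod, ← univ_prod_univ, measureReal_prod_prod]
      simp only [Measure.real, AddCircle.measure_univ]
      rw [ENNReal.toReal_ofReal Real.two_pi_pos.le]
    rw [hvol, Complex.real_smul]
    have : (Real.pi : ℂ) ≠ 0 := by exact_mod_cast Real.pi_ne_zero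
    push_cast
    field_simp
  · rw [integral_e _ h, mul_zero]

theorem integrable_of_continuous_torus {F : Type*} [NormedAddCommGroup F] {f : Torus → F}
    (hf : Continuous f) : Integrable f :=
  hf.integrable_of_hasCompactSupport (HasCompactSupport.of_compactSpace _)

theorem inner_toLp_eq {f g : Torus → ℝ} (hf : Continuous f) (hg : Continuous g) :
    inner ℝ ((memLp_of_continuous f hf).toLp) ((memLp_of_continuous g hg).toLp) =
      ∫ x, f x * g x := by
  rw [L2.inner_def]
  refine integral_congr_ae ?_
  filter_upwards [(memLp_of_continuous f hf).coeFn_toLp, (memLp_of_continuous g hg).coeFn_toLp]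
    with x h1 h2
  rw [h1, h2]
  simp [mul_comm]

theorem aVec_neg (k : Mode) (hk : k ≠ 0) (hk' : -k ≠ 0) : aVec (-k) hk' = aVec k hk := by
  apply Subtype.ext
  simp only [aVec]
  congr 1
  funext x
  rw [e_neg, Complex.conj_re]

theorem bVec_neg (k : Mode) (hk : k ≠ 0) (hk' : -k ≠ 0) : bVec (-k) hk' = -bVec k hk := by
  apply Subtype.ext
  simp only [bVec, NegMemClass.coe_neg]
  rw [← MemLp.toLp_neg]
  congr 1
  funext x
  rw [e_neg, Complex.conj_im, Pi.neg_apply]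

/-- These are the real and imaginary parts of the integral of e_k e_l, without conjugation, arranged
as they occur in the expectation of η_k η_l. -/
theorem inner_vec (k l : Mode) (hk : k ≠ 0) (hl : l ≠ 0) :
    ((inner ℝ (aVec k hk) (aVec l hl) - inner ℝ (bVec k hk) (bVec l hl) : ℝ) : ℂ) -
      Complex.I * ((inner ℝ (aVec k hk) (bVec l hl) + inner ℝ (bVec k hk) (aVec l hl) : ℝ) : ℂ) =
      if k + l = 0 then 1 else 0 := by
  have hr : ∀ k, Continuous fun x => (e k x).re := fun k =>
    Complex.continuous_re.comp (e_continuous k)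
  have hi : ∀ k, Continuous fun x => (e k x).im := fun k =>
    Complex.continuous_im.comp (e_continuous k)
  have h1 : inner ℝ (aVec k hk) (aVec l hl) = ∫ x, (e k x).re * (e l x).re :=
    inner_toLp_eq (hr k) (hr l)
  have h2 : inner ℝ (bVec k hk) (bVec l hl) = ∫ x, (e k x).im * (e l x).im :=
    inner_toLp_eq (hi k) (hi l)
  have h3 : inner ℝ (aVec k hk) (bVec l hl) = ∫ x, (e k x).re * (e l x).im :=
    inner_toLp_eq (hr k) (hi l)
  have h4 : inner ℝ (bVec k hk) (aVec l hl) = ∫ x, (e k x).im * (e l x).re :=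
    inner_toLp_eq (hi k) (hr l)
  have hint : Integrable fun x => e k x * e l x :=
    integrable_of_continuous_torus ((e_continuous k).mul (e_continuous l))
  have i1 : Integrable fun x => (e k x).re * (e l x).re :=
    integrable_of_continuous_torus ((hr k).mul (hr l))
  have i2 : Integrable fun x => (e k x).im * (e l x).im :=
    integrable_of_continuous_torus ((hi k).mul (hi l))
  have i3 : Integrable fun x => (e k x).re * (e l x).im :=
    integrable_of_continuous_torus ((hr k).mul (hi l))
  have i4 : Integrable fun x => (e k x).im * (e l x).re :=
    integrable_of_continuous_torus ((hi k).mul (hr l))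
  rw [h1, h2, h3, h4, ← integral_sub i1 i2, ← integral_add i3 i4]
  have h5 : ∫ x, ((e k x).re * (e l x).re - (e k x).im * (e l x).im) =
      (∫ x, e k x * e l x).re := integral_re hint
  have h6 : ∫ x, ((e k x).re * (e l x).im + (e k x).im * (e l x).re) =
      (∫ x, e k x * e l x).im := integral_im hint
  rw [h5, h6, integral_e_mul_e]
  split_ifs <;> simp

end FourierBasis

/-! ### The Fourier components of white noise -/

section WhiteNoise

theorem modes_zero {Ω : Type*} {η : L20 → Ω → ℝ} (ω : Ω) : modes η ω 0 = 0 := by simp [modes]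

theorem modes_of_ne {Ω : Type*} {η : L20 → Ω → ℝ} {k : Mode} (hk : k ≠ 0) (ω : Ω) :
    modes η ω k = (η (aVec k hk) ω : ℂ) - Complex.I * (η (bVec k hk) ω : ℂ) := by
  simp [modes, hk]

variable {Ω : Type*} [mΩ : MeasurableSpace Ω] {P : Measure Ω} {η : L20 → Ω → ℝ}

/-- Linearity of the process is not part of its definition. The covariance gives E[(η(-h) + η(h))²]
= 0, which recovers it almost surely in the case needed for the reality of the modes. -/
theorem isIsonormal_neg {H : Type*} [NormedAddCommGroup H] [InnerProductSpace ℝ H]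
    {η : H → Ω → ℝ} (hη : IsIsonormal P η) (h : H) : ∀ᵐ ω ∂P, η (-h) ω = -η h ω := by
  have m1 := (hη.gaussian.hasGaussianLaw_eval h).memLp_two
  have m2 := (hη.gaussian.hasGaussianLaw_eval (-h)).memLp_two
  have h1 : ∫ ω, (η (-h) ω + η h ω) ^ 2 ∂P = 0 := by
    have e1 : ∀ ω, (η (-h) ω + η h ω) ^ 2 =
        η (-h) ω * η (-h) ω + 2 * (η (-h) ω * η h ω) + η h ω * η h ω := fun ω => by ring
    simp only [e1]
    have i1 : Integrable (fun ω => η (-h) ω * η (-h) ω) P := m2.integrable_mul m2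
    have i2 : Integrable (fun ω => 2 * (η (-h) ω * η h ω)) P :=
      (m2.integrable_mul m1).const_mul 2
    have i3 : Integrable (fun ω => η h ω * η h ω) P := m1.integrable_mul m1
    have i4 : Integrable (fun ω => η (-h) ω * η (-h) ω + 2 * (η (-h) ω * η h ω)) P := i1.add i2
    rw [integral_add i4 i3, integral_add i1 i2, integral_const_mul, hη.covariance, hη.covariance,
      hη.covariance, inner_neg_neg, inner_neg_left]
    ring
  have h2 := (integral_eq_zero_iff_of_nonneg (fun ω => sq_nonneg (η (-h) ω + η h ω))
    ((m2.add m1).integrable_sq)).1 h1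
  filter_upwards [h2] with ω hω
  have : η (-h) ω + η h ω = 0 := by simpa using hω
  linarith

theorem modes_neg (hη : IsWhiteNoise P η) (k : Mode) :
    ∀ᵐ ω ∂P, modes η ω (-k) = conj (modes η ω k) := by
  by_cases hk : k = 0
  · subst hk
    simp [modes_zero]
  have hk' : -k ≠ 0 := neg_ne_zero.2 hk
  filter_upwards [isIsonormal_neg hη (bVec k hk)] with ω hω
  rw [modes_of_ne hk, modes_of_ne hk', aVec_neg k hk hk', bVec_neg k hk hk', hω]
  simp

theorem isGaussianProcess_modes (hη : IsWhiteNoise P η) :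
    IsGaussianProcess (fun k ω => modes η ω k) P := by
  classical
  refine hη.gaussian.of_isGaussianProcess fun k => ?_
  by_cases hk : k = 0
  · exact ⟨∅, 0, fun ω => by subst hk; simp [modes_zero]⟩
  · let I : Finset L20 := {aVec k hk, bVec k hk}
    have ha : aVec k hk ∈ I := by simp [I]
    have hb : bVec k hk ∈ I := by simp [I]
    let L : (I → ℝ) →L[ℝ] ℂ :=
      (ContinuousLinearMap.proj (R := ℝ) (φ := fun _ : I => ℝ) ⟨_, ha⟩).smulRight (1 : ℂ) -
      (ContinuousLinearMap.proj (R := ℝ) (φ := fun _ : I => ℝ) ⟨_, hb⟩).smulRight Complex.I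
    refine ⟨I, L, fun ω => ?_⟩
    rw [modes_of_ne hk]
    simp [L, mul_comm]

theorem integral_modes (hη : IsWhiteNoise P η) (k : Mode) : ∫ ω, modes η ω k ∂P = 0 := by
  by_cases hk : k = 0
  · subst hk
    simp [modes_zero]
  simp only [modes_of_ne hk]
  have i1 := (hη.gaussian.hasGaussianLaw_eval (aVec k hk)).integrable
  have i2 := (hη.gaussian.hasGaussianLaw_eval (bVec k hk)).integrable
  rw [integral_sub i1.ofReal (i2.ofReal.const_mul _), integral_const_mul, integral_complex_ofReal,
    integral_complex_ofReal, hη.centred, hη.centred]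
  simp

theorem integral_modes_mul (hη : IsWhiteNoise P η) (k l : Mode) :
    ∫ ω, modes η ω k * modes η ω l ∂P = if k ≠ 0 ∧ k + l = 0 then 1 else 0 := by
  by_cases hk : k = 0
  · subst hk
    simp [modes_zero]
  by_cases hl : l = 0
  · subst hl
    simp [modes_zero, hk]
  have m := fun h => (hη.gaussian.hasGaussianLaw_eval h).memLp_two
  have e1 : ∀ ω, modes η ω k * modes η ω l =
      ((η (aVec k hk) ω * η (aVec l hl) ω - η (bVec k hk) ω * η (bVec l hl) ω : ℝ) : ℂ) -
      Complex.I * ((η (aVec k hk) ω * η (bVec l hl) ω + η (bVec k hk) ω * η (aVec l hl) ω : ℝ) : ℂ)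
      := fun ω => by
    rw [modes_of_ne hk, modes_of_ne hl]
    push_cast
    linear_combination (η (bVec k hk) ω : ℂ) * (η (bVec l hl) ω : ℂ) * Complex.I_mul_I
  simp only [e1]
  have j : ∀ h g, Integrable (fun ω => η h ω * η g ω) P := fun h g =>
    (m h).integrable_mul (m g)
  rw [integral_sub, integral_const_mul, integral_complex_ofReal, integral_complex_ofReal,
    integral_sub (j _ _) (j _ _), integral_add (j _ _) (j _ _)]
  · simp only [hη.covariance]
    rw [inner_vec]
    simp [hk]
  · exact ((j _ _).sub (j _ _)).ofReal
  · exact (((j _ _).add (j _ _)).ofReal).const_mul _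

theorem aemeasurable_modes (hη : IsWhiteNoise P η) : AEMeasurable (modes η) P :=
  aemeasurable_pi_iff.2 fun k => (isGaussianProcess_modes hη).aemeasurable k

theorem measurable_toBox (M : ℕ) : Measurable (toBox M) :=
  measurable_pi_iff.2 fun k => hart.continuous.measurable.comp (measurable_pi_apply (k : Mode))

theorem map_toBox_modes (hη : IsWhiteNoise P η) (M : ℕ) :
    (P.map (modes η)).map (toBox M) = stdGauss (boxModes M) := by
  rw [AEMeasurable.map_map_of_aemeasurable (measurable_toBox M).aemeasurable
    (aemeasurable_modes hη)]
  have := map_hart_eq_pi (isGaussianProcess_modes hη) (integral_modes hη) (modes_neg hη) 1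
    (fun k l => by rw [integral_modes_mul hη]; simp) (fun _ => 1) M
  simp only [NNReal.coe_one, one_mul, one_pow] at this
  exact this

theorem ae_real_modes (hη : IsWhiteNoise P η) :
    ∀ᵐ v ∂(P.map (modes η)), (∀ k, v (-k) = conj (v k)) ∧ v 0 = 0 := by
  have hm : MeasurableSet {v : Mode → ℂ | (∀ k, v (-k) = conj (v k)) ∧ v 0 = 0} := by
    refine MeasurableSet.inter ?_ ?_
    · have h : {v : Mode → ℂ | ∀ k, v (-k) = conj (v k)} = ⋂ k, {v | v (-k) = conj (v k)} := by
        ext v; simp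
      show MeasurableSet {v : Mode → ℂ | ∀ k, v (-k) = conj (v k)}
      rw [h]
      exact MeasurableSet.iInter fun k => measurableSet_eq_fun (measurable_pi_apply _)
        (Complex.continuous_conj.measurable.comp (measurable_pi_apply k))
    · exact measurableSet_eq_fun (measurable_pi_apply _) measurable_const
  refine (ae_map_iff (aemeasurable_modes hη) hm).2 ?_
  filter_upwards [ae_all_iff.2 (modes_neg hη)] with ω hω
  exact ⟨hω, modes_zero ω⟩

end WhiteNoise

theorem measurable_of_forall_apply {Ω ι E : Type*} {m : MeasurableSpace Ω} [MeasurableSpace E]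
    {f : Ω → ι → E} (h : ∀ i, Measurable[m] fun ω => f ω i) : Measurable[m] f :=
  measurable_pi_iff.2 h

/-! ### The drift in Hartley coordinates -/

section Drift

theorem drift_neg (N : ℕ) (ν lam : ℝ) {v : Mode → ℂ} (hv : ∀ k, v (-k) = conj (v k)) (k : Mode) :
    drift N ν lam v (-k) = conj (drift N ν lam v k) := by
  simp only [drift, map_add, map_mul, map_neg, Complex.conj_ofReal, eucl_neg, hv,
    nonlin_neg N hv]

theorem hart_ofReal_mul (r : ℝ) (z : ℂ) : hart ((r : ℂ) * z) = r * hart z := by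
  rw [← Complex.real_smul, map_smul, smul_eq_mul]

/-- The coordinates of z and of its conjugate are Re z + Im z and Re z - Im z. For real fields, the
real equations for k and -k thus give back the complex equation for k. -/
theorem eq_of_hart_eq {z w : ℂ} (h : hart z = hart w) (h' : hart (conj z) = hart (conj w)) :
    z = w := by
  simp only [hart_apply, Complex.conj_re, Complex.conj_im] at h h'
  exact Complex.ext (by linarith) (by linarith)

/-- The variance rate `ν |k|²` of the noise in the `k`-th mode. -/
def rate (ν : ℝ) (k : Mode) : ℝ≥0 := (ν * eucl k ^ 2).toNNReal

theorem coe_rate {ν : ℝ} (hν : 0 < ν) (k : Mode) : (rate ν k : ℝ) = ν * eucl k ^ 2 :=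
  Real.coe_toNNReal _ (by positivity)

theorem hart_drift_of_notMem {N : ℕ} {ν : ℝ} (hν : 0 < ν) (lam : ℝ) (v : Mode → ℂ) {k : Mode}
    (hk : k ∉ boxModes N) : hart (drift N ν lam v k) = -((rate ν k : ℝ) / 2) * hart (v k) := by
  rw [drift, nonlin_eq_zero N v hk, mul_zero, add_zero, ← Complex.ofReal_neg, hart_ofReal_mul,
    coe_rate hν]
  ring

/-- The nonlinearity reads only modes of the box N, so the equation on every larger box is closed.
-/
theorem hart_drift {N M : ℕ} (hNM : N ≤ M) {ν : ℝ} (hν : 0 < ν) (lam : ℝ) {v : Mode → ℂ}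
    (hv : ∀ k, v (-k) = conj (v k)) (k : boxModes M) :
    hart (drift N ν lam v k) =
      splitDrift (fun k : boxModes M => rate ν k) (field N M lam) (toBox M v) k := by
  have h : nonlin N v k = nonlin N (fromBox (toBox M v)) k :=
    nonlin_congr N (fun j hj => (fromBox_toBox hv (boxModes_mono hNM hj)).symm) k
  rw [drift, h, map_add, ← Complex.ofReal_neg, hart_ofReal_mul, hart_ofReal_mul]
  simp only [splitDrift, field, toBox, coe_rate hν]
  ring

theorem continuous_drift (N : ℕ) (ν lam : ℝ) {v : ℝ → Mode → ℂ}
    (hv : ∀ k, Continuous fun s => v s k) (k : Mode) :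
    Continuous fun s => drift N ν lam (v s) k := by
  simp only [drift, nonlin_eq_sum]
  fun_prop

theorem hart_integral_drift (N : ℕ) (ν lam : ℝ) {v : ℝ → Mode → ℂ}
    (hv : ∀ k, Continuous fun s => v s k) (k : Mode) (t : ℝ) :
    hart (∫ s in (0 : ℝ)..t, drift N ν lam (v s) k) =
      ∫ s in (0 : ℝ)..t, hart (drift N ν lam (v s) k) :=
  (hart.intervalIntegral_comp_comm
    ((continuous_drift N ν lam hv k).intervalIntegrable _ _)).symm

theorem intervalIntegral_apply {ι : Type*} [Fintype ι] {f : ℝ → ι → ℝ} (hf : Continuous f) (t : ℝ)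
    (i : ι) : (∫ s in (0 : ℝ)..t, f s) i = ∫ s in (0 : ℝ)..t, f s i :=
  ((ContinuousLinearMap.proj (R := ℝ) (φ := fun _ : ι => ℝ) i).intervalIntegral_comp_comm
    (hf.intervalIntegrable _ _)).symm

end Drift

/-! ### The driving noise in Hartley coordinates -/

section Noise

variable {Ω : Type*} [mΩ : MeasurableSpace Ω] {P : Measure Ω} {ℱ : Filtration ℝ≥0 mΩ}
  {B : ℝ≥0 → Ω → Mode → ℂ}

/-- The driving noise in Hartley coordinates. -/
def boxNoise (ν : ℝ) (M : ℕ) (B : ℝ≥0 → Ω → Mode → ℂ) (t : ℝ≥0) (ω : Ω) (k : boxModes M) : ℝ :=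
  Real.sqrt ν * eucl k * hart (B t ω k)

theorem isBrownian_boxNoise (hB : IsNoise P ℱ B) {ν : ℝ} (hν : 0 < ν) (M : ℕ) :
    IsBrownian P ℱ (fun k : boxModes M => rate ν k) (boxNoise ν M B) where
  adapted t := measurable_of_forall_apply fun k =>
    (measurable_const_mul (Real.sqrt ν * eucl k)).comp
      (hart.continuous.measurable.comp ((measurable_pi_apply (k : Mode)).comp (hB.adapted t)))
  law s t hst := by
    have hσ : ∀ k, ((Real.sqrt ν * eucl k).toNNReal : ℝ) = Real.sqrt ν * eucl k := fun k =>
      Real.coe_toNNReal _ (mul_nonneg (Real.sqrt_nonneg _) (Real.sqrt_nonneg _))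
    have h := map_hart_eq_pi (Z := fun k ω => B t ω k - B s ω k) (hB.gaussian s t hst)
      (fun k => hB.centred s t k hst)
      (fun k => ae_of_all _ fun ω => by rw [hB.conj_symm, hB.conj_symm, map_sub]) (t - s)
      (fun k l => by rw [hB.covariance s t k l hst]; simp [NNReal.coe_sub hst])
      (fun k => (Real.sqrt ν * eucl k).toNNReal) M
    have h1 : (fun ω => boxNoise ν M B t ω - boxNoise ν M B s ω) = fun ω (k : boxModes M) =>
        ((Real.sqrt ν * eucl k).toNNReal : ℝ) * hart (B t ω k - B s ω k) := by
      funext ω k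
      rw [Pi.sub_apply, hσ, boxNoise, boxNoise, map_sub, mul_sub]
    have h2 : ∀ k : Mode, (Real.sqrt ν * eucl k).toNNReal ^ 2 = rate ν k := fun k => by
      apply NNReal.eq
      rw [NNReal.coe_pow, hσ, coe_rate hν, mul_pow, Real.sq_sqrt hν.le]
    rw [h1, h]
    simp only [h2]
  indep s t hst := by
    refine indep_of_indep_of_le_left (hB.indep s t hst) ?_
    have h1 : (fun ω => boxNoise ν M B t ω - boxNoise ν M B s ω) =
        (fun (z : Mode → ℂ) (k : boxModes M) => Real.sqrt ν * eucl k * hart (z k)) ∘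
          fun ω k => B t ω k - B s ω k := by
      funext ω k
      simp only [boxNoise, Pi.sub_apply, Function.comp_apply, map_sub, mul_sub]
    have h2 : Measurable fun (z : Mode → ℂ) (k : boxModes M) =>
        Real.sqrt ν * eucl k * hart (z k) := measurable_of_forall_apply fun k =>
      (hart.continuous.measurable.comp (measurable_pi_apply (k : Mode))).const_mul _
    rw [h1, ← MeasurableSpace.comap_comp]
    exact MeasurableSpace.comap_mono h2.comap_le

end Noise

/-! ### Laws of real fields from their box marginals -/

section Law

variable {Ω : Type*} [mΩ : MeasurableSpace Ω] {P : Measure Ω} [IsProbabilityMeasure P]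

/-- The law of a random real field is determined by its Hartley coordinates in large boxes. -/
theorem map_eq_map_of_map_toBox_eq {X Y : Ω → Mode → ℂ} (hX : Measurable X) (hY : Measurable Y)
    (hXr : ∀ᵐ ω ∂P, (∀ k, X ω (-k) = conj (X ω k)) ∧ X ω 0 = 0)
    (hYr : ∀ᵐ ω ∂P, (∀ k, Y ω (-k) = conj (Y ω k)) ∧ Y ω 0 = 0) (N : ℕ)
    (h : ∀ M, N ≤ M → P.map (fun ω => toBox M (X ω)) = P.map (fun ω => toBox M (Y ω))) :
    P.map X = P.map Y := by
  have key : ∀ Z : Ω → Mode → ℂ, Measurable Z →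
      (∀ᵐ ω ∂P, (∀ k, Z ω (-k) = conj (Z ω k)) ∧ Z ω 0 = 0) → ∀ (I : Finset Mode) (M : ℕ),
      (∀ k ∈ I, k ≠ 0 → k ∈ boxModes M) → (P.map Z).map I.restrict =
        (P.map fun ω => toBox M (Z ω)).map fun g => I.restrict (fromBox g) := by
    intro Z hZ hr I M hM
    have hm : Measurable fun g : boxModes M → ℝ => I.restrict (fromBox g) :=
      measurable_of_forall_apply fun k => (fromBoxL M k).continuous.measurable
    have hmZ : Measurable fun ω => toBox M (Z ω) := (measurable_toBox M).comp hZ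
    rw [Measure.map_map (by fun_prop) hZ, Measure.map_map hm hmZ]
    refine Measure.map_congr ?_
    filter_upwards [hr] with ω hω
    funext k
    simp only [Function.comp_apply, Finset.restrict]
    by_cases hk : (k : Mode) = 0
    · rw [hk, hω.2, fromBox_zero]
    · rw [fromBox_toBox hω.1 (hM k k.2 hk)]
  -- A measure on the product space is determined by its finite-dimensional marginals, and each of
  -- these is a function of the coordinates in one large box.
  refine IsProjectiveLimit.unique (P := fun J => (P.map Y).map J.restrict) (fun I => ?_)
    fun I => rfl
  obtain ⟨M, hM⟩ := exists_boxModes I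
  have hM' : ∀ k ∈ I, k ≠ 0 → k ∈ boxModes (max N M) := fun k hk hk0 =>
    boxModes_mono (le_max_right _ _) (hM k hk hk0)
  show (P.map X).map I.restrict = (P.map Y).map I.restrict
  rw [key X hX hXr I _ hM', key Y hY hYr I _ hM', h _ (le_max_left _ _)]

end Law

/-! ### Solutions of the Fourier system and invariance of white noise -/

section Invariance

variable {Ω : Type*} [mΩ : MeasurableSpace Ω] {P : Measure Ω}
  {ℱ : Filtration ℝ≥0 mΩ} {B u : ℝ≥0 → Ω → Mode → ℂ} {N : ℕ} {ν lam : ℝ}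

theorem IsSolution.solvesOn_toBox (hu : IsSolution P ℱ B N ν lam u) (hν : 0 < ν) {M : ℕ}
    (hNM : N ≤ M) (T : ℝ) :
    ∀ᵐ ω ∂P, SolvesOn (splitDrift (fun k : boxModes M => rate ν k) (field N M lam))
      (fun s => boxNoise ν M B s.toNNReal ω) (fun s => toBox M (u s.toNNReal ω)) T := by
  filter_upwards [hu.continuous, hu.real, hu.equation] with ω hc hr he
  have hc' : ∀ k, Continuous fun s : ℝ => u s.toNNReal ω k := fun k =>
    (hc k).comp continuous_real_toNNReal
  have hb : Continuous fun s : ℝ => toBox M (u s.toNNReal ω) :=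
    continuous_pi fun k => hart.continuous.comp (hc' k)
  refine ⟨hb.continuousOn, fun t ht => ?_⟩
  funext k
  have hd : Continuous fun s : ℝ => splitDrift (fun k : boxModes M => rate ν k) (field N M lam)
      (toBox M (u s.toNNReal ω)) :=
    (contDiff_splitDrift _ (contDiff_field lam)).continuous.comp hb
  have h1 := congrArg hart (he k (mem_boxModes.1 k.2).1 t.toNNReal)
  rw [map_add, map_add, Real.coe_toNNReal t ht.1, hart_integral_drift N ν lam hc',
    hart_ofReal_mul] at h1
  simp only [hart_drift hNM hν lam (hr _)] at h1
  rw [Pi.add_apply, Pi.add_apply, intervalIntegral_apply hd]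
  show _ = hart (u (Real.toNNReal 0) ω k) + _ + _
  rw [Real.toNNReal_zero]
  exact h1

theorem IsSolution.map_eq [IsProbabilityMeasure P] (hu : IsSolution P ℱ B N ν lam u)
    (hB : IsNoise P ℱ B) (hν : 0 < ν)
    (h0 : ∀ M, P.map (fun ω => toBox M (u 0 ω)) = stdGauss (boxModes M)) (t : ℝ≥0) :
    P.map (u t) = P.map (u 0) := by
  rcases eq_or_lt_of_le (zero_le (a := t)) with rfl | ht
  · rfl
  have hr : ∀ t, ∀ᵐ ω ∂P, (∀ k, u t ω (-k) = conj (u t ω k)) ∧ u t ω 0 = 0 := fun t => by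
    filter_upwards [hu.real, hu.zero_mode] with ω h1 h2
    exact ⟨h1 t, h2 t⟩
  have hm : ∀ t, Measurable (u t) := fun t => (hu.adapted t).mono (ℱ.le t) le_rfl
  refine map_eq_map_of_map_toBox_eq (hm t) (hm 0) (hr t) (hr 0) N fun M hNM => ?_
  rw [h0 M]
  exact map_eq_stdGauss (isBrownian_boxNoise hB hν M) (contDiff_field lam)
    (divergence_field lam) (sum_mul_field lam hNM) (u := fun t ω => toBox M (u t ω))
    (fun t => (measurable_toBox M).comp (hu.adapted t)) (h0 M) ht (hu.solvesOn_toBox hν hNM t)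

/-- Solutions in Hartley coordinates. -/
theorem exists_hartley_solution (hB : IsNoise P ℱ B) (hν : 0 < ν) {u₀ : Ω → Mode → ℂ}
    (hu₀ : Measurable[ℱ 0] u₀) : ∃ g : ℝ≥0 → Ω → Mode → ℝ,
      (∀ t, Measurable[ℱ t] (g t)) ∧ (∀ ω k, Continuous fun t => g t ω k) ∧
      (∀ t ω, g t ω 0 = 0) ∧ (∀ ω k, k ≠ 0 → g 0 ω k = hart (u₀ ω k)) ∧
      ∀ ω k, k ≠ 0 → ∀ t : ℝ≥0, g t ω k = g 0 ω k +
        (∫ s in (0 : ℝ)..t, hart (drift N ν lam (ofHartley (g s.toNNReal ω)) k)) +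
        Real.sqrt ν * eucl k * hart (B t ω k) := by
  have hmB : ∀ t k, Measurable[ℱ t] fun ω => Real.sqrt ν * eucl k * hart (B t ω k) := fun t k =>
    (measurable_const_mul (Real.sqrt ν * eucl k)).comp
      (hart.continuous.measurable.comp ((measurable_pi_apply k).comp (hB.adapted t)))
  have hcB : ∀ ω k, Continuous fun t => Real.sqrt ν * eucl k * hart (B t ω k) := fun ω k =>
    continuous_const.mul (hart.continuous.comp (hB.continuous ω k))
  have hB0 : ∀ ω k, Real.sqrt ν * eucl k * hart (B 0 ω k) = 0 := fun ω k => by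
    rw [hB.zero, Pi.zero_apply, map_zero, mul_zero]
  have hm0 : ∀ k, Measurable[ℱ 0] fun ω => hart (u₀ ω k) := fun k =>
    hart.continuous.measurable.comp ((measurable_pi_apply k).comp hu₀)
  -- The modes in the box N form the only coupled part of the system.
  obtain ⟨y, hym, hyc, hy0, hy⟩ := exists_adapted_solution
    (b := splitDrift (fun k : boxModes N => rate ν k) (field N N lam))
    (contDiff_splitDrift _ (contDiff_field lam))
    (coercive_splitDrift _ (sum_mul_field lam le_rfl) (norm_field_le lam)) ℱ
    (x := fun ω => toBox N (u₀ ω)) ((measurable_toBox N).comp hu₀)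
    (W := boxNoise ν N B) (isBrownian_boxNoise hB hν N).adapted
    (fun ω => funext fun k => hB0 ω k) (fun ω => continuous_pi fun k => hcB ω k)
  -- Each mode outside the box solves its own scalar Ornstein-Uhlenbeck equation, the case of zero
  -- vector field on a one-point index set.
  have hou : ∀ k : Mode, ∃ z : ℝ≥0 → Ω → Unit → ℝ, (∀ t, Measurable[ℱ t] (z t)) ∧
      (∀ ω, Continuous fun t => z t ω) ∧ z 0 = (fun ω _ => hart (u₀ ω k)) ∧
      ∀ ω (t : ℝ≥0), z t ω = (fun _ => hart (u₀ ω k)) +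
        (∫ s in (0 : ℝ)..t, splitDrift (fun _ => rate ν k) 0 (z s.toNNReal ω)) +
        fun _ => Real.sqrt ν * eucl k * hart (B t ω k) := fun k =>
    exists_adapted_solution (contDiff_splitDrift _ contDiff_const)
      (coercive_splitDrift _ (X := 0) (fun x => by simp) ⟨0, fun x => by simp⟩) ℱ
      (measurable_of_forall_apply fun _ => hm0 k)
      (W := fun t ω _ => Real.sqrt ν * eucl k * hart (B t ω k))
      (fun t => measurable_of_forall_apply fun _ => hmB t k)
      (fun ω => funext fun _ => hB0 ω k) (fun ω => continuous_pi fun _ => hcB ω k)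
  choose z hzm hzc hz0 hz using hou
  let g : ℝ≥0 → Ω → Mode → ℝ := fun t ω k =>
    if h : k ∈ boxModes N then y t ω ⟨k, h⟩ else if k = 0 then 0 else z k t ω ()
  have hg1 : ∀ t ω (k : boxModes N), g t ω k = y t ω k := fun t ω k => by simp [g]
  have hg2 : ∀ t ω k, k ∉ boxModes N → k ≠ 0 → g t ω k = z k t ω () := fun t ω k h h' => by
    simp [g, h, h']
  have hg0 : ∀ t ω, g t ω 0 = 0 := fun t ω => by simp [g, mem_boxModes]
  have hbox : ∀ t ω, toBox N (ofHartley (g t ω)) = y t ω := fun t ω => by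
    funext k
    rw [toBox, hart_ofHartley, hg1]
  have hyk : ∀ ω k, Continuous fun t => y t ω k := fun ω k => (continuous_apply k).comp (hyc ω)
  have hzk : ∀ ω k, Continuous fun t => z k t ω () := fun ω k =>
    (continuous_apply ()).comp (hzc k ω)
  refine ⟨g, fun t => measurable_of_forall_apply fun k => ?_, fun ω k => ?_, hg0, fun ω k hk => ?_,
    fun ω k hk t => ?_⟩
  · by_cases h : k ∈ boxModes N
    · simp only [g, h, dif_pos]
      exact (measurable_pi_apply _).comp (hym t)
    · by_cases h' : k = 0
      · subst h'
        simp only [hg0]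
        exact @measurable_const _ _ _ (ℱ t) _
      · simp only [hg2 _ _ _ h h']
        exact (measurable_pi_apply _).comp (hzm k t)
  · by_cases h : k ∈ boxModes N
    · simp only [g, h, dif_pos]
      exact hyk ω _
    · by_cases h' : k = 0
      · subst h'
        simp only [hg0]
        exact continuous_const
      · simp only [hg2 _ _ _ h h']
        exact hzk ω k
  · by_cases h : k ∈ boxModes N
    · rw [hg1 0 ω ⟨k, h⟩, hy0]
      rfl
    · rw [hg2 _ _ _ h hk, hz0]
  · by_cases h : k ∈ boxModes N
    · have h1 := congrFun (hy ω t) ⟨k, h⟩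
      have hd : Continuous fun s : ℝ => splitDrift (fun k : boxModes N => rate ν k)
          (field N N lam) (y s.toNNReal ω) :=
        (contDiff_splitDrift _ (contDiff_field lam)).continuous.comp
          ((hyc ω).comp continuous_real_toNNReal)
      rw [Pi.add_apply, Pi.add_apply, intervalIntegral_apply hd] at h1
      have h2 : ∀ s : ℝ, hart (drift N ν lam (ofHartley (g s.toNNReal ω)) k) =
          splitDrift (fun k : boxModes N => rate ν k) (field N N lam) (y s.toNNReal ω) ⟨k, h⟩ :=
        fun s => by
          rw [← hbox]
          exact hart_drift le_rfl hν lam (ofHartley_neg _) ⟨k, h⟩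
      simp only [h2]
      rw [hg1 t ω ⟨k, h⟩, hg1 0 ω ⟨k, h⟩, hy0, h1]
      rfl
    · have h1 := congrFun (hz k ω t) ()
      have hd : Continuous fun s : ℝ => splitDrift (fun _ : Unit => rate ν k) 0
          (z k s.toNNReal ω) :=
        (contDiff_splitDrift _ contDiff_const).continuous.comp
          ((hzc k ω).comp continuous_real_toNNReal)
      rw [Pi.add_apply, Pi.add_apply, intervalIntegral_apply hd] at h1
      have h2 : ∀ s : ℝ, hart (drift N ν lam (ofHartley (g s.toNNReal ω)) k) =
          splitDrift (fun _ : Unit => rate ν k) 0 (z k s.toNNReal ω) () := fun s => by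
        rw [hart_drift_of_notMem hν lam _ h, hart_ofHartley, hg2 _ _ _ h hk]
        simp [splitDrift]
      simp only [h2]
      rw [hg2 _ _ _ h hk, hg2 _ _ _ h hk, hz0, h1]

theorem exists_isSolution (hB : IsNoise P ℱ B) (hν : 0 < ν) {u₀ : Ω → Mode → ℂ}
    (hu₀ : Measurable[ℱ 0] u₀) (hr : ∀ᵐ ω ∂P, (∀ k, u₀ ω (-k) = conj (u₀ ω k)) ∧ u₀ ω 0 = 0) :
    ∃ u, IsSolution P ℱ B N ν lam u ∧ ∀ᵐ ω ∂P, u 0 ω = u₀ ω := by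
  obtain ⟨g, hgm, hgc, hg0, hgi, hge⟩ :=
    exists_hartley_solution (N := N) (lam := lam) hB hν hu₀
  have huc : ∀ ω k, Continuous fun t => ofHartley (g t ω) k := fun ω k => by
    have h1 := hgc ω k
    have h2 := hgc ω (-k)
    unfold ofHartley
    fun_prop
  refine ⟨fun t ω => ofHartley (g t ω), ⟨fun t => measurable_of_forall_apply fun k => ?_,
    ae_of_all _ huc, ae_of_all _ fun ω t k => ofHartley_neg _ k,
    ae_of_all _ fun ω t => ?_, ae_of_all _ fun ω k hk t => ?_⟩, ?_⟩
  · have h : Measurable fun g : Mode → ℝ => ofHartley g k := by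
      unfold ofHartley
      fun_prop
    exact h.comp (hgm t)
  · simp [ofHartley, hg0]
  · have hc' : ∀ k, Continuous fun s : ℝ => ofHartley (g s.toNNReal ω) k := fun k =>
      (huc ω k).comp continuous_real_toNNReal
    -- This is the Hartley part of the complex equation; it is used for k and, through conjugation
    -- symmetry, for -k.
    have key : ∀ k, k ≠ 0 → hart (ofHartley (g t ω) k) = hart (ofHartley (g 0 ω) k +
        (∫ s in (0 : ℝ)..t, drift N ν lam (ofHartley (g s.toNNReal ω)) k) +
        ((Real.sqrt ν * eucl k : ℝ) : ℂ) * B t ω k) := fun k hk => by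
      rw [map_add, map_add, hart_ofHartley, hart_ofHartley, hart_integral_drift N ν lam hc',
        hart_ofReal_mul]
      exact hge ω k hk t
    refine eq_of_hart_eq (key k hk) ?_
    have h := key (-k) (neg_ne_zero.2 hk)
    simp only [drift_neg N ν lam (ofHartley_neg _)] at h
    rw [ofHartley_neg, ofHartley_neg, hB.conj_symm, eucl_neg] at h
    have hi : ∫ s in (0 : ℝ)..t, conj (drift N ν lam (ofHartley (g s.toNNReal ω)) k) =
        conj (∫ s in (0 : ℝ)..t, drift N ν lam (ofHartley (g s.toNNReal ω)) k) :=
      Complex.conjCLE.toContinuousLinearMap.intervalIntegral_comp_comm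
        ((continuous_drift N ν lam hc' k).intervalIntegrable _ _)
    rw [h, hi, map_add conj, map_add conj, map_mul conj, Complex.conj_ofReal]
  · filter_upwards [hr] with ω hω
    have h : g 0 ω = fun k => hart (u₀ ω k) := funext fun k => by
      by_cases hk : k = 0
      · rw [hk, hg0, hω.2, map_zero]
      · exact hgi ω k hk
    rw [h, ofHartley_hart hω.1]

end Invariance

theorem isInvariant_map_modes {Ω : Type*} [MeasurableSpace Ω] {P : Measure Ω}
    [IsProbabilityMeasure P] {η : L20 → Ω → ℝ} (hη : IsWhiteNoise P η) (N : ℕ) {ν : ℝ} (hν : 0 < ν)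
    (lam : ℝ) : IsInvariant.{w} N ν lam (P.map (modes η)) := by
  intro Ω' mΩ' P' _ ℱ B hB
  refine ⟨fun u₀ hm hlaw => exists_isSolution hB hν hm ?_, fun u hu hlaw t => ?_⟩
  · exact ae_of_ae_map (hm.mono (ℱ.le 0) le_rfl).aemeasurable (hlaw ▸ ae_real_modes hη)
  · have hm : Measurable (u 0) := (hu.adapted 0).mono (ℱ.le 0) le_rfl
    rw [← hlaw]
    refine hu.map_eq hB hν (fun M => ?_) t
    rw [← map_toBox_modes hη, ← hlaw, Measure.map_map (measurable_toBox M) hm]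
    rfl

/-! ### Symmetric and antisymmetric operators on Gaussian space -/

section GaussianGenerators

variable {ι : Type*} [Fintype ι] [DecidableEq ι]

/-- The Ornstein-Uhlenbeck generator on a finite-dimensional Gaussian space. -/
def ouGen (c : ι → ℝ) (f : (ι → ℝ) → ℝ) (x : ι → ℝ) : ℝ :=
  ∑ i, c i * (pderiv i (pderiv i f) x - x i * pderiv i f x)

/-- Differentiation along a vector field. -/
def transport (X : (ι → ℝ) → ι → ℝ) (f : (ι → ℝ) → ℝ) (x : ι → ℝ) : ℝ :=
  ∑ i, X x i * pderiv i f x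

theorem temperate_ouGen (c : ι → ℝ) {f : (ι → ℝ) → ℝ} (hf : f.HasTemperateGrowth) :
    (ouGen c f).HasTemperateGrowth :=
  Function.HasTemperateGrowth.sum fun i _ => (Function.HasTemperateGrowth.const (c i)).mul
    ((temperate_pderiv (temperate_pderiv hf i) i).sub
      ((temperate_coord i).mul (temperate_pderiv hf i)))

theorem temperate_transport {X : (ι → ℝ) → ι → ℝ} (hX : ∀ i, (fun x => X x i).HasTemperateGrowth)
    {f : (ι → ℝ) → ℝ} (hf : f.HasTemperateGrowth) : (transport X f).HasTemperateGrowth :=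
  Function.HasTemperateGrowth.sum fun i _ => (hX i).mul (temperate_pderiv hf i)

/-- Gaussian integration by parts applied to (∂_i f) g gives the Dirichlet form, from which symmetry
is evident. -/
theorem integral_ouGen_mul (c : ι → ℝ) {f g : (ι → ℝ) → ℝ} (hf : f.HasTemperateGrowth)
    (hg : g.HasTemperateGrowth) : ∫ x, ouGen c f x * g x ∂(stdGauss ι) =
      -∑ i, c i * ∫ x, pderiv i f x * pderiv i g x ∂(stdGauss ι) := by
  have key : ∀ i, ∫ x, (pderiv i (pderiv i f) x - x i * pderiv i f x) * g x ∂(stdGauss ι) =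
      -∫ x, pderiv i f x * pderiv i g x ∂(stdGauss ι) := fun i => by
    have hf1 := temperate_pderiv hf i
    have i1 : Integrable (fun x => pderiv i f x * pderiv i g x) (stdGauss ι) :=
      integrable_stdGauss_of_temperate (hf1.mul (temperate_pderiv hg i))
    have i2 : Integrable (fun x => pderiv i (pderiv i f) x * g x) (stdGauss ι) :=
      integrable_stdGauss_of_temperate ((temperate_pderiv hf1 i).mul hg)
    have i3 : Integrable (fun x : ι → ℝ => x i * (pderiv i f x * g x)) (stdGauss ι) :=
      integrable_stdGauss_of_temperate ((temperate_coord i).mul (hf1.mul hg))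
    have h := integral_pderiv (hf1.mul hg) i
    have h1 : ∀ x, pderiv i (pderiv i f * g) x =
        pderiv i f x * pderiv i g x + pderiv i (pderiv i f) x * g x := pderiv_mul hf1 hg i
    simp only [h1, Pi.mul_apply] at h
    rw [integral_add i1 i2] at h
    have h2 : ∀ x, (pderiv i (pderiv i f) x - x i * pderiv i f x) * g x =
        pderiv i (pderiv i f) x * g x - x i * (pderiv i f x * g x) := fun x => by ring
    simp only [h2]
    rw [integral_sub i2 i3]
    linarith
  have hi : ∀ i ∈ Finset.univ, Integrable
      (fun x => c i * ((pderiv i (pderiv i f) x - x i * pderiv i f x) * g x)) (stdGauss ι) :=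
    fun i _ => (integrable_stdGauss_of_temperate (((temperate_pderiv (temperate_pderiv hf i) i).sub
      ((temperate_coord i).mul (temperate_pderiv hf i))).mul hg)).const_mul _
  simp only [ouGen, Finset.sum_mul, mul_assoc]
  rw [integral_finsetSum _ hi, ← Finset.sum_neg_distrib]
  exact Finset.sum_congr rfl fun i _ => by rw [integral_const_mul, key, mul_neg]

theorem integral_ouGen_mul_comm (c : ι → ℝ) {f g : (ι → ℝ) → ℝ} (hf : f.HasTemperateGrowth)
    (hg : g.HasTemperateGrowth) : ∫ x, ouGen c f x * g x ∂(stdGauss ι) =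
      ∫ x, f x * ouGen c g x ∂(stdGauss ι) := by
  simp only [mul_comm (f _)]
  rw [integral_ouGen_mul c hf hg, integral_ouGen_mul c hg hf]
  simp only [mul_comm (pderiv _ f _)]

/-- A divergence free vector field tangent to spheres is antisymmetric in Gaussian space. -/
theorem integral_transport_mul_comm {X : (ι → ℝ) → ι → ℝ}
    (hX : ∀ i, (fun x => X x i).HasTemperateGrowth) (hdiv : ∀ x, divergence X x = 0)
    (hen : ∀ x, ∑ i, x i * X x i = 0) {f g : (ι → ℝ) → ℝ} (hf : f.HasTemperateGrowth)
    (hg : g.HasTemperateGrowth) : ∫ x, transport X f x * g x ∂(stdGauss ι) =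
      -∫ x, f x * transport X g x ∂(stdGauss ι) := by
  have hfg : (fun x => f x * g x).HasTemperateGrowth := hf.mul hg
  have hXfg : ∀ i, (fun x => X x i * (f x * g x)).HasTemperateGrowth := fun i => (hX i).mul hfg
  -- By the product rule X · ∇(fg) equals the divergence of fgX, as div X = 0. The subtracted sum is
  -- zero by orthogonality; it is the term that Gaussian integration by parts sets against the
  -- divergence.
  have e1 : ∀ x, transport X f x * g x + f x * transport X g x =
      (∑ i, pderiv i (fun y => X y i * (f y * g y)) x) - ∑ i, x i * (X x i * (f x * g x)) := by
    intro x
    have h1 : ∀ i, pderiv i (fun y => X y i * (f y * g y)) x =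
        X x i * (f x * pderiv i g x + pderiv i f x * g x) +
          pderiv i (fun y => X y i) x * (f x * g x) := fun i => by
      rw [pderiv_mul (hX i) hfg, pderiv_mul hf hg]
    have h2 : ∑ i, x i * (X x i * (f x * g x)) = 0 := by
      simp only [← mul_assoc (_ : ℝ) (_ : ℝ) (f x * g x)]
      rw [← Finset.sum_mul, hen, zero_mul]
    have h3 := hdiv x
    rw [divergence] at h3
    simp only [h1]
    rw [h2, Finset.sum_add_distrib, ← Finset.sum_mul (a := f x * g x), h3, zero_mul, sub_zero,
      add_zero, transport, transport, Finset.sum_mul, Finset.mul_sum, ← Finset.sum_add_distrib]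
    exact Finset.sum_congr rfl fun i _ => by ring
  have j1 : ∀ i ∈ Finset.univ, Integrable (fun x => pderiv i (fun y => X y i * (f y * g y)) x)
      (stdGauss ι) := fun i _ => integrable_stdGauss_of_temperate (temperate_pderiv (hXfg i) i)
  have j2 : ∀ i ∈ Finset.univ, Integrable (fun x : ι → ℝ => x i * (X x i * (f x * g x)))
      (stdGauss ι) := fun i _ =>
    integrable_stdGauss_of_temperate ((temperate_coord i).mul (hXfg i))
  have i1 : Integrable (fun x => transport X f x * g x) (stdGauss ι) :=
    integrable_stdGauss_of_temperate ((temperate_transport hX hf).mul hg)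
  have i2 : Integrable (fun x => f x * transport X g x) (stdGauss ι) :=
    integrable_stdGauss_of_temperate (hf.mul (temperate_transport hX hg))
  rw [eq_neg_iff_add_eq_zero, ← integral_add i1 i2]
  simp only [e1]
  rw [integral_sub (integrable_finsetSum _ j1) (integrable_finsetSum _ j2),
    integral_finsetSum _ j1, integral_finsetSum _ j2, sub_eq_zero]
  exact Finset.sum_congr rfl fun i _ => integral_pderiv (hXfg i) i

theorem pderiv_comm {f : (ι → ℝ) → ℝ} (hf : f.HasTemperateGrowth) (i j : ι) (x : ι → ℝ) :
    pderiv i (pderiv j f) x = pderiv j (pderiv i f) x := by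
  have hd : DifferentiableAt ℝ (fderiv ℝ f) x :=
    ((hf.1.fderiv_right (m := 1) (by norm_cast)).differentiable one_ne_zero) x
  have h : ∀ i j, pderiv i (pderiv j f) x =
      fderiv ℝ (fderiv ℝ f) x (Pi.single i 1) (Pi.single j 1) := fun i j => by
    show fderiv ℝ (fun y => fderiv ℝ f y (Pi.single j 1)) x (Pi.single i 1) = _
    rw [fderiv_clm_apply hd (differentiableAt_const _)]
    simp
  rw [h, h]
  exact ((contDiff_infty.1 hf.1 2).contDiffAt.isSymmSndFDerivAt (by simp)).eq _ _

end GaussianGenerators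

/-! ### Fourier derivatives in Hartley coordinates -/

section Derivatives

theorem lineDeriv_congr_of_dependsOn {H : (Mode → ℂ) → ℂ} {T : Set Mode} (hH : DependsOn H T)
    {v w : Mode → ℂ} (h : ∀ k ∈ T, v k = w k) (δ : Mode → ℂ) :
    lineDeriv ℝ H v δ = lineDeriv ℝ H w δ := by
  have : (fun t : ℝ => H (v + t • δ)) = fun t : ℝ => H (w + t • δ) := funext fun t =>
    hH fun k hk => by simp [h k hk]
  rw [lineDeriv, lineDeriv, this]

theorem dependsOn_D {H : (Mode → ℂ) → ℂ} {T : Set Mode} (hH : DependsOn H T) (k : Mode) :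
    DependsOn (D k H) T := fun v w h => by
  rw [D, D, lineDeriv_congr_of_dependsOn hH h, lineDeriv_congr_of_dependsOn hH h]

theorem D_eq_zero_of_dependsOn {H : (Mode → ℂ) → ℂ} {T : Set Mode} (hH : DependsOn H T) {k : Mode}
    (h : k ∉ T) (h' : -k ∉ T) : D k H = 0 := by
  funext v
  have key : ∀ δ : Mode → ℂ, (∀ j ∈ T, δ j = 0) → lineDeriv ℝ H v δ = 0 := fun δ hδ => by
    have : (fun t : ℝ => H (v + t • δ)) = fun t : ℝ => H v := funext fun t =>
      hH fun k hk => by simp [hδ k hk]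
    rw [lineDeriv, this, deriv_const]
  have hne : ∀ j ∈ T, j ≠ k ∧ j ≠ -k := fun j hj =>
    ⟨fun e => h (e ▸ hj), fun e => h' (e ▸ hj)⟩
  rw [D, key _ fun j hj => by simp [aDir, hne j hj],
    key _ fun j hj => by simp [bDir, hne j hj]]
  simp

theorem D_zero (k : Mode) : D k 0 = 0 := by
  funext v
  have h : ∀ δ : Mode → ℂ, lineDeriv ℝ (0 : (Mode → ℂ) → ℂ) v δ = 0 := fun δ => by
    rw [lineDeriv]
    exact deriv_const _ _
  rw [D, h, h]
  simp

variable {M : ℕ}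

/-- The opposite mode in a box. -/
def boxNeg (k : boxModes M) : boxModes M := ⟨-k, neg_mem_boxModes.2 k.2⟩

theorem aDir_eq_fromBox (k : boxModes M) :
    aDir k = fromBox ((2⁻¹ : ℝ) • (Pi.single k 1 + Pi.single (boxNeg k) 1 : boxModes M → ℝ)) := by
  funext j
  have hk0 : (k : Mode) ≠ 0 := (mem_boxModes.1 k.2).1
  have hkn : (k : Mode) ≠ -k := fun h => hk0 (self_eq_neg.1 h)
  rw [fromBox_smul, fromBox_add, Pi.smul_apply, Pi.add_apply, fromBox_single, fromBox_single]
  simp only [boxNeg, neg_neg, aDir, Complex.real_smul]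
  by_cases h1 : j = k
  · subst h1
    simp only [if_true, if_neg hkn]
    push_cast; ring
  · by_cases h2 : j = -k
    · simp only [h2, if_true, if_neg hkn.symm]
      push_cast; ring
    · simp [h1, h2]

/-- The component of b_k at k is 1 / (2i) = -i / 2, with Hartley coordinate -1 / 2; at -k the sign
is opposite. -/
theorem bDir_eq_fromBox (k : boxModes M) :
    bDir k = fromBox ((2⁻¹ : ℝ) • (Pi.single (boxNeg k) 1 - Pi.single k 1 : boxModes M → ℝ)) := by
  funext j
  have hk0 : (k : Mode) ≠ 0 := (mem_boxModes.1 k.2).1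
  have hkn : (k : Mode) ≠ -k := fun h => hk0 (self_eq_neg.1 h)
  rw [sub_eq_add_neg, ← neg_one_smul ℝ (Pi.single k 1 : boxModes M → ℝ), fromBox_smul, fromBox_add,
    fromBox_smul, Pi.smul_apply, Pi.add_apply, Pi.smul_apply, fromBox_single, fromBox_single]
  simp only [boxNeg, neg_neg, bDir, Complex.real_smul]
  have hI : (2 * Complex.I)⁻¹ = -Complex.I / 2 := by
    rw [mul_inv, Complex.inv_I]; ring
  rw [div_eq_mul_inv, hI]
  by_cases h1 : j = k
  · subst h1
    simp only [if_true, if_neg hkn]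
    push_cast; ring
  · by_cases h2 : j = -k
    · simp only [h2, if_true, if_neg hkn.symm]
      push_cast; ring
    · simp [h1, h2]

/-- The passage from coordinates to fields is linear, so line derivatives on the infinite product
become Fréchet derivatives in finite dimensions. -/
theorem lineDeriv_fromBox {H : (Mode → ℂ) → ℂ} {g : boxModes M → ℝ}
    (hd : DifferentiableAt ℝ (fun g : boxModes M → ℝ => H (fromBox g)) g) (δ : boxModes M → ℝ) :
    lineDeriv ℝ H (fromBox g) (fromBox δ) =
      fderiv ℝ (fun g : boxModes M → ℝ => H (fromBox g)) g δ := by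
  rw [← hd.lineDeriv_eq_fderiv, lineDeriv, lineDeriv]
  simp only [fromBox_add, fromBox_smul]

theorem D_fromBox {H : (Mode → ℂ) → ℂ} {g : boxModes M → ℝ}
    (hd : DifferentiableAt ℝ (fun g : boxModes M → ℝ => H (fromBox g)) g) (k : boxModes M) :
    D k H (fromBox g) =
      ((1 + Complex.I) * fderiv ℝ (fun g : boxModes M → ℝ => H (fromBox g)) g (Pi.single k 1) +
      (1 - Complex.I) *
        fderiv ℝ (fun g : boxModes M → ℝ => H (fromBox g)) g (Pi.single (boxNeg k) 1)) / 2 := by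
  rw [D, aDir_eq_fromBox, bDir_eq_fromBox, lineDeriv_fromBox hd, lineDeriv_fromBox hd, map_smul,
    map_smul, map_add, map_sub, Complex.real_smul, Complex.real_smul]
  push_cast
  ring

/-- The gradient in Hartley coordinates. -/
def boxGrad (f : (boxModes M → ℝ) → ℝ) (g : boxModes M → ℝ) : boxModes M → ℝ :=
  fun k => pderiv k f g

theorem fderiv_ofReal_comp {E : Type*} [NormedAddCommGroup E] [NormedSpace ℝ E] {f : E → ℝ} {x : E}
    (hf : DifferentiableAt ℝ f x) (δ : E) :
    fderiv ℝ (fun y => (f y : ℂ)) x δ = (fderiv ℝ f x δ : ℝ) := by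
  have h := (Complex.ofRealCLM.hasFDerivAt (x := f x)).comp x hf.hasFDerivAt
  have h' : HasFDerivAt (fun y => (f y : ℂ)) (Complex.ofRealCLM.comp (fderiv ℝ f x)) x := h
  rw [h'.fderiv]
  rfl

variable {F : (Mode → ℂ) → ℝ}

/-- The complex gradient of a real function is the real field whose Hartley coordinates are the
ordinary gradient, so the pairing identity applies to it as to v. -/
theorem D_real_fromBox (hF : (fun g : boxModes M → ℝ => F (fromBox g)).HasTemperateGrowth)
    (k : boxModes M) (g : boxModes M → ℝ) : D k (fun w => (F w : ℂ)) (fromBox g) =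
      fromBox (boxGrad (fun g : boxModes M → ℝ => F (fromBox g)) g) k := by
  have hd := (hF.1.differentiable (by simp)) g
  rw [D_fromBox (Complex.ofRealCLM.differentiableAt.comp g hd), fderiv_ofReal_comp hd,
    fderiv_ofReal_comp hd, fromBox, ofHartley, extend_coe,
    extend_of_mem _ (neg_mem_boxModes.2 k.2)]
  rfl

/-- The mixed second derivatives carry the factor (1 + i)² + (1 - i)² = 0, and the pure ones (1 +
i)(1 - i) = 2. -/
theorem D_neg_D_real_fromBox
    (hF : (fun g : boxModes M → ℝ => F (fromBox g)).HasTemperateGrowth)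
    (k : boxModes M) (g : boxModes M → ℝ) : D (-k) (D k (fun w => (F w : ℂ))) (fromBox g) =
      ((pderiv k (pderiv k fun g : boxModes M → ℝ => F (fromBox g)) g +
        pderiv (boxNeg k) (pderiv (boxNeg k) fun g : boxModes M → ℝ => F (fromBox g)) g) / 2 : ℝ)
      := by
  set f := fun g : boxModes M → ℝ => F (fromBox g) with hf
  have hd : ∀ j, HasFDerivAt (fun g => (pderiv j f g : ℂ))
      (Complex.ofRealCLM.comp (fderiv ℝ (pderiv j f) g)) g := fun j =>
    (Complex.ofRealCLM.hasFDerivAt (x := pderiv j f g)).comp g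
      ((temperate_pderiv hF j).1.differentiable (by simp) g).hasFDerivAt
  have h1 : (fun g : boxModes M → ℝ => D k (fun w => (F w : ℂ)) (fromBox g)) = fun g =>
      (1 + Complex.I) / 2 * (pderiv k f g : ℂ) +
        (1 - Complex.I) / 2 * (pderiv (boxNeg k) f g : ℂ) := funext fun g => by
    rw [D_real_fromBox hF, fromBox, ofHartley, extend_coe,
      extend_of_mem _ (neg_mem_boxModes.2 k.2)]
    show ((1 + Complex.I) * (pderiv k f g : ℂ) +
        (1 - Complex.I) * (pderiv (boxNeg k) f g : ℂ)) / 2 = _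
    ring
  have h2 := ((hd k).const_mul ((1 + Complex.I) / 2)).add
    ((hd (boxNeg k)).const_mul ((1 - Complex.I) / 2))
  have h3 : HasFDerivAt (fun g : boxModes M → ℝ => D k (fun w => (F w : ℂ)) (fromBox g))
      (((1 + Complex.I) / 2) • Complex.ofRealCLM.comp (fderiv ℝ (pderiv k f) g) +
        ((1 - Complex.I) / 2) • Complex.ofRealCLM.comp (fderiv ℝ (pderiv (boxNeg k) f) g)) g := by
    rw [h1]; exact h2
  have h4 := D_fromBox h3.differentiableAt (boxNeg k)
  have h5 : boxNeg (boxNeg k) = k := Subtype.ext (neg_neg _)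
  have h6 : ∀ i j, fderiv ℝ (pderiv j f) g (Pi.single i 1) = pderiv i (pderiv j f) g :=
    fun i j => rfl
  rw [h3.fderiv, h5] at h4
  simp only [add_apply, smul_apply,
    ContinuousLinearMap.comp_apply, Complex.ofRealCLM_apply, h6, smul_eq_mul] at h4
  rw [pderiv_comm hF (boxNeg k) k] at h4
  refine h4.trans ?_
  push_cast
  linear_combination ((pderiv k (pderiv (boxNeg k) f) g : ℂ) / 2 -
    (pderiv (boxNeg k) (pderiv (boxNeg k) f) g : ℂ) / 4 -
    (pderiv k (pderiv k f) g : ℂ) / 4) * Complex.I_mul_I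

end Derivatives

/-! ### Cylinder functions and their generators on a box -/

section Cylinder

/-- The modes of a box, together with the zero mode. -/
def fullBox (M : ℕ) : Set Mode := {k | k = 0 ∨ k ∈ boxModes M}

theorem neg_mem_fullBox {M : ℕ} {k : Mode} : -k ∈ fullBox M ↔ k ∈ fullBox M := by
  simp [fullBox, neg_mem_boxModes]

/-- `F` is a smooth tempered function of the modes in a box, and of the zero mode. -/
structure IsBoxFun (M : ℕ) (F : (Mode → ℂ) → ℝ) : Prop where
  dependsOn : DependsOn F (fullBox M)
  temperate : (fun g : boxModes M → ℝ => F (fromBox g)).HasTemperateGrowth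

/-- All sufficiently large boxes are admitted, so that two functions and the nonlinearity can share
one. A dependence on the zero mode is harmless, since that mode vanishes for white noise. -/
theorem IsCylinder.exists_isBoxFun {F : (Mode → ℂ) → ℝ} (hF : IsCylinder F) :
    ∃ M₀, ∀ M, M₀ ≤ M → IsBoxFun M F := by
  obtain ⟨S, f, hf, hFf⟩ := hF
  obtain ⟨M₀, hM₀⟩ := exists_boxModes S
  refine ⟨M₀, fun M hM => ⟨fun v w h => ?_, ?_⟩⟩
  · rw [hFf, hFf]
    congr 1
    funext k
    refine h k ?_
    by_cases hk : (k : Mode) = 0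
    · exact Or.inl hk
    · exact Or.inr (boxModes_mono hM (hM₀ k k.2 hk))
  · simp only [hFf]
    exact hf.comp (ContinuousLinearMap.hasTemperateGrowth
      (ContinuousLinearMap.pi fun k : S => fromBoxL M (k : Mode)))

variable {M : ℕ} {F : (Mode → ℂ) → ℝ}

theorem IsBoxFun.dependsOn_ofReal (hF : IsBoxFun M F) :
    DependsOn (fun w => (F w : ℂ)) (fullBox M) := fun _ _ h =>
  congrArg Complex.ofReal (hF.dependsOn h)

theorem IsBoxFun.D_eq_zero (hF : IsBoxFun M F) {k : Mode} (hk : k ∉ fullBox M) :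
    D k (fun w => (F w : ℂ)) = 0 :=
  D_eq_zero_of_dependsOn hF.dependsOn_ofReal hk fun h => hk (neg_mem_fullBox.1 h)

/-! ### The splitting of the generator -/

theorem IsBoxFun.genS_eq_sum (hF : IsBoxFun M F) (ν : ℝ) (v : Mode → ℂ) :
    genS ν F v = ((ν / 2 : ℝ) : ℂ) * ∑ k ∈ boxModes M, ((eucl k ^ 2 : ℝ) : ℂ) *
      (-v (-k) * D k (fun w => (F w : ℂ)) v + D (-k) (D k (fun w => (F w : ℂ))) v) := by
  rw [genS, tsum_eq_sum fun k hk => ?_]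
  by_cases h0 : k = 0
  · simp [h0, eucl_zero]
  · rw [hF.D_eq_zero (k := k) (by simp [fullBox, h0, hk]), D_zero]
    simp

theorem IsBoxFun.genA_eq_sum (hF : IsBoxFun M F) (N : ℕ) (lam : ℝ) (v : Mode → ℂ) :
    genA N lam F v =
      (lam : ℂ) * ∑ k ∈ boxModes M, nonlin N v k * D (-k) (fun w => (F w : ℂ)) v := by
  have h := tsum_nonlin_mul N v fun k => D (-k) (fun w => (F w : ℂ)) v
  simp only [neg_add'] at h
  rw [genA, ← h, tsum_eq_sum fun k hk => ?_]
  by_cases h0 : k = 0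
  · rw [h0, nonlin_eq_zero N v fun h => (mem_boxModes.1 h).1 rfl, zero_mul]
  · rw [hF.D_eq_zero (k := -k) (by rw [neg_mem_fullBox]; simp [fullBox, h0, hk])]
    simp

theorem IsBoxFun.gen_eq (hF : IsBoxFun M F) (N : ℕ) (ν lam : ℝ) (v : Mode → ℂ) :
    gen N ν lam F v = genS ν F v + genA N lam F v := by
  set G : (Mode → ℂ) → ℂ := fun w => (F w : ℂ) with hG
  have h1 : (∑' k : Mode, if k = 0 then 0 else drift N ν lam v k * D (-k) G v) =
      ∑ k ∈ boxModes M, drift N ν lam v k * D (-k) G v := by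
    rw [tsum_eq_sum fun k hk => ?_]
    · exact Finset.sum_congr rfl fun k hk => if_neg (mem_boxModes.1 hk).1
    · by_cases h0 : k = 0
      · rw [if_pos h0]
      · rw [if_neg h0, hF.D_eq_zero (k := -k) (by rw [neg_mem_fullBox]; simp [fullBox, h0, hk])]
        simp
  -- The covariation lives on the antidiagonal, so the double sum reduces to pairs (k, -k).
  have h2 : (∑' p : Mode × Mode,
      (if p.1 ≠ 0 ∧ p.1 + p.2 = 0 then ((ν * eucl p.1 * eucl p.2 : ℝ) : ℂ) else 0) *
        D (-p.1) (D (-p.2) G) v) =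
      ∑ k ∈ boxModes M, ((ν * eucl k ^ 2 : ℝ) : ℂ) * D (-k) (D k G) v := by
    have hinj : Function.Injective fun k : Mode => (k, -k) := fun k l h => congrArg Prod.fst h
    rw [← hinj.tsum_eq, tsum_eq_sum (s := boxModes M) fun k hk => ?_]
    · refine Finset.sum_congr rfl fun k hk => ?_
      rw [if_pos ⟨(mem_boxModes.1 hk).1, add_neg_cancel k⟩, neg_neg, eucl_neg, mul_assoc, ← sq]
    · by_cases h0 : k = 0
      · simp [h0]
      · simp only [neg_neg]
        rw [hF.D_eq_zero (k := k) (by simp [fullBox, h0, hk]), D_zero]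
        simp
    · rintro ⟨k, l⟩ hp
      refine ⟨k, Prod.ext rfl ?_⟩
      by_contra hl
      refine hp ?_
      show (if k ≠ 0 ∧ k + l = 0 then ((ν * eucl k * eucl l : ℝ) : ℂ) else 0) * _ = 0
      rw [if_neg fun h => hl (neg_eq_of_add_eq_zero_right h.2), zero_mul]
  have h3 : ∑ k ∈ boxModes M, ((eucl k ^ 2 : ℝ) : ℂ) * (v k * D (-k) G v) =
      ∑ k ∈ boxModes M, ((eucl k ^ 2 : ℝ) : ℂ) * (v (-k) * D k G v) := by
    refine Finset.sum_nbij' (fun k => -k) (fun k => -k) (fun k hk => neg_mem_boxModes.2 hk)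
      (fun k hk => neg_mem_boxModes.2 hk) (fun k _ => neg_neg k) (fun k _ => neg_neg k)
      fun k _ => ?_
    rw [neg_neg, eucl_neg]
  rw [gen, h1, h2, hF.genS_eq_sum, hF.genA_eq_sum]
  have h4 : ∑ k ∈ boxModes M, drift N ν lam v k * D (-k) G v =
      -((ν / 2 : ℝ) : ℂ) * ∑ k ∈ boxModes M, ((eucl k ^ 2 : ℝ) : ℂ) * (v k * D (-k) G v) +
        (lam : ℂ) * ∑ k ∈ boxModes M, nonlin N v k * D (-k) G v := by
    rw [Finset.mul_sum, Finset.mul_sum, ← Finset.sum_add_distrib]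
    refine Finset.sum_congr rfl fun k _ => ?_
    rw [drift]
    push_cast
    ring
  have h5 : (1 / 2 : ℂ) * ∑ k ∈ boxModes M, ((ν * eucl k ^ 2 : ℝ) : ℂ) * D (-k) (D k G) v =
      ((ν / 2 : ℝ) : ℂ) * ∑ k ∈ boxModes M, ((eucl k ^ 2 : ℝ) : ℂ) * D (-k) (D k G) v := by
    rw [Finset.mul_sum, Finset.mul_sum]
    refine Finset.sum_congr rfl fun k _ => ?_
    push_cast
    ring
  rw [h4, h3, h5]
  simp only [mul_add, Finset.sum_add_distrib, neg_mul, mul_neg, Finset.sum_neg_distrib]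
  ring

/-! ### The generators in Hartley coordinates -/

theorem IsBoxFun.dependsOn_genS (hF : IsBoxFun M F) (ν : ℝ) :
    DependsOn (genS ν F) (fullBox M) := fun v w h => by
  rw [hF.genS_eq_sum, hF.genS_eq_sum]
  congr 1
  refine Finset.sum_congr rfl fun k hk => ?_
  rw [h (-k) (Or.inr (neg_mem_boxModes.2 hk)), dependsOn_D hF.dependsOn_ofReal k h,
    dependsOn_D (dependsOn_D hF.dependsOn_ofReal k) (-k) h]

theorem IsBoxFun.dependsOn_genA (hF : IsBoxFun M F) {N : ℕ} (hNM : N ≤ M) (lam : ℝ) :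
    DependsOn (genA N lam F) (fullBox M) := fun v w h => by
  rw [hF.genA_eq_sum, hF.genA_eq_sum]
  congr 1
  refine Finset.sum_congr rfl fun k hk => ?_
  rw [nonlin_congr N (fun j hj => h j (Or.inr (boxModes_mono hNM hj))) k,
    dependsOn_D hF.dependsOn_ofReal (-k) h]

theorem IsBoxFun.genS_fromBox (hF : IsBoxFun M F) (ν : ℝ) (g : boxModes M → ℝ) :
    genS ν F (fromBox g) = (ouGen (fun k : boxModes M => ν / 2 * eucl k ^ 2)
      (fun g : boxModes M → ℝ => F (fromBox g)) g : ℝ) := by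
  set f := fun g : boxModes M → ℝ => F (fromBox g) with hf
  have h1 : ∑ k ∈ boxModes M, ((eucl k ^ 2 : ℝ) : ℂ) *
      (fromBox g (-k) * D k (fun w => (F w : ℂ)) (fromBox g)) =
      ((∑ k : boxModes M, eucl k ^ 2 * (g k * pderiv k f g) : ℝ) : ℂ) := by
    have h := sum_ofHartley_pairing (S := boxModes M) (fun k => neg_mem_boxModes)
      (wt := fun k => eucl k ^ 2) (fun k => by rw [eucl_neg]) (extend g) (extend (boxGrad f g))
    rw [sum_boxModes_extend (fun k a b => eucl k ^ 2 * (a * b))] at h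
    refine Eq.trans (Finset.sum_congr rfl fun k hk => ?_) h
    rw [D_real_fromBox hF.temperate ⟨k, hk⟩]
    rfl
  have h2 : ∑ k ∈ boxModes M, ((eucl k ^ 2 : ℝ) : ℂ) *
      D (-k) (D k (fun w => (F w : ℂ))) (fromBox g) =
      ((∑ k : boxModes M, eucl k ^ 2 * pderiv k (pderiv k f) g : ℝ) : ℂ) := by
    -- The mixed complex derivative is an average over k and -k; reflection invariance of the
    -- weighted sum makes both halves equal.
    have h3 : ∑ k : boxModes M, eucl (boxNeg k) ^ 2 * pderiv (boxNeg k) (pderiv (boxNeg k) f) g =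
        ∑ k : boxModes M, eucl k ^ 2 * pderiv k (pderiv k f) g :=
      Function.Bijective.sum_comp (e := boxNeg) (Function.Involutive.bijective fun k =>
        Subtype.ext (neg_neg _)) fun k : boxModes M => eucl k ^ 2 * pderiv k (pderiv k f) g
    rw [← Finset.sum_coe_sort]
    simp only [D_neg_D_real_fromBox hF.temperate]
    rw [← Complex.ofReal_inj.2 (add_self_div_two
      (∑ k : boxModes M, eucl k ^ 2 * pderiv k (pderiv k f) g))]
    nth_rw 2 [← h3]
    rw [← Finset.sum_add_distrib, Finset.sum_div]
    push_cast
    refine Finset.sum_congr rfl fun k _ => ?_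
    rw [show eucl (boxNeg k) = eucl k from eucl_neg _]
    ring
  rw [hF.genS_eq_sum]
  simp only [mul_add, neg_mul, mul_neg, Finset.sum_add_distrib, Finset.sum_neg_distrib]
  rw [h1, h2, ouGen]
  simp only [mul_assoc (ν / 2), ← Finset.mul_sum, mul_sub, Finset.sum_sub_distrib]
  push_cast
  ring

/-- The pairing identity for the gradient of F and the nonlinearity, both being real fields. -/
theorem IsBoxFun.genA_fromBox (hF : IsBoxFun M F) {N : ℕ} (hNM : N ≤ M) (lam : ℝ)
    (g : boxModes M → ℝ) : genA N lam F (fromBox g) =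
      (transport (field N M lam) (fun g : boxModes M → ℝ => F (fromBox g)) g : ℝ) := by
  set f := fun g : boxModes M → ℝ => F (fromBox g) with hf
  have h := sum_ofHartley_pairing (S := boxModes M) (fun k => neg_mem_boxModes)
    (wt := fun _ => 1) (fun k => rfl) (extend (boxGrad f g)) (extend (field N M lam g))
  rw [sum_boxModes_extend (fun k a b => 1 * (a * b))] at h
  rw [hF.genA_eq_sum, Finset.mul_sum, transport]
  simp only [one_mul, Complex.ofReal_one] at h
  simp only [mul_comm (field N M lam g _)]
  refine Eq.trans (Finset.sum_congr rfl fun k hk => ?_) h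
  have h1 := D_real_fromBox hF.temperate (boxNeg ⟨k, hk⟩) g
  rw [show D (-k) (fun w => (F w : ℂ)) (fromBox g) = _ from h1, ← mul_assoc,
    ← fromBox_field lam hNM, mul_comm]
  rfl

end Cylinder

/-! ### The generator in the Gaussian Hilbert space -/

section L2

variable {Ω : Type*} [MeasurableSpace Ω] {P : Measure Ω} {η : L20 → Ω → ℝ} {M : ℕ}

/-- Under white noise almost every v is a real field without zero mode, so the box coordinates
determine everything the function sees. Integrals and norms then reduce to the standard Gaussian
measure. -/
theorem ae_eq_comp_toBox (hη : IsWhiteNoise P η) {E : Type*} {H : (Mode → ℂ) → E}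
    (hH : DependsOn H (fullBox M)) :
    H =ᵐ[P.map (modes η)] (fun g => H (fromBox g)) ∘ toBox M := by
  filter_upwards [ae_real_modes hη] with v hv
  refine hH fun k hk => ?_
  rcases hk with rfl | hk
  · rw [hv.2, fromBox_zero]
  · rw [fromBox_toBox hv.1 hk]

theorem measurePreserving_toBox (hη : IsWhiteNoise P η) (M : ℕ) :
    MeasurePreserving (toBox M) (P.map (modes η)) (stdGauss (boxModes M)) :=
  ⟨measurable_toBox M, map_toBox_modes hη M⟩

theorem memLp_two_of_dependsOn (hη : IsWhiteNoise P η) {E : Type*} [NormedAddCommGroup E]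
    {H : (Mode → ℂ) → E} (hH : DependsOn H (fullBox M))
    (hm : MemLp (fun g : boxModes M → ℝ => H (fromBox g)) 2 (stdGauss (boxModes M))) :
    MemLp H 2 (P.map (modes η)) :=
  (memLp_congr_ae (ae_eq_comp_toBox hη hH)).2
    (hm.comp_measurePreserving (measurePreserving_toBox hη M))

theorem integral_of_dependsOn (hη : IsWhiteNoise P η) {H : (Mode → ℂ) → ℂ}
    (hH : DependsOn H (fullBox M)) {h : (boxModes M → ℝ) → ℝ} (hh : h.HasTemperateGrowth)
    (hHh : ∀ g, H (fromBox g) = h g) :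
    ∫ v, H v ∂(P.map (modes η)) = (∫ g, h g ∂(stdGauss (boxModes M)) : ℝ) := by
  have hm : AEStronglyMeasurable (fun g => (h g : ℂ)) ((P.map (modes η)).map (toBox M)) :=
    (Complex.continuous_ofReal.comp hh.1.continuous).aestronglyMeasurable
  rw [integral_congr_ae (ae_eq_comp_toBox hη hH), ← integral_complex_ofReal, ← map_toBox_modes hη,
    integral_map (measurable_toBox M).aemeasurable hm]
  simp only [Function.comp_apply, hHh]

/-- An operator on cylinder functions which in each large box acts as an operator on tempered
functions. -/
def IsBoxOperator (T : ((Mode → ℂ) → ℝ) → (Mode → ℂ) → ℂ)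
    (τ : ∀ M, ((boxModes M → ℝ) → ℝ) → (boxModes M → ℝ) → ℝ) (N : ℕ) : Prop :=
  ∀ M, N ≤ M → ∀ F, IsBoxFun M F → DependsOn (T F) (fullBox M) ∧
    (τ M fun g => F (fromBox g)).HasTemperateGrowth ∧
    ∀ g, T F (fromBox g) = τ M (fun g => F (fromBox g)) g

variable {T : ((Mode → ℂ) → ℝ) → (Mode → ℂ) → ℂ}
  {τ : ∀ M, ((boxModes M → ℝ) → ℝ) → (boxModes M → ℝ) → ℝ} {N : ℕ}

theorem IsBoxOperator.mapsToL2 (hT : IsBoxOperator T τ N) (hη : IsWhiteNoise P η) :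
    MapsToL2 (P.map (modes η)) T := by
  intro F hF
  obtain ⟨M₀, hM₀⟩ := hF.exists_isBoxFun
  obtain ⟨h1, h2, h3⟩ := hT (max N M₀) (le_max_left _ _) F (hM₀ _ (le_max_right _ _))
  refine ⟨memLp_two_of_dependsOn hη h1 ?_, ?_⟩
  · simp only [h3]
    exact (memLp_two_stdGauss_of_temperate h2).ofReal
  · filter_upwards [ae_eq_comp_toBox hη h1] with v hv
    rw [hv, Function.comp_apply, h3, Complex.ofReal_im]

theorem IsBoxOperator.integral_mul (hT : IsBoxOperator T τ N) (hη : IsWhiteNoise P η)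
    {F G : (Mode → ℂ) → ℝ} (hNM : N ≤ M) (hF : IsBoxFun M F) (hG : IsBoxFun M G) :
    ∫ v, T F v * (G v : ℂ) ∂(P.map (modes η)) =
      (∫ g, τ M (fun g => F (fromBox g)) g * G (fromBox g) ∂(stdGauss (boxModes M)) : ℝ) := by
  obtain ⟨h1, h2, h3⟩ := hT M hNM F hF
  refine integral_of_dependsOn hη (fun v w h => ?_) (h2.mul hG.temperate) fun g => ?_
  · rw [h1 h, hG.dependsOn h]
  · rw [h3, ← Complex.ofReal_mul]

theorem isBoxOperator_genS (ν : ℝ) (N : ℕ) : IsBoxOperator (genS ν)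
    (fun M => ouGen fun k : boxModes M => ν / 2 * eucl k ^ 2) N := fun _ _ _ hF =>
  ⟨hF.dependsOn_genS ν, temperate_ouGen _ hF.temperate, hF.genS_fromBox ν⟩

theorem isBoxOperator_genA (N : ℕ) (lam : ℝ) : IsBoxOperator (genA N lam)
    (fun M => transport (field N M lam)) N := fun _ hNM _ hF =>
  ⟨hF.dependsOn_genA hNM lam, temperate_transport (temperate_field lam) hF.temperate,
    hF.genA_fromBox hNM lam⟩

theorem isBoxOperator_gen (N : ℕ) (ν lam : ℝ) : IsBoxOperator (gen N ν lam)
    (fun M f g => ouGen (fun k : boxModes M => ν / 2 * eucl k ^ 2) f g +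
      transport (field N M lam) f g) N := fun M hNM F hF => by
  obtain ⟨h1, h2, h3⟩ := isBoxOperator_genS ν N M hNM F hF
  obtain ⟨h4, h5, h6⟩ := isBoxOperator_genA N lam M hNM F hF
  refine ⟨fun v w h => ?_, h2.add h5, fun g => ?_⟩
  · rw [hF.gen_eq, hF.gen_eq, h1 h, h4 h]
  · rw [hF.gen_eq, h3, h6, Complex.ofReal_add]

theorem IsCylinder.memLp_two (hη : IsWhiteNoise P η) {F : (Mode → ℂ) → ℝ} (hF : IsCylinder F) :
    MemLp F 2 (P.map (modes η)) := by
  obtain ⟨M, hM⟩ := hF.exists_isBoxFun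
  have h := hM M le_rfl
  exact memLp_two_of_dependsOn hη h.dependsOn (memLp_two_stdGauss_of_temperate h.temperate)

/-- Both parts are computed on one common box. Exchanging F and G preserves the symmetric
contribution s and reverses the antisymmetric contribution a, and half the sum and half the
difference isolate them. -/
theorem integral_gen_mul (hη : IsWhiteNoise P η) (N : ℕ) (ν lam : ℝ) {F G : (Mode → ℂ) → ℝ}
    (hF : IsCylinder F) (hG : IsCylinder G) : ∃ s a : ℂ,
      ∫ v, genS ν F v * (G v : ℂ) ∂(P.map (modes η)) = s ∧
      ∫ v, genA N lam F v * (G v : ℂ) ∂(P.map (modes η)) = a ∧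
      ∫ v, gen N ν lam F v * (G v : ℂ) ∂(P.map (modes η)) = s + a ∧
      ∫ v, (F v : ℂ) * gen N ν lam G v ∂(P.map (modes η)) = s - a := by
  obtain ⟨M₁, hM₁⟩ := hF.exists_isBoxFun
  obtain ⟨M₂, hM₂⟩ := hG.exists_isBoxFun
  set M := max N (max M₁ M₂) with hM
  have hNM : N ≤ M := le_max_left _ _
  have hF' : IsBoxFun M F := hM₁ M ((le_max_left _ _).trans (le_max_right _ _))
  have hG' : IsBoxFun M G := hM₂ M ((le_max_right _ _).trans (le_max_right _ _))
  have key : ∀ {F G : (Mode → ℂ) → ℝ}, IsBoxFun M F → IsBoxFun M G →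
      ∫ v, gen N ν lam F v * (G v : ℂ) ∂(P.map (modes η)) =
      ∫ v, genS ν F v * (G v : ℂ) ∂(P.map (modes η)) +
      ∫ v, genA N lam F v * (G v : ℂ) ∂(P.map (modes η)) := fun hF hG => by
    rw [(isBoxOperator_gen N ν lam).integral_mul hη hNM hF hG,
      (isBoxOperator_genS ν N).integral_mul hη hNM hF hG,
      (isBoxOperator_genA N lam).integral_mul hη hNM hF hG, ← Complex.ofReal_add]
    simp only [add_mul]
    exact congrArg Complex.ofReal (integral_add (integrable_stdGauss_of_temperate
      ((temperate_ouGen _ hF.temperate).mul hG.temperate)) (integrable_stdGauss_of_temperate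
      ((temperate_transport (temperate_field lam) hF.temperate).mul hG.temperate)))
  refine ⟨_, _, rfl, rfl, key hF' hG', ?_⟩
  simp only [mul_comm ((F _ : ℝ) : ℂ)]
  rw [key hG' hF', sub_eq_add_neg, (isBoxOperator_genS ν N).integral_mul hη hNM hF' hG',
    (isBoxOperator_genA N lam).integral_mul hη hNM hF' hG',
    (isBoxOperator_genS ν N).integral_mul hη hNM hG' hF',
    (isBoxOperator_genA N lam).integral_mul hη hNM hG' hF',
    integral_ouGen_mul_comm _ hF'.temperate hG'.temperate,
    integral_transport_mul_comm (temperate_field lam) (divergence_field lam)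
      (sum_mul_field lam hNM) hF'.temperate hG'.temperate]
  simp only [Complex.ofReal_neg, neg_neg, mul_comm]

theorem isSymmetricPart_genS (hη : IsWhiteNoise P η) (N : ℕ) (ν lam : ℝ) :
    IsSymmetricPart (P.map (modes η)) (gen N ν lam) (genS ν) := fun F G hF hG => by
  obtain ⟨s, a, h1, -, h3, h4⟩ := integral_gen_mul hη N ν lam hF hG
  rw [h1, h3, h4]
  ring

theorem isAntisymmetricPart_genA (hη : IsWhiteNoise P η) (N : ℕ) (ν lam : ℝ) :
    IsAntisymmetricPart (P.map (modes η)) (gen N ν lam) (genA N lam) := fun F G hF hG => by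
  obtain ⟨s, a, -, h2, h3, h4⟩ := integral_gen_mul hη N ν lam hF hG
  rw [h2, h3, h4]
  ring

end L2

end AKPZ

end

theorem mainTheorem9 {Ω : Type u} [MeasurableSpace Ω] (P : MeasureTheory.Measure Ω)
    [MeasureTheory.IsProbabilityMeasure P] (η : AKPZ.L20 → Ω → ℝ) (hη : AKPZ.IsWhiteNoise P η)
    (N : ℕ) (ν lam : ℝ) (hν : 0 < ν) (hlam : 0 < lam) :
    -- invariance of white noise
    AKPZ.IsInvariant.{w} N ν lam (P.map (AKPZ.modes η)) ∧
    -- symmetric and antisymmetric part of the generator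
    (∀ F, AKPZ.IsCylinder F → ∀ v,
      AKPZ.gen N ν lam F v = AKPZ.genS ν F v + AKPZ.genA N lam F v) ∧
    (∀ F, AKPZ.IsCylinder F → MeasureTheory.MemLp F 2 (P.map (AKPZ.modes η))) ∧
    AKPZ.MapsToL2 (P.map (AKPZ.modes η)) (AKPZ.gen N ν lam) ∧
    AKPZ.MapsToL2 (P.map (AKPZ.modes η)) (AKPZ.genS ν) ∧
    AKPZ.MapsToL2 (P.map (AKPZ.modes η)) (AKPZ.genA N lam) ∧
    AKPZ.IsSymmetricPart (P.map (AKPZ.modes η)) (AKPZ.gen N ν lam) (AKPZ.genS ν) ∧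
    AKPZ.IsAntisymmetricPart (P.map (AKPZ.modes η)) (AKPZ.gen N ν lam) (AKPZ.genA N lam) ∧
    -- the cancellation, for arbitrary families of complex numbers
    (∀ v : AKPZ.Mode → ℂ, ∑' p : AKPZ.Mode × AKPZ.Mode,
      (AKPZ.K N p.1 p.2 : ℂ) * v p.1 * v p.2 * v (-p.1 - p.2) = 0) :=
  open AKPZ in
  ⟨isInvariant_map_modes hη N hν lam,
    fun _ hF v => let ⟨_, hM⟩ := hF.exists_isBoxFun
      (hM _ le_rfl).gen_eq N ν lam v,
    fun _ hF => hF.memLp_two hη,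
    (isBoxOperator_gen N ν lam).mapsToL2 hη,
    (isBoxOperator_genS ν N).mapsToL2 hη,
    (isBoxOperator_genA N lam).mapsToL2 hη,
    isSymmetricPart_genS hη N ν lam,
    isAntisymmetricPart_genA hη N ν lam,
    tsum_triad_eq_zero N⟩
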